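/- Let $Q\ge 8$ be even, $\mathbf k_j=(\cos\frac{2\pi (j-1)}{Q},\sin\frac{2\pi (j-1)}{Q})$ for $1\le j\le Q$, and $\Gamma=\{\sum_j m_j\mathbf k_j:\ m\in\mathbb N^Q\}\subset\mathbb R^2$. For $\mathbf k\in\Gamma$ let $N_{\mathbf k}=\min\{\sum_j m_j:\ \mathbf k=\sum_j m_j\mathbf k_j\}$. For $s\in\mathbb R$ let $\mathcal H_s$ be the Hilbert space of (formal) Fourier series $U=\sum_{\mathbf k\in\Gamma}U_{\mathbf k}e^{i\mathbf k\cdot\mathbf x}$ with $\|U\|_s^2=\sum_{\mathbf k}(1+N_{\mathbf k}^2)^s|U_{\mathbf k}|^2<\infty$; on it $(1+\Delta)^2$ multiplies $U_{\mathbf k}$ by $(1-|\mathbf k|^2)^2$, and products are given by convolution of coefficients. Let $l=\frac12\varphi(Q)-1$ ($\varphi$ is Euler's function), $\beta=3(Q-1)$, and let $s>Q/4$. 1. There is a unique sequence $U^{(n)}\in\mathcal H_s$, $n\ge0$, invariant under the rotation by $2\pi/Q$, with $U^{(0)}=\sum_{j}e^{i\mathbf k_j\cdot\mathbf x}$, such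 that $U=\sqrt{\mu/\beta}\sum_{n\ge0}\mu^nU^{(n)}$ solves formally the steady Swift--Hohenberg equation $(1+\Delta)^2U-\mu U+U^3=0$, i.e. $(1+\Delta)^2U^{(0)}=0$ and $(1+\Delta)^2U^{(n+1)}=U^{(n)}-\beta^{-1}\sum_{p+q+r=n}U^{(p)}U^{(q)}U^{(r)}$ for $n\ge0$. There are $K,\gamma>0$ with $\|U^{(n)}\|_s\le\gamma K^n(n!)^{4l}$ for all $n\ge0$. 2. Let $K,\gamma>0$ be any constants for which this bound holds. Then the Borel transform $\hat U(\zeta)=\beta^{-1/2}\sum_{n\ge0}\frac{\zeta^{4ln+2l}}{(4ln+2l)!}U^{(n)}$ converges in $\mathcal H_s$ and is analytic for $|\zeta|<K^{-1/(4l)}$. For every $K'>K^{1/(4l)}$ the truncated Laplace transform $$\bar U(\nu)=\frac1\nu\int_0^{1/K'}e^{-\zeta/\nu}\hat U(\zeta)\,d\zeta\quad(\nu>0),\qquad \bar U(0)=0,$$ has the following properties. (a) $\nu\mapsto\bar U(\nu)\in\mathcal H_s$ is $C^\infty$ on $[0,\infty)$. (b) For all $N\ge 0$, $\big\|\bar U(\mu^{1/(4l)})-\sqrt{\mu/\beta}\sum_{n<N}\mu^nU^{(n)}\big\|_s=O(\mu^{N+1/2})$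 as $\mu\to0^+$. (c) For every $\mu>0$, $\bar U(\mu^{1/(4l)})$ is the Fourier series, convergent at every point, of a real $C^\infty$ function on $\mathbb R^2$ that is invariant under the rotation by $2\pi/Q$. (d) For every $\mu_0>0$ there is $C=C(K',\mu_0)>0$ (depending also on $Q,s$) such that for $0<\mu\le\mu_0$, with $\bar U=\bar U(\mu^{1/(4l)})$, the residual $(1+\Delta)^2\bar U-\mu\bar U+\bar U^3$ lies in $\mathcal H_{s-4}$ and $$\big\|(1+\Delta)^2\bar U-\mu\bar U+\bar U^3\big\|_{s-4}\le C\,e^{-\frac{1}{K'\mu^{1/(4l)}}}.$$ -/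

import Mathlib

open Filter Topology

noncomputable section

namespace SwiftHohenberg

/-- The plane is `ℂ`, with its real inner product `inner ℝ k x` (the dot product of `ℝ²`).
The wavevectors are `(cos (2πj/Q), sin (2πj/Q))`, `0 ≤ j < Q`. -/
def wavevector (Q : ℕ) (j : Fin Q) : ℂ :=
  ⟨Real.cos (2 * Real.pi * (j : ℝ) / Q), Real.sin (2 * Real.pi * (j : ℝ) / Q)⟩

/-- The quasilattice: combinations of the wavevectors with coefficients in `ℕ`. -/
def Quasilattice (Q : ℕ) : AddSubmonoid ℂ where
  carrier := {k | ∃ m : Fin Q → ℕ, k = ∑ j, (m j : ℂ) * wavevector Q j}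
  zero_mem' := ⟨0, by simp⟩
  add_mem' := by
    rintro a b ⟨m, rfl⟩ ⟨m', rfl⟩
    exact ⟨m + m', by simp [add_mul, Finset.sum_add_distrib]⟩

/-- The order `N_k`: the least `∑ m_j` over all representations `k = ∑ m_j k_j`. -/
def order {Q : ℕ} (k : Quasilattice Q) : ℕ :=
  sInf {n | ∃ m : Fin Q → ℕ, (k : ℂ) = ∑ j, (m j : ℂ) * wavevector Q j ∧ n = ∑ j, m j}

/-- The weight `(1 + N_k²)^s`. -/
def weight {Q : ℕ} (s : ℝ) (k : Quasilattice Q) : ℝ := (1 + (order k : ℝ) ^ 2) ^ s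

theorem weight_pos {Q : ℕ} (s : ℝ) (k : Quasilattice Q) : 0 < weight s k := by
  unfold weight; positivity

/-- The families of Fourier coefficients `(U_k)` with `∑ (1 + N_k²)^s |U_k|² < ∞`. -/
def hsSubmodule (Q : ℕ) (s : ℝ) : Submodule ℂ (Quasilattice Q → ℂ) where
  carrier := {c | Summable fun k => weight s k * ‖c k‖ ^ 2}
  zero_mem' := by simp
  add_mem' := by
    intro a b ha hb
    refine Summable.of_nonneg_of_le
      (fun k => mul_nonneg (weight_pos s k).le (sq_nonneg _)) (fun k => ?_)
      ((ha.mul_left 2).add (hb.mul_left 2))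
    have h1 : ‖a k + b k‖ ^ 2 ≤ 2 * ‖a k‖ ^ 2 + 2 * ‖b k‖ ^ 2 := by
      nlinarith [norm_add_le (a k) (b k), norm_nonneg (a k + b k), sq_nonneg (‖a k‖ - ‖b k‖)]
    have := mul_le_mul_of_nonneg_left h1 (weight_pos s k).le
    simp only [Pi.add_apply]
    linarith
  smul_mem' := by
    intro z a ha
    have : (fun k => weight s k * ‖(z • a) k‖ ^ 2)
        = fun k => ‖z‖ ^ 2 * (weight s k * ‖a k‖ ^ 2) := by
      funext k
      simp only [Pi.smul_apply, smul_eq_mul, norm_mul]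
      ring
    simp only [Set.mem_ofPred_eq, this]
    exact ha.mul_left _

/-- The space `H_s`; its norm is `‖U‖² = ∑ (1 + N_k²)^s |U_k|²`, see `HSpace.norm_sq_eq`. -/
def HSpace (Q : ℕ) (s : ℝ) : Type := hsSubmodule Q s

namespace HSpace

variable {Q : ℕ} {s : ℝ}

instance : AddCommGroup (HSpace Q s) := inferInstanceAs (AddCommGroup (hsSubmodule Q s))
instance : Module ℂ (HSpace Q s) := inferInstanceAs (Module ℂ (hsSubmodule Q s))

/-- The Fourier coefficients of an element of `H_s`. -/
def coeff (U : HSpace Q s) : Quasilattice Q → ℂ := U.1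

theorem sqrt_weight_norm_sq (c : ℂ) (k : Quasilattice Q) :
    ‖(Real.sqrt (weight s k) : ℂ) * c‖ ^ 2 = weight s k * ‖c‖ ^ 2 := by
  rw [norm_mul, mul_pow, Complex.norm_real, Real.norm_eq_abs, sq_abs,
    Real.sq_sqrt (weight_pos s k).le]

theorem memlp_iff (c : Quasilattice Q → ℂ) :
    Memℓp (fun k => (Real.sqrt (weight s k) : ℂ) * c k) 2 ↔ c ∈ hsSubmodule Q s := by
  rw [memℓp_gen_iff (by norm_num)]
  have : (fun k => ‖(Real.sqrt (weight s k) : ℂ) * c k‖ ^ (2 : ENNReal).toReal)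
      = fun k => weight s k * ‖c k‖ ^ 2 := by
    funext k
    rw [← sqrt_weight_norm_sq]
    norm_num
  rw [this]
  rfl

/-- The identification of `H_s` with `ℓ²` of the quasilattice, through the weights. -/
def toL2 : HSpace Q s ≃ₗ[ℂ] lp (fun _ : Quasilattice Q => ℂ) 2 where
  toFun U := ⟨fun k => (Real.sqrt (weight s k) : ℂ) * coeff U k, (memlp_iff _).2 U.2⟩
  map_add' U V := by
    ext k
    exact mul_add _ _ _
  map_smul' z U := by
    ext k
    exact mul_left_comm _ z (coeff U k)
  invFun f := ⟨fun k => (Real.sqrt (weight s k) : ℂ)⁻¹ * f k, (memlp_iff _).1 (by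
    have : (fun k => (Real.sqrt (weight s k) : ℂ) * ((Real.sqrt (weight s k) : ℂ)⁻¹ * f k))
        = fun k => f k := by
      funext k
      have h : (Real.sqrt (weight s k) : ℂ) ≠ 0 :=
        Complex.ofReal_ne_zero.2 (Real.sqrt_pos.2 (weight_pos s k)).ne'
      rw [mul_inv_cancel_left₀ h]
    rw [this]
    exact f.2)⟩
  left_inv U := by
    apply Subtype.ext
    funext k
    have h : (Real.sqrt (weight s k) : ℂ) ≠ 0 :=
      Complex.ofReal_ne_zero.2 (Real.sqrt_pos.2 (weight_pos s k)).ne'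
    exact inv_mul_cancel_left₀ h _
  right_inv f := by
    ext k
    have h : (Real.sqrt (weight s k) : ℂ) ≠ 0 :=
      Complex.ofReal_ne_zero.2 (Real.sqrt_pos.2 (weight_pos s k)).ne'
    exact mul_inv_cancel_left₀ h _

instance : NormedAddCommGroup (HSpace Q s) :=
  NormedAddCommGroup.induced (HSpace Q s) (lp (fun _ : Quasilattice Q => ℂ) 2)
    (toL2 (Q := Q) (s := s)) toL2.injective

instance : NormedSpace ℂ (HSpace Q s) :=
  NormedSpace.induced ℂ (HSpace Q s) (lp (fun _ : Quasilattice Q => ℂ) 2)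
    (toL2 (Q := Q) (s := s) : HSpace Q s →ₗ[ℂ] lp (fun _ : Quasilattice Q => ℂ) 2)

theorem norm_sq_eq (U : HSpace Q s) : ‖U‖ ^ 2 = ∑' k, weight s k * ‖coeff U k‖ ^ 2 := by
  have h := lp.norm_rpow_eq_tsum (p := 2) (by norm_num) (toL2 U)
  have h2 : ‖U‖ = ‖toL2 U‖ := rfl
  have h3 : ∀ k, ‖(toL2 U) k‖ ^ (2 : ENNReal).toReal = weight s k * ‖coeff U k‖ ^ 2 := by
    intro k
    rw [← sqrt_weight_norm_sq, ENNReal.toReal_ofNat]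
    exact Real.rpow_natCast _ 2
  simp only [h3] at h
  rw [h2, ← h]
  norm_num

instance : CompleteSpace (HSpace Q s) := by
  have hiso : Isometry (toL2 (Q := Q) (s := s)) :=
    AddMonoidHomClass.isometry_of_norm (toL2 (Q := Q) (s := s)) fun _ => rfl
  let e : HSpace Q s ≃ᵢ lp (fun _ : Quasilattice Q => ℂ) 2 := ⟨toL2.toEquiv, hiso⟩
  exact e.completeSpace

end HSpace


open SwiftHohenberg.HSpace

/-- Fourier coefficients of the product of two functions. -/
def conv {Q : ℕ} (a b : Quasilattice Q → ℂ) (k : Quasilattice Q) : ℂ :=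
  ∑' p : {p : Quasilattice Q × Quasilattice Q // p.1 + p.2 = k}, a p.1.1 * b p.1.2

/-- Fourier coefficients of `(1 + Δ)² U`. -/
def linOp {Q : ℕ} (a : Quasilattice Q → ℂ) (k : Quasilattice Q) : ℂ :=
  (1 - (‖(k : ℂ)‖ : ℂ) ^ 2) ^ 2 * a k

/-- Fourier coefficients of the residual `(1 + Δ)² U - μ U + U³`. -/
def shResidual {Q : ℕ} (μ : ℝ) (a : Quasilattice Q → ℂ) (k : Quasilattice Q) : ℂ :=
  linOp a k - μ * a k + conv (conv a a) a k

/-- Rotation of the plane by the angle `2π/Q`. -/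
def rot (Q : ℕ) (x : ℂ) : ℂ := Complex.exp (2 * Real.pi * Complex.I / Q) * x

/-- Invariance under rotations by `2π/Q`, on Fourier coefficients. -/
def RotInvariant {Q : ℕ} (a : Quasilattice Q → ℂ) : Prop :=
  ∀ k k' : Quasilattice Q, (k' : ℂ) = rot Q k → a k' = a k

/-- The constant `β = 3(Q - 1)`. -/
def beta (Q : ℕ) : ℝ := 3 * ((Q : ℝ) - 1)

/-- `√(μ/β) ∑ μⁿ U⁽ⁿ⁾` is a formal solution of `(1 + Δ)² U - μ U + U³ = 0` with rotationally
invariant coefficients in `H_s` and leading term `U⁽⁰⁾ = ∑ⱼ exp(i kⱼ·x)`. -/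
structure IsFormalSolution {Q : ℕ} {s : ℝ} (U : ℕ → HSpace Q s) : Prop where
  leading : ∀ k : Quasilattice Q,
    ((∃ j, (k : ℂ) = wavevector Q j) → coeff (U 0) k = 1) ∧
    ((¬ ∃ j, (k : ℂ) = wavevector Q j) → coeff (U 0) k = 0)
  invariant : ∀ n, RotInvariant (coeff (U n))
  order_zero : ∀ k, linOp (coeff (U 0)) k = 0
  order_succ : ∀ n k, linOp (coeff (U (n + 1))) k = coeff (U n) k - (beta Q : ℂ)⁻¹ *
    ∑ p ∈ Finset.HasAntidiagonal.antidiagonal n, ∑ q ∈ Finset.HasAntidiagonal.antidiagonal p.2,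
      conv (conv (coeff (U p.1)) (coeff (U q.1))) (coeff (U q.2)) k

/-- `l = φ(Q)/2 - 1`. -/
def ell (Q : ℕ) : ℕ := Nat.totient Q / 2 - 1

/-- Gevrey bound on the coefficients of the formal series. -/
def GevreyBound {Q : ℕ} {s : ℝ} (U : ℕ → HSpace Q s) (γ K : ℝ) : Prop :=
  ∀ n, ‖U n‖ ≤ γ * K ^ n * (n.factorial : ℝ) ^ (4 * ell Q)

/-- Terms of the Borel transform in `ζ` of `β^{-1/2} ζ^{2l} ∑ ζ^{4ln} U⁽ⁿ⁾`, the formal series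
written in the variable `ζ = μ^{1/(4l)}`. -/
def borelTerm {Q : ℕ} {s : ℝ} (U : ℕ → HSpace Q s) (ζ : ℂ) (n : ℕ) : HSpace Q s :=
  (((Real.sqrt (beta Q))⁻¹ : ℝ) * ζ ^ (4 * ell Q * n + 2 * ell Q) /
    ((4 * ell Q * n + 2 * ell Q).factorial : ℂ)) • U n

/-- The Borel transform. -/
def borelTransform {Q : ℕ} {s : ℝ} (U : ℕ → HSpace Q s) (ζ : ℂ) : HSpace Q s :=
  ∑' n, borelTerm U ζ n

/-- The truncated Laplace transform `(1/ν) ∫₀^{1/K'} e^{-ζ/ν} Û(ζ) dζ`. For `ν = 0` the formula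
returns `0`, which is the limit as `ν → 0+`. -/
def truncLaplace {Q : ℕ} {s : ℝ} (U : ℕ → HSpace Q s) (K' ν : ℝ) : HSpace Q s :=
  ν⁻¹ • ∫ ζ in (0 : ℝ)..(1 / K'), Real.exp (-ζ / ν) • borelTransform U (ζ : ℂ)

end SwiftHohenberg

end

open SwiftHohenberg SwiftHohenberg.HSpace

/-! On Fourier coefficients `(1 + Δ)²` is multiplication by `(1 - |k|²)²`. This symbol vanishes only
at the wavevectors: if `|k| = 1`, all conjugates of `k` in the cyclotomic field have modulus one, so
`k` is a root of unity by Kronecker's theorem (`exists_eq_wavevector_of_norm_eq_one`). Rotation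
invariance reduces the kernel to the line of `U⁽⁰⁾`, and each order of the formal equation has a
single solvability condition. The cube of `U⁽⁰⁾` has coefficient `β` at each wavevector
(`coeff_leadingPoly_cube`), which settles the first condition; adding `a U⁽⁰⁾` to `U⁽ⁿ⁺¹⁾` changes
the next one by `a - 3a`, so `a` is determined. This gives existence and uniqueness.

For the Gevrey bound, `|k|² - 1` is an algebraic integer of a field of degree `2l + 2`. Off the unit
circle its norm is a nonzero integer. Two embeddings give it the modulus `||k|² - 1|` and the others
at most `1 + N_k²`, so `(1 - |k|²)⁻² ≤ (1 + N_k²)^(2l)` (`small_divisor`). The support of `U⁽ⁿ⁾`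
lies in orders at most `2n + 1`, so one step of the recursion costs a constant times `(n + 1)^(4l)`.
Since `s > Q/4` makes `H_s` an algebra (`conv_estimate`), a majorant argument
(`exists_gevrey_bound`) yields `Kⁿ (n!)^(4l)`.

Integrating the Borel series term by term gives `Ū(ν) = ∑ T_{p(n)}(ν) Wₙ`, with `p(n) = 4ln + 2l`,
`Wₙ = β^(-1/2) U⁽ⁿ⁾`, `a = 1/K'` and `T_p(ν) = ν^p γ_p(a/ν)` for the normalized incomplete Gamma
function `γ_p` (`hasSum_truncLaplace`). Since `0 ≤ T_p ≤ a^p/p!`, the Gevrey bound makes the series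
converge, even with polynomial factors in `p(n)`. The rest are estimates on the scalars `T_p`. Their
derivatives cost powers of `p` (smoothness). The difference `T_p - ν^p` is flat at zero
(asymptotics). Up to `e^(-a/ν)` times summable constants, `T_p T_q T_r` is `T_{p+q+r}` and
`T_{p+4l}` is `ν^(4l) T_p`. As `p(i) + p(j) + p(k) = p(i+j+k+1)`, summing the recursion against
`T_{p(n+1)}` shows that `Ū` solves the equation up to `O(e^(-a/ν))` (`exists_residual_le`).
Pointwise smoothness in the plane comes from the supports of the `U⁽ⁿ⁾`, as `H_s` alone gives only
finitely many derivatives. -/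

noncomputable section
namespace SwiftHohenberg

/-! ### Roots of unity, the quasilattice and its order function. -/

section Arithmetic

variable {Q : ℕ}

/-- The primitive root of unity `exp (2πi/Q)`. -/
def omega (Q : ℕ) : ℂ := Complex.exp (2 * Real.pi * Complex.I / Q)

theorem rot_eq (Q : ℕ) (x : ℂ) : rot Q x = omega Q * x := rfl

theorem omega_primitive (hQ : Q ≠ 0) : IsPrimitiveRoot (omega Q) Q :=
  Complex.isPrimitiveRoot_exp Q hQ

theorem omega_pow_self (hQ : Q ≠ 0) : omega Q ^ Q = 1 := (omega_primitive hQ).pow_eq_one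

theorem norm_omega (Q : ℕ) : ‖omega Q‖ = 1 := by
  have : omega Q = Complex.exp ((2 * Real.pi / Q : ℝ) * Complex.I) := by
    rw [omega]; congr 1; push_cast; ring
  rw [this, Complex.norm_exp_ofReal_mul_I]

theorem wavevector_eq (j : Fin Q) : wavevector Q j = omega Q ^ (j : ℕ) := by
  have h : omega Q ^ (j : ℕ) = Complex.exp ((2 * Real.pi * (j : ℝ) / Q : ℝ) * Complex.I) := by
    rw [omega, ← Complex.exp_nat_mul]; congr 1; push_cast; ring
  rw [h, Complex.exp_mul_I]
  apply Complex.ext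
  · simp [wavevector, Complex.cos_ofReal_re, Complex.sin_ofReal_re, Complex.sin_ofReal_im,
      -Complex.ofReal_div, -Complex.ofReal_mul]
  · simp [wavevector, Complex.sin_ofReal_re, Complex.sin_ofReal_im,
      Complex.cos_ofReal_im, -Complex.ofReal_div, -Complex.ofReal_mul]

theorem norm_wavevector (j : Fin Q) : ‖wavevector Q j‖ = 1 := by
  rw [wavevector_eq, norm_pow, norm_omega, one_pow]

theorem omega_pow_mod (hQ : Q ≠ 0) (i : ℕ) : omega Q ^ (i % Q) = omega Q ^ i := by
  conv_rhs => rw [← Nat.mod_add_div i Q, pow_add, pow_mul, omega_pow_self hQ, one_pow, mul_one]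

theorem omega_pow_eq_wavevector (hQ : Q ≠ 0) (i : ℕ) :
    omega Q ^ i = wavevector Q ⟨i % Q, Nat.mod_lt _ (Nat.pos_of_ne_zero hQ)⟩ := by
  rw [wavevector_eq, omega_pow_mod hQ]

theorem wavevector_mem (j : Fin Q) : wavevector Q j ∈ Quasilattice Q :=
  ⟨Pi.single j 1, by simp [Pi.single_apply]⟩

theorem omega_pow_mem (hQ : Q ≠ 0) (i : ℕ) : omega Q ^ i ∈ Quasilattice Q := by
  rw [omega_pow_eq_wavevector hQ]; exact wavevector_mem _

theorem omega_pow_mul_mem (hQ : Q ≠ 0) (i : ℕ) {k : ℂ} (hk : k ∈ Quasilattice Q) :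
    omega Q ^ i * k ∈ Quasilattice Q := by
  obtain ⟨m, rfl⟩ := hk
  rw [Finset.mul_sum]
  refine sum_mem fun j _ => ?_
  have : omega Q ^ i * ((m j : ℂ) * wavevector Q j) = m j • omega Q ^ (i + j) := by
    rw [wavevector_eq, nsmul_eq_mul, pow_add]; ring
  rw [this]
  exact nsmul_mem (omega_pow_mem hQ _) _

/-- Rotation by `2π/Q` as an automorphism of the quasilattice. -/
def rotEquiv (hQ : Q ≠ 0) : Quasilattice Q ≃+ Quasilattice Q where
  toFun k := ⟨omega Q * k, by simpa using omega_pow_mul_mem hQ 1 k.2⟩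
  invFun k := ⟨omega Q ^ (Q - 1) * k, omega_pow_mul_mem hQ _ k.2⟩
  left_inv k := by
    ext1
    change omega Q ^ (Q - 1) * (omega Q * (k : ℂ)) = k
    rw [← mul_assoc, pow_sub_one_mul hQ, omega_pow_self hQ, one_mul]
  right_inv k := by
    ext1
    change omega Q * (omega Q ^ (Q - 1) * (k : ℂ)) = k
    rw [← mul_assoc, mul_pow_sub_one hQ, omega_pow_self hQ, one_mul]
  map_add' k k' := by ext1; exact mul_add _ _ _

@[simp] theorem coe_rotEquiv (hQ : Q ≠ 0) (k : Quasilattice Q) :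
    (rotEquiv hQ k : ℂ) = omega Q * k := rfl

theorem rotInvariant_iff (hQ : Q ≠ 0) (a : Quasilattice Q → ℂ) :
    RotInvariant a ↔ ∀ k, a (rotEquiv hQ k) = a k := by
  constructor
  · intro h k
    exact h k _ rfl
  · intro h k k' hk
    rw [← h k]
    congr 1
    exact Subtype.ext hk

theorem norm_rotEquiv (hQ : Q ≠ 0) (k : Quasilattice Q) : ‖(rotEquiv hQ k : ℂ)‖ = ‖(k : ℂ)‖ := by
  simp [norm_omega]

/-- The wavevectors as elements of the quasilattice. -/
def wv (Q : ℕ) (j : Fin Q) : Quasilattice Q := ⟨wavevector Q j, wavevector_mem j⟩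

theorem wv_injective (hQ : Q ≠ 0) : Function.Injective (wv Q) := by
  intro i j h
  have h' : wavevector Q i = wavevector Q j := congrArg Subtype.val h
  rw [wavevector_eq, wavevector_eq] at h'
  exact Fin.ext ((omega_primitive hQ).pow_inj i.2 j.2 h')

theorem rotEquiv_wv (hQ : Q ≠ 0) (j : Fin Q) :
    rotEquiv hQ (wv Q j) = wv Q ⟨(j + 1) % Q, Nat.mod_lt _ (Nat.pos_of_ne_zero hQ)⟩ := by
  ext1
  change omega Q * wavevector Q j = wavevector Q _
  rw [← omega_pow_eq_wavevector hQ, wavevector_eq, pow_succ']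

/-- The number of wavevectors in a minimal representation. -/
theorem exists_order (k : Quasilattice Q) :
    ∃ m : Fin Q → ℕ, (k : ℂ) = ∑ j, (m j : ℂ) * wavevector Q j ∧ order k = ∑ j, m j := by
  have : {n | ∃ m : Fin Q → ℕ, (k : ℂ) = ∑ j, (m j : ℂ) * wavevector Q j ∧ n = ∑ j, m j}.Nonempty := by
    obtain ⟨m, hm⟩ := k.2
    exact ⟨_, m, hm, rfl⟩
  exact Nat.sInf_mem this

theorem order_le {k : Quasilattice Q} {m : Fin Q → ℕ}
    (h : (k : ℂ) = ∑ j, (m j : ℂ) * wavevector Q j) : order k ≤ ∑ j, m j :=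
  Nat.sInf_le ⟨m, h, rfl⟩

theorem order_add_le (k k' : Quasilattice Q) : order (k + k') ≤ order k + order k' := by
  obtain ⟨m, hm, h⟩ := exists_order k
  obtain ⟨m', hm', h'⟩ := exists_order k'
  rw [h, h', ← Finset.sum_add_distrib]
  refine order_le (m := m + m') ?_
  push_cast [hm, hm']
  simp [add_mul, Finset.sum_add_distrib]

theorem norm_le_order (k : Quasilattice Q) : ‖(k : ℂ)‖ ≤ order k := by
  obtain ⟨m, hm, h⟩ := exists_order k
  rw [h, hm]
  push_cast
  refine (norm_sum_le _ _).trans (Finset.sum_le_sum fun j _ => ?_)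
  rw [norm_mul, norm_wavevector, mul_one, Complex.norm_natCast]

theorem order_wv_le (j : Fin Q) : order (wv Q j) ≤ 1 := by
  have := order_le (k := wv Q j) (m := Pi.single j 1) (by simp [Pi.single_apply, wv])
  simpa [Finset.sum_pi_single'] using this

/-- The residues `1`, `Q - 1` and one strictly between them are prime to `Q`, so `φ(Q) ≥ 3`; as
`φ(Q)` is even it is at least `4`. Hence the natural-number operations in `ell` lose nothing. -/
theorem ell_pos (hQ : Even Q) (hQ8 : 8 ≤ Q) : 1 ≤ ell Q ∧ Nat.totient Q = 2 * ell Q + 2 := by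
  have h4 : 3 ≤ Nat.totient Q := by
    obtain ⟨b, hb⟩ : ∃ b, 1 < b ∧ b < Q - 1 ∧ Nat.Coprime Q b := by
      obtain ⟨m, rfl⟩ := hQ
      rcases Nat.even_or_odd m with hm | hm
      · refine ⟨m - 1, by omega, by omega, ?_⟩
        rw [← two_mul]
        refine Nat.Coprime.mul_left ?_ ?_
        · exact (Nat.coprime_two_left).2 (Nat.Even.sub_odd (by omega) hm odd_one)
        · rw [Nat.coprime_comm]; exact Nat.coprime_self_sub_left (by omega) |>.2 (by simp)
      · refine ⟨m - 2, by omega, by omega, ?_⟩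
        have h2 : Nat.Coprime 2 (m - 2) :=
          (Nat.coprime_two_left).2 (Nat.Odd.sub_even (by omega) hm even_two)
        rw [← two_mul]
        refine Nat.Coprime.mul_left h2 ?_
        rw [Nat.coprime_comm, Nat.coprime_self_sub_left (by omega)]
        exact (Nat.coprime_two_left).2 hm
    rw [Nat.totient_eq_card_coprime]
    have hs : ({1, b, Q - 1} : Finset ℕ) ⊆ (Finset.range Q).filter (Nat.Coprime Q) := by
      intro x hx
      simp only [Finset.mem_insert, Finset.mem_singleton] at hx
      simp only [Finset.mem_filter, Finset.mem_range]
      rcases hx with rfl | rfl | rfl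
      · exact ⟨by omega, by simp⟩
      · exact ⟨by omega, hb.2.2⟩
      · refine ⟨by omega, ?_⟩
        rw [Nat.coprime_comm, Nat.coprime_self_sub_left (by omega)]
        simp
    refine le_trans (le_of_eq ?_) (Finset.card_le_card hs)
    rw [Finset.card_eq_three.2 ⟨1, b, Q - 1, by omega, by omega, by omega, rfl⟩]
  have he : Even (Nat.totient Q) := Nat.totient_even (by omega)
  obtain ⟨r, hr⟩ := he
  unfold ell
  omega

/-- If the sum of three unit vectors of the plane is a unit vector, two of them are opposite. -/
theorem opposite_of_norm_add_eq_one {x y z : ℂ} (hx : ‖x‖ = 1) (hy : ‖y‖ = 1) (hz : ‖z‖ = 1)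
    (h : ‖x + y + z‖ = 1) : x + y = 0 ∨ y + z = 0 ∨ z + x = 0 := by
  have key : ∀ {u : ℂ}, ‖u‖ = 1 → u * (starRingEnd ℂ) u = 1 := by
    intro u hu
    rw [Complex.mul_conj, Complex.normSq_eq_norm_sq, hu]; norm_num
  have e1 := key hx
  have e2 := key hy
  have e3 := key hz
  have e4 := key h
  simp only [map_add] at e4
  set x' := (starRingEnd ℂ) x
  set y' := (starRingEnd ℂ) y
  set z' := (starRingEnd ℂ) z
  -- Since `ū = 1/u` on the circle, `|x + y + z|² = 1` multiplied by `xyz` reads `(x + y + z)(xy +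
  -- yz + zx) = xyz`, which is this factorization.
  have : (x + y) * (y + z) * (z + x) = 0 := by
    linear_combination (x*y*z) * e4 - (x + y + z) * (y*z) * e1 - (x + y + z) * (x*z) * e2
      - (x + y + z) * (x * y) * e3
  simpa [mul_eq_zero, or_assoc] using this

end Arithmetic
end SwiftHohenberg
end

noncomputable section
namespace SwiftHohenberg

/-! ### Kronecker's theorem and small divisors in the cyclotomic field. -/

section Diophantine

variable {Q : ℕ}

/-- Embeddings of the cyclotomic field correspond to primitive roots of unity, so one of them hits
`omega Q`; through it quasilattice vectors become images of algebraic integers. -/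
theorem exists_embedding (hQ : Q ≠ 0) :
    ∃ (ζ : CyclotomicField Q ℚ) (σ : CyclotomicField Q ℚ →ₐ[ℚ] ℂ),
      IsPrimitiveRoot ζ Q ∧ σ ζ = omega Q := by
  have : NeZero Q := ⟨hQ⟩
  have : IsCyclotomicExtension {Q} ℚ (CyclotomicField Q ℚ) :=
    CyclotomicField.isCyclotomicExtension Q ℚ
  have hζ := IsCyclotomicExtension.zeta_spec Q ℚ (CyclotomicField Q ℚ)
  let e := hζ.embeddingsEquivPrimitiveRoots ℂ (Polynomial.cyclotomic.irreducible_rat (NeZero.pos Q))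
  let w : primitiveRoots Q ℂ := ⟨omega Q, (mem_primitiveRoots (NeZero.pos Q)).2 (omega_primitive hQ)⟩
  refine ⟨_, e.symm w, hζ, ?_⟩
  have h : (e (e.symm w) : ℂ) = omega Q := by rw [e.apply_symm_apply]
  rw [← h]
  rfl

/-- Lift of a quasilattice vector, and of its complex conjugate, to the cyclotomic field. -/
theorem exists_lift (hQ : Q ≠ 0) {ζ : CyclotomicField Q ℚ} (hζ : IsPrimitiveRoot ζ Q)
    {σ₀ : CyclotomicField Q ℚ →ₐ[ℚ] ℂ} (hσ₀ : σ₀ ζ = omega Q) (k : Quasilattice Q) :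
    ∃ x x' : CyclotomicField Q ℚ, IsIntegral ℤ x ∧ IsIntegral ℤ x' ∧ σ₀ x = k ∧
      (∀ σ : CyclotomicField Q ℚ →+* ℂ, σ x' = (starRingEnd ℂ) (σ x)) ∧
      ∀ σ : CyclotomicField Q ℚ →+* ℂ, ‖σ x‖ ≤ order k := by
  obtain ⟨m, hm, hN⟩ := exists_order k
  have hint : IsIntegral ℤ ζ := hζ.isIntegral (Nat.pos_of_ne_zero hQ)
  have hint' : IsIntegral ℤ ζ⁻¹ := hζ.inv.isIntegral (Nat.pos_of_ne_zero hQ)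
  have hnorm : ∀ σ : CyclotomicField Q ℚ →+* ℂ, ‖σ ζ‖ = 1 := fun σ =>
    Complex.norm_eq_one_of_pow_eq_one (n := Q) (by rw [← map_pow, hζ.pow_eq_one, map_one]) hQ
  -- Replacing `ζ` by `ζ⁻¹` realizes complex conjugation under every embedding at once, because all
  -- conjugates of `ζ` have modulus one.
  refine ⟨∑ j : Fin Q, (m j : CyclotomicField Q ℚ) * ζ ^ (j : ℕ),
    ∑ j : Fin Q, (m j : CyclotomicField Q ℚ) * ζ⁻¹ ^ (j : ℕ), ?_, ?_, ?_, fun σ => ?_, fun σ => ?_⟩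
  · exact IsIntegral.sum _ fun j _ => (isIntegral_natCast _).mul (hint.pow _)
  · exact IsIntegral.sum _ fun j _ => (isIntegral_natCast _).mul (hint'.pow _)
  · rw [hm, map_sum]
    refine Finset.sum_congr rfl fun j _ => ?_
    rw [map_mul, map_natCast, map_pow, hσ₀, wavevector_eq]
  · simp only [map_sum, map_mul, map_natCast, map_pow, map_inv₀]
    refine Finset.sum_congr rfl fun j _ => ?_
    rw [Complex.inv_eq_conj (hnorm σ)]
  · rw [map_sum, hN]
    push_cast
    refine (norm_sum_le _ _).trans (Finset.sum_le_sum fun j _ => ?_)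
    rw [map_mul, map_natCast, map_pow, norm_mul, norm_pow, hnorm σ, one_pow, mul_one,
      Complex.norm_natCast]

theorem mul_conj_sub_one_eq (z : ℂ) : z * (starRingEnd ℂ) z - 1 = ((‖z‖ ^ 2 - 1 : ℝ) : ℂ) := by
  rw [Complex.mul_conj, Complex.normSq_eq_norm_sq]; push_cast; rfl

/-- The quasilattice vectors on the unit circle are the wavevectors. -/
theorem exists_eq_wavevector_of_norm_eq_one (hQ : Q ≠ 0) (hQe : Even Q) {k : Quasilattice Q}
    (hk : ‖(k : ℂ)‖ = 1) : ∃ j, (k : ℂ) = wavevector Q j := by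
  have : NeZero Q := ⟨hQ⟩
  have : IsCyclotomicExtension {Q} ℚ (CyclotomicField Q ℚ) :=
    CyclotomicField.isCyclotomicExtension Q ℚ
  obtain ⟨ζ, σ₀, hζ, hσ₀⟩ := exists_embedding hQ
  obtain ⟨x, x', hx, hx', hxk, hconj, -⟩ := exists_lift hQ hζ hσ₀ k
  have hσ₀inj : Function.Injective σ₀ := σ₀.toRingHom.injective
  have h1 : x * x' = 1 := by
    apply hσ₀inj
    rw [map_mul, map_one]
    have : σ₀ x' = (starRingEnd ℂ) (σ₀ x) := hconj σ₀.toRingHom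
    rw [this, ← sub_eq_zero, mul_conj_sub_one_eq, hxk, hk]
    norm_num
  have hall : ∀ φ : CyclotomicField Q ℚ →+* ℂ, ‖φ x‖ = 1 := by
    intro φ
    have h2 : φ x * (starRingEnd ℂ) (φ x) - 1 = 0 := by
      rw [← hconj, ← map_mul, h1, map_one, sub_self]
    rw [mul_conj_sub_one_eq] at h2
    have h3 : ‖φ x‖ ^ 2 - 1 = 0 := by exact_mod_cast h2
    have h4 : ‖φ x‖ ^ 2 = 1 := by linarith
    exact (pow_eq_one_iff_of_nonneg (norm_nonneg _) two_ne_zero).1 h4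
  obtain ⟨n, hn, hxn⟩ := NumberField.Embeddings.pow_eq_one_of_norm_eq_one (CyclotomicField Q ℚ) ℂ hx hall
  have hfin : IsOfFinOrder x := isOfFinOrder_iff_pow_eq_one.2 ⟨n, hn, hxn⟩
  have hprim := IsPrimitiveRoot.orderOf x
  have : NeZero (orderOf x) := ⟨hfin.orderOf_pos.ne'⟩
  have hdvd := NumberField.Units.dvd_torsionOrder_of_isPrimitiveRoot hprim
  -- For even `Q` the field contains exactly `Q` roots of unity (for odd `Q` there would be `2Q`),
  -- so `x` is a power of `ζ`.
  rw [IsCyclotomicExtension.Rat.torsionOrder_eq (n := Q), if_pos hQe] at hdvd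
  have hxQ : x ^ Q = 1 := orderOf_dvd_iff_pow_eq_one.1 hdvd
  obtain ⟨i, hi, hik⟩ := hζ.eq_pow_of_pow_eq_one hxQ
  refine ⟨⟨i, hi⟩, ?_⟩
  rw [wavevector_eq, ← hxk, ← hik, map_pow, hσ₀]

/-- The small divisor estimate. -/
theorem small_divisor (hQe : Even Q) (hQ8 : 8 ≤ Q) {k : Quasilattice Q}
    (hk : ‖(k : ℂ)‖ ≠ 1) :
    1 ≤ (1 - ‖(k : ℂ)‖ ^ 2) ^ 2 * (1 + (order k : ℝ) ^ 2) ^ (2 * ell Q) := by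
  have hQ : Q ≠ 0 := by omega
  have : NeZero Q := ⟨hQ⟩
  have : IsCyclotomicExtension {Q} ℚ (CyclotomicField Q ℚ) :=
    CyclotomicField.isCyclotomicExtension Q ℚ
  obtain ⟨ζ, σ₀, hζ, hσ₀⟩ := exists_embedding hQ
  obtain ⟨x, x', hx, hx', hxk, hconj, hle⟩ := exists_lift hQ hζ hσ₀ k
  set y := x * x' - 1 with hy
  have hyint : IsIntegral ℤ y := (hx.mul hx').sub isIntegral_one
  have hσy : ∀ σ : CyclotomicField Q ℚ →ₐ[ℚ] ℂ, σ y = ((‖σ x‖ ^ 2 - 1 : ℝ) : ℂ) := by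
    intro σ
    have : σ x' = (starRingEnd ℂ) (σ x) := hconj σ.toRingHom
    rw [hy, map_sub, map_mul, map_one, this, mul_conj_sub_one_eq]
  have hy0 : y ≠ 0 := by
    intro h0
    have h1 := hσy σ₀
    rw [h0, map_zero, hxk] at h1
    have h2 : ‖(k : ℂ)‖ ^ 2 - 1 = 0 := by exact_mod_cast h1.symm
    exact hk ((pow_eq_one_iff_of_nonneg (norm_nonneg _) two_ne_zero).1 (by linarith))
  obtain ⟨n, hn⟩ := IsIntegrallyClosed.isIntegral_iff.1 (Algebra.isIntegral_norm ℚ hyint)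
  have hn0 : n ≠ 0 := by
    rintro rfl
    rw [map_zero] at hn
    exact hy0 (Algebra.norm_eq_zero_iff.1 hn.symm)
  have hprod := Algebra.norm_eq_prod_embeddings ℚ ℂ y
  have hge : 1 ≤ ∏ σ : CyclotomicField Q ℚ →ₐ[ℚ] ℂ, ‖σ y‖ := by
    rw [← norm_prod, ← hprod, ← hn]
    simp only [eq_intCast, map_intCast, Complex.norm_intCast]
    exact_mod_cast Int.one_le_abs hn0
  -- The conjugate embedding gives `y` the same modulus `||k|² - 1|`. This pair produces the square;
  -- the other `2l` factors are at most `1 + N_k²`.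
  let σ₁ : CyclotomicField Q ℚ →ₐ[ℚ] ℂ := (Complex.conjAe.toAlgHom.restrictScalars ℚ).comp σ₀
  have hσ₁ : ∀ z, σ₁ z = (starRingEnd ℂ) (σ₀ z) := fun z => rfl
  have hne : σ₀ ≠ σ₁ := by
    intro h
    have h1 : omega Q = (starRingEnd ℂ) (omega Q) := by
      rw [← hσ₀, ← hσ₁, ← h]
    have h2 : omega Q * (starRingEnd ℂ) (omega Q) = 1 := by
      rw [← sub_eq_zero, mul_conj_sub_one_eq, norm_omega]; norm_num
    rw [← h1, ← pow_two] at h2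
    have := (omega_primitive hQ).dvd_of_pow_eq_one 2 h2
    exact absurd (Nat.le_of_dvd (by norm_num) this) (by omega)
  classical
  have hsub : ({σ₀, σ₁} : Finset (CyclotomicField Q ℚ →ₐ[ℚ] ℂ)) ⊆ Finset.univ := Finset.subset_univ _
  rw [← Finset.prod_sdiff hsub, Finset.prod_pair hne] at hge
  have hcard : (Finset.univ \ ({σ₀, σ₁} : Finset (CyclotomicField Q ℚ →ₐ[ℚ] ℂ))).card = 2 * ell Q := by
    rw [Finset.card_sdiff_of_subset hsub, Finset.card_pair hne, Finset.card_univ,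
      AlgHom.card, IsCyclotomicExtension.finrank (n := Q) _
        (Polynomial.cyclotomic.irreducible_rat (NeZero.pos Q)), (ell_pos hQe hQ8).2]
    omega
  have h0 : ‖σ₀ y‖ * ‖σ₁ y‖ = (1 - ‖(k : ℂ)‖ ^ 2) ^ 2 := by
    rw [hσ₁, RCLike.norm_conj, hσy, hxk, Complex.norm_real, Real.norm_eq_abs, ← pow_two, sq_abs]
    ring
  rw [h0, mul_comm] at hge
  refine hge.trans (mul_le_mul_of_nonneg_left ?_ (sq_nonneg _))
  rw [← hcard]
  rw [← Finset.prod_const]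
  refine Finset.prod_le_prod (fun _ _ => norm_nonneg _) fun σ _ => ?_
  have hl := hle σ.toRingHom
  have hl' : ‖σ x‖ ≤ order k := hl
  rw [hσy, Complex.norm_real, Real.norm_eq_abs, abs_le]
  constructor
  · nlinarith [sq_nonneg ‖σ x‖, sq_nonneg (order k : ℝ)]
  · nlinarith [norm_nonneg (σ x)]

end Diophantine
end SwiftHohenberg
end

noncomputable section
namespace SwiftHohenberg

open SwiftHohenberg.HSpace

/-! ### The spaces `H_s`: summability of the inverse weights and the algebra property. -/

section Spaces

variable {Q : ℕ} {s : ℝ}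

/-- Coordinates of a quasilattice vector with respect to half of the wavevectors. -/
theorem exists_int_coordinates {d : ℕ} (hd : d ≠ 0) (k : Quasilattice (d + d)) :
    ∃ z : Fin d → ℤ, (k : ℂ) = ∑ j, (z j : ℂ) * omega (d + d) ^ (j : ℕ) ∧
      ∀ j, |z j| ≤ (order k : ℤ) := by
  obtain ⟨m, hm, hN⟩ := exists_order k
  have hprim := omega_primitive (Q := d + d) (by omega)
  have hneg : omega (d + d) ^ d = -1 := by
    have h1 : (omega (d + d) ^ d - 1) * (omega (d + d) ^ d + 1) = 0 := by
      have := hprim.pow_eq_one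
      rw [pow_add] at this
      linear_combination this
    rcases mul_eq_zero.1 h1 with h | h
    · have := hprim.dvd_of_pow_eq_one d (sub_eq_zero.1 h)
      exact absurd (Nat.le_of_dvd (by omega) this) (by omega)
    · exact eq_neg_of_add_eq_zero_left h
  -- The wavevectors of index `j` and `j + d` are opposite, so only the difference of their
  -- multiplicities remains.
  refine ⟨fun j => (m (Fin.castAdd d j) : ℤ) - m (Fin.natAdd d j), ?_, fun j => ?_⟩
  · rw [hm, Fin.sum_univ_add, ← Finset.sum_add_distrib]
    refine Finset.sum_congr rfl fun j _ => ?_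
    rw [wavevector_eq, wavevector_eq, Fin.val_castAdd, Fin.val_natAdd, pow_add, hneg]
    push_cast
    ring
  · have h1 : m (Fin.castAdd d j) ≤ order k := by
      rw [hN]; exact Finset.single_le_sum (fun _ _ => Nat.zero_le _) (Finset.mem_univ _)
    have h2 : m (Fin.natAdd d j) ≤ order k := by
      rw [hN]; exact Finset.single_le_sum (fun _ _ => Nat.zero_le _) (Finset.mem_univ _)
    dsimp only
    rw [abs_le]
    constructor <;> omega

/-- The integer coordinates inject the quasilattice into `ℤ^(Q/2)` with sup norm at most `N_k`. The
sum is thus dominated by that of `|z|^(-2s)`, which converges for `2s > Q/2`. -/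
theorem summable_inv_weight (hQ : Even Q) (hQ0 : Q ≠ 0) (hs : (Q : ℝ) / 4 < s) :
    Summable fun k : Quasilattice Q => (weight s k)⁻¹ := by
  obtain ⟨d, rfl⟩ := hQ
  have hd : d ≠ 0 := by omega
  have hs0 : 0 < s := lt_of_le_of_lt (by positivity) hs
  let b := Pi.basisFun ℝ (Fin d)
  let L := Submodule.span ℤ (Set.range b)
  have hrank : Module.finrank ℤ L = d := by
    rw [Module.finrank_eq_card_basis (b.restrictScalars ℤ), Fintype.card_fin]
  have hsum := ZLattice.summable_norm_rpow L (-(2 * s)) (by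
    rw [hrank]; push_cast at hs; linarith)
  choose z hz hzle using exists_int_coordinates hd
  have hmem : ∀ k, (fun j => (z k j : ℝ)) ∈ L := by
    intro k
    have : (fun j => (z k j : ℝ)) = ∑ j, z k j • b j := by
      funext i
      simp [b, Pi.single_apply]
    rw [this]
    exact sum_mem fun j _ => L.smul_mem _ (Submodule.subset_span ⟨j, rfl⟩)
  let e : Quasilattice (d + d) → L := fun k => ⟨_, hmem k⟩
  have hinj : Function.Injective e := by
    intro k k' h
    have h1 : ∀ j, z k j = z k' j := fun j => by
      have : (z k j : ℝ) = z k' j := congrFun (congrArg Subtype.val h) j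
      exact_mod_cast this
    apply Subtype.ext
    rw [hz k, hz k']
    simp only [h1]
  -- The comparison fails at `k = 0`, where the inverse weight is `1` while `0 ^ (-(2 * s))`
  -- evaluates to `0`.
  refine Summable.of_norm_bounded_eventually (hsum.comp_injective hinj) ?_
  refine (Set.finite_singleton (0 : Quasilattice (d + d))).subset ?_
  intro k hk
  by_contra hk0
  apply hk
  have he0 : e k ≠ 0 := by
    intro h
    apply hk0
    have h1 : ∀ j, z k j = 0 := fun j => by
      have : (z k j : ℝ) = 0 := congrFun (congrArg Subtype.val h) j
      exact_mod_cast this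
    apply Subtype.ext
    rw [hz k]
    simp [h1]
  have hpos : 0 < ‖e k‖ := norm_pos_iff.2 he0
  have hle : ‖e k‖ ≤ order k := by
    change ‖fun j => (z k j : ℝ)‖ ≤ _
    refine (pi_norm_le_iff_of_nonneg (Nat.cast_nonneg _)).2 fun j => ?_
    rw [Real.norm_eq_abs]
    exact_mod_cast hzle k j
  change ‖(weight s k)⁻¹‖ ≤ ‖e k‖ ^ (-(2 * s))
  rw [norm_inv, Real.norm_of_nonneg (weight_pos s k).le, Real.rpow_neg hpos.le]
  refine inv_anti₀ (by positivity) ?_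
  rw [Real.rpow_mul hpos.le]
  refine Real.rpow_le_rpow (by positivity) ?_ hs0.le
  rw [Real.rpow_two]
  nlinarith

theorem one_le_weight (hs : 0 ≤ s) (k : Quasilattice Q) : 1 ≤ weight s k :=
  Real.one_le_rpow (by nlinarith [sq_nonneg (order k : ℝ)]) hs

/-- The larger of the two orders is at least half the order of the sum; halving costs the factor
`4^s`. -/
theorem weight_add_le (hs : 0 ≤ s) (p q : Quasilattice Q) :
    weight s (p + q) ≤ 4 ^ s * (weight s p + weight s q) := by
  wlog h : order p ≤ order q generalizing p q
  · rw [add_comm p, add_comm (weight s p)]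
    exact this q p (by omega)
  have h1 : (order (p + q) : ℝ) ≤ 2 * order q := by
    have := order_add_le p q
    exact_mod_cast (by omega : order (p + q) ≤ 2 * order q)
  have h2 : weight s (p + q) ≤ 4 ^ s * weight s q := by
    unfold weight
    rw [← Real.mul_rpow (by norm_num) (by positivity)]
    refine Real.rpow_le_rpow (by positivity) ?_ hs
    nlinarith [Nat.cast_nonneg (α := ℝ) (order (p + q))]
  refine h2.trans (mul_le_mul_of_nonneg_left ?_ (by positivity))
  linarith [weight_pos s p]

/-- The Cauchy-Schwarz inequality for series of nonnegative terms. -/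
theorem summable_and_tsum_mul_sq_le {ι : Type*} {f g : ι → ℝ} (hf0 : ∀ i, 0 ≤ f i)
    (hg0 : ∀ i, 0 ≤ g i) (hf : Summable fun i => f i ^ 2) (hg : Summable fun i => g i ^ 2) :
    (Summable fun i => f i * g i) ∧
      (∑' i, f i * g i) ^ 2 ≤ (∑' i, f i ^ 2) * ∑' i, g i ^ 2 := by
  have hA : 0 ≤ ∑' i, f i ^ 2 := tsum_nonneg fun i => sq_nonneg _
  have hB : 0 ≤ ∑' i, g i ^ 2 := tsum_nonneg fun i => sq_nonneg _
  have hfin : ∀ t : Finset ι, ∑ i ∈ t, f i * g i ≤ √((∑' i, f i ^ 2) * ∑' i, g i ^ 2) := by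
    intro t
    refine Real.le_sqrt_of_sq_le ((Finset.sum_mul_sq_le_sq_mul_sq t f g).trans ?_)
    exact mul_le_mul (hf.sum_le_tsum t fun i _ => sq_nonneg _)
      (hg.sum_le_tsum t fun i _ => sq_nonneg _) (Finset.sum_nonneg fun i _ => sq_nonneg _) hA
  have h0 : ∀ i, 0 ≤ f i * g i := fun i => mul_nonneg (hf0 i) (hg0 i)
  refine ⟨summable_of_sum_le h0 hfin, ?_⟩
  have h1 := Real.tsum_le_of_sum_le h0 hfin
  calc _ ≤ √((∑' i, f i ^ 2) * ∑' i, g i ^ 2) ^ 2 := pow_le_pow_left₀ (tsum_nonneg h0) h1 2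
    _ = _ := Real.sq_sqrt (mul_nonneg hA hB)

theorem summable_coeff_sq (U : HSpace Q s) : Summable fun k => weight s k * ‖coeff U k‖ ^ 2 := U.2

@[simp] theorem coeff_add (U V : HSpace Q s) : coeff (U + V) = coeff U + coeff V := rfl
@[simp] theorem coeff_sub (U V : HSpace Q s) : coeff (U - V) = coeff U - coeff V := rfl
@[simp] theorem coeff_smul (c : ℂ) (U : HSpace Q s) : coeff (c • U) = c • coeff U := rfl
@[simp] theorem coeff_real_smul (c : ℝ) (U : HSpace Q s) : coeff (c • U) = (c : ℂ) • coeff U := rfl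
@[simp] theorem coeff_zero : coeff (0 : HSpace Q s) = 0 := rfl

theorem HSpace.ext {U V : HSpace Q s} (h : coeff U = coeff V) : U = V := Subtype.ext h

theorem norm_coeff_le (hs : 0 ≤ s) (U : HSpace Q s) (k : Quasilattice Q) : ‖coeff U k‖ ≤ ‖U‖ := by
  refine le_of_sq_le_sq ?_ (norm_nonneg U)
  rw [norm_sq_eq]
  have h := (summable_coeff_sq U).le_tsum k fun j _ =>
    mul_nonneg (weight_pos s j).le (sq_nonneg _)
  nlinarith [one_le_weight hs k, sq_nonneg ‖coeff U k‖]

/-- The Fourier coefficient at `k`, as a continuous linear functional. -/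
def coeffCLM (hs : 0 ≤ s) (k : Quasilattice Q) : HSpace Q s →L[ℂ] ℂ :=
  LinearMap.mkContinuous
    { toFun := fun U => coeff U k
      map_add' := fun _ _ => rfl
      map_smul' := fun _ _ => rfl } 1 fun U => by
    rw [one_mul]; exact norm_coeff_le hs U k

@[simp] theorem coeffCLM_apply (hs : 0 ≤ s) (k : Quasilattice Q) (U : HSpace Q s) :
    coeffCLM hs k U = coeff U k := rfl

/-- Cauchy-Schwarz against the inverse weights: `H_s` embeds in the absolutely convergent series. -/
theorem summable_norm_coeff (hw : Summable fun k : Quasilattice Q => (weight s k)⁻¹)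
    (U : HSpace Q s) : (Summable fun k => ‖coeff U k‖) ∧
      ∑' k, ‖coeff U k‖ ≤ √(∑' k : Quasilattice Q, (weight s k)⁻¹) * ‖U‖ := by
  have h1 : ∀ k : Quasilattice Q, (√(weight s k) * ‖coeff U k‖) ^ 2 = weight s k * ‖coeff U k‖ ^ 2 :=
    fun k => by rw [mul_pow, Real.sq_sqrt (weight_pos s k).le]
  have h2 : ∀ k : Quasilattice Q, (√(weight s k))⁻¹ ^ 2 = (weight s k)⁻¹ :=
    fun k => by rw [inv_pow, Real.sq_sqrt (weight_pos s k).le]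
  have h3 : ∀ k : Quasilattice Q, √(weight s k) * ‖coeff U k‖ * (√(weight s k))⁻¹ = ‖coeff U k‖ :=
    fun k => by
      have := (Real.sqrt_pos.2 (weight_pos s k)).ne'
      field_simp
  have := summable_and_tsum_mul_sq_le (f := fun k : Quasilattice Q => √(weight s k) * ‖coeff U k‖)
    (g := fun k => (√(weight s k))⁻¹) (fun k => by positivity) (fun k => by positivity)
    (by simpa only [h1] using summable_coeff_sq U) (by simpa only [h2] using hw)
  simp only [h1, h2, h3] at this
  refine ⟨this.1, ?_⟩
  rw [← norm_sq_eq] at this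
  have h4 := Real.le_sqrt_of_sq_le this.2
  rwa [Real.sqrt_mul (sq_nonneg _), Real.sqrt_sq (norm_nonneg _), mul_comm] at h4

/-- The inclusion of `H_s` into `H_t` for `t ≤ s`. -/
theorem exists_inclusion {t : ℝ} (hts : t ≤ s) (U : HSpace Q s) :
    ∃ R : HSpace Q t, coeff R = coeff U ∧ ‖R‖ ≤ ‖U‖ := by
  have hw : ∀ k : Quasilattice Q, weight t k * ‖coeff U k‖ ^ 2 ≤ weight s k * ‖coeff U k‖ ^ 2 :=
    fun k => mul_le_mul_of_nonneg_right
      (Real.rpow_le_rpow_of_exponent_le (by nlinarith [sq_nonneg (order k : ℝ)]) hts) (sq_nonneg _)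
  have hsum : Summable fun k => weight t k * ‖coeff U k‖ ^ 2 :=
    Summable.of_nonneg_of_le (fun k => mul_nonneg (weight_pos t k).le (sq_nonneg _)) hw
      (summable_coeff_sq U)
  let R : HSpace Q t := ⟨coeff U, hsum⟩
  refine ⟨R, rfl, le_of_sq_le_sq ?_ (norm_nonneg U)⟩
  rw [norm_sq_eq, norm_sq_eq]
  exact hsum.tsum_le_tsum hw (summable_coeff_sq U)

/-- Cauchy-Schwarz on the fibre `p + q = k` separates `w_p |U_p|² w_q |V_q|²`, whose sum over all
fibres is `‖U‖² ‖V‖²`, from `∑ 1/(w_p w_q)`. By `weight_add_le`, `w_k/(w_p w_q) ≤ 4^s (1/w_p +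
1/w_q)`, so `w_k` times the latter is bounded uniformly in `k`. -/
theorem conv_estimate (hs : 0 ≤ s) (hw : Summable fun k : Quasilattice Q => (weight s k)⁻¹)
    (U V : HSpace Q s) :
    (∀ k, Summable fun p : {p : Quasilattice Q × Quasilattice Q // p.1 + p.2 = k} =>
      ‖coeff U p.1.1‖ * ‖coeff V p.1.2‖) ∧
    (Summable fun k => weight s k * ‖conv (coeff U) (coeff V) k‖ ^ 2) ∧
    ∑' k, weight s k * ‖conv (coeff U) (coeff V) k‖ ^ 2 ≤
      (2 * 4 ^ s * ∑' k : Quasilattice Q, (weight s k)⁻¹) * (‖U‖ ^ 2 * ‖V‖ ^ 2) := by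
  set S := ∑' k : Quasilattice Q, (weight s k)⁻¹ with hS
  let F : Quasilattice Q × Quasilattice Q → ℝ := fun p =>
    (weight s p.1 * ‖coeff U p.1‖ ^ 2) * (weight s p.2 * ‖coeff V p.2‖ ^ 2)
  have hF0 : ∀ p, 0 ≤ F p := fun p => mul_nonneg
    (mul_nonneg (weight_pos s _).le (sq_nonneg _)) (mul_nonneg (weight_pos s _).le (sq_nonneg _))
  have hF : HasSum F (‖U‖ ^ 2 * ‖V‖ ^ 2) := by
    rw [norm_sq_eq, norm_sq_eq]
    have hsm : Summable F := (summable_coeff_sq U).mul_of_nonneg (summable_coeff_sq V)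
      (fun k => mul_nonneg (weight_pos s k).le (sq_nonneg _))
      (fun k => mul_nonneg (weight_pos s k).le (sq_nonneg _))
    exact (summable_coeff_sq U).hasSum.mul (summable_coeff_sq V).hasSum hsm
  let e := Equiv.sigmaFiberEquiv (fun p : Quasilattice Q × Quasilattice Q => p.1 + p.2)
  have hFe : HasSum (F ∘ e) (‖U‖ ^ 2 * ‖V‖ ^ 2) := e.hasSum_iff.2 hF
  have hFk : ∀ k, Summable fun p : {p : Quasilattice Q × Quasilattice Q // p.1 + p.2 = k} => F p.1 :=
    fun k => hF.summable.subtype _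
  have hA : HasSum (fun k => ∑' p : {p : Quasilattice Q × Quasilattice Q // p.1 + p.2 = k}, F p.1)
      (‖U‖ ^ 2 * ‖V‖ ^ 2) := hFe.sigma fun k => (hFk k).hasSum
  have hg : ∀ k, (Summable fun p : {p : Quasilattice Q × Quasilattice Q // p.1 + p.2 = k} =>
      (weight s p.1.1)⁻¹ * (weight s p.1.2)⁻¹) ∧
      weight s k * ∑' p : {p : Quasilattice Q × Quasilattice Q // p.1 + p.2 = k},
        (weight s p.1.1)⁻¹ * (weight s p.1.2)⁻¹ ≤ 2 * 4 ^ s * S := by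
    intro k
    have hi1 : Function.Injective
        (fun p : {p : Quasilattice Q × Quasilattice Q // p.1 + p.2 = k} => p.1.1) := by
      rintro ⟨⟨a, b⟩, h⟩ ⟨⟨a', b'⟩, h'⟩ (hab : a = a')
      subst hab
      have h2 : a + b = a + b' := h.trans h'.symm
      have : b = b' := by
        apply Subtype.ext
        have := congrArg (Subtype.val : Quasilattice Q → ℂ) h2
        exact add_left_cancel this
      subst this
      rfl
    have hi2 : Function.Injective
        (fun p : {p : Quasilattice Q × Quasilattice Q // p.1 + p.2 = k} => p.1.2) := by
      rintro ⟨⟨a, b⟩, h⟩ ⟨⟨a', b'⟩, h'⟩ (hab : b = b')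
      subst hab
      have h2 : a + b = a' + b := h.trans h'.symm
      have : a = a' := by
        apply Subtype.ext
        have := congrArg (Subtype.val : Quasilattice Q → ℂ) h2
        exact add_right_cancel this
      subst this
      rfl
    have hw0 : ∀ k : Quasilattice Q, 0 ≤ (weight s k)⁻¹ := fun k => (inv_pos.2 (weight_pos s k)).le
    have hs1 := hw.comp_injective hi1
    have hs2 := hw.comp_injective hi2
    have ht1 : ∑' p : {p : Quasilattice Q × Quasilattice Q // p.1 + p.2 = k}, (weight s p.1.1)⁻¹ ≤ S :=
      tsum_comp_le_tsum_of_inj hw hw0 hi1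
    have ht2 : ∑' p : {p : Quasilattice Q × Quasilattice Q // p.1 + p.2 = k}, (weight s p.1.2)⁻¹ ≤ S :=
      tsum_comp_le_tsum_of_inj hw hw0 hi2
    have hle : ∀ p : {p : Quasilattice Q × Quasilattice Q // p.1 + p.2 = k},
        weight s k * ((weight s p.1.1)⁻¹ * (weight s p.1.2)⁻¹) ≤
          4 ^ s * ((weight s p.1.1)⁻¹ + (weight s p.1.2)⁻¹) := by
      rintro ⟨⟨a, b⟩, h⟩
      have h1 := weight_add_le hs a b
      have ha := weight_pos s a
      have hb := weight_pos s b
      have hk : weight s (a + b) = weight s k := by rw [← h]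
      rw [hk] at h1
      calc weight s k * ((weight s a)⁻¹ * (weight s b)⁻¹)
          ≤ (4 ^ s * (weight s a + weight s b)) * ((weight s a)⁻¹ * (weight s b)⁻¹) :=
            mul_le_mul_of_nonneg_right h1 (by positivity)
        _ = _ := by field_simp; ring
    have hsg : Summable fun p : {p : Quasilattice Q × Quasilattice Q // p.1 + p.2 = k} =>
        weight s k * ((weight s p.1.1)⁻¹ * (weight s p.1.2)⁻¹) :=
      Summable.of_nonneg_of_le (fun p => by
        have := weight_pos s k; have := hw0 p.1.1; have := hw0 p.1.2; positivity) hle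
        ((hs1.add hs2).mul_left _)
    refine ⟨(summable_mul_left_iff (weight_pos s k).ne').1 hsg, ?_⟩
    rw [← tsum_mul_left]
    calc _ ≤ _ := hsg.tsum_le_tsum hle ((hs1.add hs2).mul_left _)
      _ = 4 ^ s * (∑' p : {p : Quasilattice Q × Quasilattice Q // p.1 + p.2 = k}, (weight s p.1.1)⁻¹
          + ∑' p : {p : Quasilattice Q × Quasilattice Q // p.1 + p.2 = k}, (weight s p.1.2)⁻¹) := by
        rw [tsum_mul_left]
        exact congrArg _ (hs1.tsum_add hs2)
      _ ≤ 4 ^ s * (S + S) := mul_le_mul_of_nonneg_left (add_le_add ht1 ht2) (by positivity)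
      _ = _ := by ring
  have hcs := fun k => summable_and_tsum_mul_sq_le
    (f := fun p : {p : Quasilattice Q × Quasilattice Q // p.1 + p.2 = k} => √(F p.1))
    (g := fun p => √((weight s p.1.1)⁻¹ * (weight s p.1.2)⁻¹))
    (fun p => Real.sqrt_nonneg _) (fun p => Real.sqrt_nonneg _)
    (by simpa only [Real.sq_sqrt (hF0 _)] using hFk k)
    (by
      refine (hg k).1.congr fun p => ?_
      rw [Real.sq_sqrt (mul_nonneg (inv_pos.2 (weight_pos s _)).le (inv_pos.2 (weight_pos s _)).le)])
  have hprod : ∀ p : Quasilattice Q × Quasilattice Q,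
      √(F p) * √((weight s p.1)⁻¹ * (weight s p.2)⁻¹) = ‖coeff U p.1‖ * ‖coeff V p.2‖ := by
    intro p
    have h1 := weight_pos s p.1
    have h2 := weight_pos s p.2
    rw [← Real.sqrt_mul (hF0 p), Real.sqrt_eq_iff_mul_self_eq]
    · simp only [F]; field_simp
    · have := hF0 p; positivity
    · positivity
  simp only [hprod, Real.sq_sqrt (hF0 _), Real.sq_sqrt (mul_nonneg (inv_pos.2 (weight_pos s _)).le
    (inv_pos.2 (weight_pos s _)).le)] at hcs
  have hk : ∀ k, weight s k * ‖conv (coeff U) (coeff V) k‖ ^ 2 ≤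
      (2 * 4 ^ s * S) * ∑' p : {p : Quasilattice Q × Quasilattice Q // p.1 + p.2 = k}, F p.1 := by
    intro k
    have h1 : ‖conv (coeff U) (coeff V) k‖ ≤
        ∑' p : {p : Quasilattice Q × Quasilattice Q // p.1 + p.2 = k},
          ‖coeff U p.1.1‖ * ‖coeff V p.1.2‖ := by
      unfold conv
      simp only [← norm_mul]
      exact norm_tsum_le_tsum_norm (by simpa only [norm_mul] using (hcs k).1)
    have h2 := pow_le_pow_left₀ (norm_nonneg _) h1 2
    have h3 := (hcs k).2
    have hA0 : 0 ≤ ∑' p : {p : Quasilattice Q × Quasilattice Q // p.1 + p.2 = k}, F p.1 :=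
      tsum_nonneg fun p => hF0 _
    calc _ ≤ weight s k * ((∑' p : {p : Quasilattice Q × Quasilattice Q // p.1 + p.2 = k}, F p.1) *
          ∑' p : {p : Quasilattice Q × Quasilattice Q // p.1 + p.2 = k},
            (weight s p.1.1)⁻¹ * (weight s p.1.2)⁻¹) :=
          mul_le_mul_of_nonneg_left (h2.trans h3) (weight_pos s k).le
      _ = (weight s k * ∑' p : {p : Quasilattice Q × Quasilattice Q // p.1 + p.2 = k},
            (weight s p.1.1)⁻¹ * (weight s p.1.2)⁻¹) *
          ∑' p : {p : Quasilattice Q × Quasilattice Q // p.1 + p.2 = k}, F p.1 := by ring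
      _ ≤ _ := mul_le_mul_of_nonneg_right (hg k).2 hA0
  have hsum : Summable fun k => weight s k * ‖conv (coeff U) (coeff V) k‖ ^ 2 :=
    Summable.of_nonneg_of_le (fun k => mul_nonneg (weight_pos s k).le (sq_nonneg _)) hk
      (hA.summable.mul_left _)
  refine ⟨fun k => (hcs k).1, hsum, ?_⟩
  calc _ ≤ _ := hsum.tsum_le_tsum hk (hA.summable.mul_left _)
    _ = _ := by rw [tsum_mul_left, hA.tsum_eq]

/-- The product of `H_s` as a continuous bilinear map. -/
theorem exists_mulCLM (hs : 0 ≤ s) (hw : Summable fun k : Quasilattice Q => (weight s k)⁻¹) :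
    ∃ B : HSpace Q s →L[ℂ] HSpace Q s →L[ℂ] HSpace Q s,
      ∀ U V, coeff (B U V) = conv (coeff U) (coeff V) := by
  have hsm : ∀ (U V : HSpace Q s) k,
      Summable fun p : {p : Quasilattice Q × Quasilattice Q // p.1 + p.2 = k} =>
        coeff U p.1.1 * coeff V p.1.2 := fun U V k => by
    have := (conv_estimate hs hw U V).1 k
    simp only [← norm_mul] at this
    exact this.of_norm
  let f : HSpace Q s →ₗ[ℂ] HSpace Q s →ₗ[ℂ] HSpace Q s := LinearMap.mk₂ ℂ
    (fun U V => ⟨conv (coeff U) (coeff V), (conv_estimate hs hw U V).2.1⟩)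
    (fun U U' V => HSpace.ext <| funext fun k => by
      change conv (coeff U + coeff U') (coeff V) k = conv _ _ k + conv _ _ k
      unfold conv
      rw [← (hsm U V k).tsum_add (hsm U' V k)]
      simp only [Pi.add_apply, add_mul])
    (fun c U V => HSpace.ext <| funext fun k => by
      change conv (c • coeff U) (coeff V) k = c * conv _ _ k
      unfold conv
      rw [← tsum_mul_left]
      simp only [Pi.smul_apply, smul_eq_mul, mul_assoc])
    (fun U V V' => HSpace.ext <| funext fun k => by
      change conv (coeff U) (coeff V + coeff V') k = conv _ _ k + conv _ _ k
      unfold conv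
      rw [← (hsm U V k).tsum_add (hsm U V' k)]
      simp only [Pi.add_apply, mul_add])
    (fun c U V => HSpace.ext <| funext fun k => by
      change conv (coeff U) (c • coeff V) k = c * conv _ _ k
      unfold conv
      rw [← tsum_mul_left]
      simp only [Pi.smul_apply, smul_eq_mul, mul_left_comm])
  have hf : ∀ U V, coeff (f U V) = conv (coeff U) (coeff V) := fun U V => rfl
  have hS0 : 0 ≤ 2 * 4 ^ s * ∑' k : Quasilattice Q, (weight s k)⁻¹ :=
    mul_nonneg (by positivity) (tsum_nonneg fun k => (inv_pos.2 (weight_pos s k)).le)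
  refine ⟨f.mkContinuous₂ (√(2 * 4 ^ s * ∑' k : Quasilattice Q, (weight s k)⁻¹)) fun U V => ?_,
    fun U V => rfl⟩
  refine le_of_sq_le_sq ?_ (by positivity)
  rw [norm_sq_eq, mul_pow, mul_pow, Real.sq_sqrt hS0, hf, mul_assoc]
  exact (conv_estimate hs hw U V).2.2

end Spaces
end SwiftHohenberg
end

noncomputable section
namespace SwiftHohenberg

open SwiftHohenberg.HSpace

/-! ### Coefficients of the cube of a power series, and recursive definition of sequences. -/

section CubicSum

/-- The coefficient of index `n` of the cube of the power series with coefficients `f`. -/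
def cubicSum {R : Type*} [Semiring R] (f : ℕ → R) (n : ℕ) : R :=
  ∑ p ∈ Finset.HasAntidiagonal.antidiagonal n, ∑ q ∈ Finset.HasAntidiagonal.antidiagonal p.2,
    f p.1 * f q.1 * f q.2

theorem cubicSum_eq_coeff {R : Type*} [Semiring R] (f : ℕ → R) (n : ℕ) :
    cubicSum f n = PowerSeries.coeff n (PowerSeries.mk f * (PowerSeries.mk f * PowerSeries.mk f)) := by
  unfold cubicSum
  simp only [PowerSeries.coeff_mul, PowerSeries.coeff_mk, Finset.mul_sum, mul_assoc]

theorem le_of_mem_antidiagonals {n : ℕ} {p q : ℕ × ℕ}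
    (hp : p ∈ Finset.HasAntidiagonal.antidiagonal n)
    (hq : q ∈ Finset.HasAntidiagonal.antidiagonal p.2) :
    p.1 + q.1 + q.2 = n ∧ p.1 ≤ n ∧ q.1 ≤ n ∧ q.2 ≤ n := by
  rw [Finset.HasAntidiagonal.mem_antidiagonal] at hp hq
  omega

theorem cubicSum_congr {R : Type*} [Semiring R] {f g : ℕ → R} {n : ℕ} (h : ∀ i ≤ n, f i = g i) :
    cubicSum f n = cubicSum g n := by
  unfold cubicSum
  refine Finset.sum_congr rfl fun p hp => Finset.sum_congr rfl fun q hq => ?_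
  obtain ⟨-, h1, h2, h3⟩ := le_of_mem_antidiagonals hp hq
  rw [h _ h1, h _ h2, h _ h3]

/-- Dependence of the cubic sum on the last coefficient. -/
theorem cubicSum_add_last {R : Type*} [CommRing R] {f g : ℕ → R} {n : ℕ} {d : R}
    (h : ∀ i ≤ n, f i = g i) (hd : f (n + 1) = g (n + 1) + d) :
    cubicSum f (n + 1) = cubicSum g (n + 1) + 3 * g 0 ^ 2 * d := by
  obtain ⟨H, hH⟩ : ∃ H, PowerSeries.mk f - PowerSeries.mk g = PowerSeries.X ^ (n + 1) * H := by
    refine PowerSeries.X_pow_dvd_iff.2 fun m hm => ?_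
    rw [map_sub, PowerSeries.coeff_mk, PowerSeries.coeff_mk, h m (by omega), sub_self]
  have hH0 : PowerSeries.constantCoeff H = d := by
    have := congrArg (PowerSeries.coeff (n + 1)) hH
    rw [map_sub, PowerSeries.coeff_mk, PowerSeries.coeff_mk, hd] at this
    have h2 : PowerSeries.coeff (0 + (n + 1)) (PowerSeries.X ^ (n + 1) * H) = PowerSeries.coeff 0 H :=
      PowerSeries.coeff_X_pow_mul H (n + 1) 0
    rw [zero_add] at h2
    rw [h2, PowerSeries.coeff_zero_eq_constantCoeff_apply] at this
    rw [← this]; ring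
  have hf : PowerSeries.mk f = PowerSeries.mk g + PowerSeries.X ^ (n + 1) * H := by
    rw [← hH]; ring
  -- With `f = g + X^(n+1) H`, the terms of degree two and three in `X^(n+1) H` retain a spare
  -- factor `X`; only `3 g² H` reaches degree `n + 1`.
  have hcube : PowerSeries.mk f * (PowerSeries.mk f * PowerSeries.mk f) =
      PowerSeries.mk g * (PowerSeries.mk g * PowerSeries.mk g) + PowerSeries.X ^ (n + 1) *
        (H * (3 * PowerSeries.mk g ^ 2 + PowerSeries.X * (3 * PowerSeries.mk g * PowerSeries.X ^ n * H +
          PowerSeries.X ^ (2 * n + 1) * H ^ 2))) := by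
    rw [hf]; ring
  rw [cubicSum_eq_coeff, cubicSum_eq_coeff, hcube, map_add]
  congr 1
  have h2 := PowerSeries.coeff_X_pow_mul (H * (3 * PowerSeries.mk g ^ 2 + PowerSeries.X *
    (3 * PowerSeries.mk g * PowerSeries.X ^ n * H + PowerSeries.X ^ (2 * n + 1) * H ^ 2))) (n + 1) 0
  rw [zero_add] at h2
  rw [h2, PowerSeries.coeff_zero_eq_constantCoeff_apply]
  simp only [map_mul, map_add, map_pow, hH0, PowerSeries.constantCoeff_X, zero_mul, add_zero,
    map_ofNat, PowerSeries.constantCoeff_mk]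
  ring

/-- In the applications `d` is a multiple of the leading term, or the component in the range when `w
= 0`. -/
theorem cubicSum_update {R : Type*} [CommRing R] (f : ℕ → R) (n : ℕ) (w d : R) :
    cubicSum (Function.update f (n + 1) (w + d)) (n + 1) =
      cubicSum (Function.update f (n + 1) w) (n + 1) + 3 * f 0 ^ 2 * d := by
  have h := cubicSum_add_last (f := Function.update f (n + 1) (w + d))
    (g := Function.update f (n + 1) w) (n := n) (d := d)
    (fun i hi => by rw [Function.update_of_ne (by omega), Function.update_of_ne (by omega)])
    (by simp)
  rwa [Function.update_of_ne (by omega : 0 ≠ n + 1)] at h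

/-- Definition of a sequence by a recursion on all previous terms. -/
theorem exists_seq_of_step {A : Type*} (u : A) (step : ℕ → (ℕ → A) → A)
    (hstep : ∀ n f g, (∀ i ≤ n, f i = g i) → step n f = step n g) :
    ∃ U : ℕ → A, U 0 = u ∧ ∀ n, U (n + 1) = step n U := by
  -- `h n` is a sequence whose entries of index at most `n` are final; the solution is its diagonal.
  let h : ℕ → ℕ → A := fun n => Nat.rec (fun _ => u)
    (fun n f => Function.update f (n + 1) (step n f)) n
  have hsucc : ∀ n, h (n + 1) = Function.update (h n) (n + 1) (step n (h n)) := fun n => rfl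
  have hst : ∀ n d, h (n + d) n = h n n := by
    intro n d
    induction d with
    | zero => rfl
    | succ d ih => rw [← add_assoc, hsucc, Function.update_of_ne (by omega), ih]
  refine ⟨fun n => h n n, rfl, fun n => ?_⟩
  change h (n + 1) (n + 1) = _
  rw [hsucc, Function.update_self]
  refine hstep _ _ _ fun i hi => ?_
  obtain ⟨d, rfl⟩ := Nat.exists_eq_add_of_le hi
  exact hst i d

end CubicSum

/-! ### Trigonometric polynomials as a group algebra. -/

section TrigPoly

variable {Q : ℕ} {s : ℝ}

/-- Trigonometric polynomials with frequencies in the quasilattice. -/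
abbrev TrigPoly (Q : ℕ) : Type := AddMonoidAlgebra ℂ (Quasilattice Q)

/-- On finite supports the convolution is the product of a commutative ring, so the formal solution
can be built there without convergence questions. -/
theorem conv_coeff (x y : TrigPoly Q) (k : Quasilattice Q) :
    conv x.coeff y.coeff k = (x * y).coeff k := by
  classical
  rw [AddMonoidAlgebra.coeff_mul]
  unfold conv
  have h1 := tsum_subtype {p : Quasilattice Q × Quasilattice Q | p.1 + p.2 = k}
    (fun p => x.coeff p.1 * y.coeff p.2)
  refine h1.trans ?_
  rw [tsum_eq_sum (s := x.coeff.support ×ˢ y.coeff.support), Finset.sum_product]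
  · simp only [Finsupp.sum, Set.indicator_apply, Set.mem_ofPred_eq]
  · intro p hp
    rw [Set.indicator_apply]
    split_ifs
    · simp only [Finset.mem_product, Finsupp.mem_support_iff, not_and_or, not_not] at hp
      rcases hp with hp | hp <;> simp [hp]
    · rfl

/-- A trigonometric polynomial as an element of `H_s`. -/
def toH (s : ℝ) : TrigPoly Q →ₗ[ℂ] HSpace Q s where
  toFun x := ⟨x.coeff, summable_of_ne_finset_zero (s := x.coeff.support) fun k hk => by
    rw [Finsupp.notMem_support_iff.1 hk]
    simp⟩
  map_add' _ _ := rfl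
  map_smul' _ _ := rfl

@[simp] theorem coeff_toH (x : TrigPoly Q) : coeff (toH s x) = x.coeff := rfl

/-- The trigonometric polynomial `∑ⱼ exp(i kⱼ·x)`. -/
def leadingPoly (Q : ℕ) : TrigPoly Q := ∑ j, AddMonoidAlgebra.single (wv Q j) 1

theorem coeff_leadingPoly_wv (hQ : Q ≠ 0) (j : Fin Q) : (leadingPoly Q).coeff (wv Q j) = 1 := by
  classical
  rw [leadingPoly, AddMonoidAlgebra.coeff_sum, Finsupp.finsetSum_apply]
  simp only [AddMonoidAlgebra.coeff_single, Finsupp.single_apply, (wv_injective hQ).eq_iff]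
  simp

theorem coeff_leadingPoly_of_ne {k : Quasilattice Q} (hk : ∀ j, wv Q j ≠ k) :
    (leadingPoly Q).coeff k = 0 := by
  classical
  rw [leadingPoly, AddMonoidAlgebra.coeff_sum, Finsupp.finsetSum_apply]
  simp only [AddMonoidAlgebra.coeff_single, Finsupp.single_apply, hk]
  simp

theorem norm_wv (j : Fin Q) : ‖(wv Q j : ℂ)‖ = 1 := norm_wavevector j

theorem exists_eq_wv (hQ : Q ≠ 0) (hQe : Even Q) {k : Quasilattice Q} (hk : ‖(k : ℂ)‖ = 1) :
    ∃ j, k = wv Q j := by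
  obtain ⟨j, hj⟩ := exists_eq_wavevector_of_norm_eq_one hQ hQe hk
  exact ⟨j, Subtype.ext hj⟩

/-- Rotation of trigonometric polynomials. -/
def rotPoly (hQ : Q ≠ 0) : TrigPoly Q ≃+* TrigPoly Q :=
  AddMonoidAlgebra.mapDomainRingEquiv ℂ (rotEquiv hQ)

theorem coeff_rotPoly (hQ : Q ≠ 0) (x : TrigPoly Q) (k : Quasilattice Q) :
    (rotPoly hQ x).coeff (rotEquiv hQ k) = x.coeff k := by
  rw [rotPoly, AddMonoidAlgebra.coeff_mapDomainRingEquiv]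
  simp

theorem rotPoly_eq_iff (hQ : Q ≠ 0) (x : TrigPoly Q) :
    rotPoly hQ x = x ↔ ∀ k, x.coeff (rotEquiv hQ k) = x.coeff k := by
  constructor
  · intro h k
    conv_lhs => rw [← h]
    exact coeff_rotPoly hQ x k
  · intro h
    apply AddMonoidAlgebra.coeff_injective
    ext k
    obtain ⟨k', rfl⟩ := (rotEquiv hQ).surjective k
    rw [coeff_rotPoly, h]

/-- Complex conjugation of the coefficients. -/
def conjPoly (Q : ℕ) : TrigPoly Q →+* TrigPoly Q :=
  AddMonoidAlgebra.mapRingHom _ (starRingEnd ℂ)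

theorem conjPoly_eq_iff (x : TrigPoly Q) :
    conjPoly Q x = x ↔ ∀ k, (starRingEnd ℂ) (x.coeff k) = x.coeff k := by
  rw [← AddMonoidAlgebra.coeff_inj, Finsupp.ext_iff]
  simp only [conjPoly, AddMonoidAlgebra.coeff_mapRingHom]

/-- Rotationally invariant trigonometric polynomials with real coefficients. -/
def invariantSubring (hQ : Q ≠ 0) : Subring (TrigPoly Q) :=
  (RingHom.eqLocus (rotPoly hQ : TrigPoly Q →+* TrigPoly Q) (RingHom.id _)) ⊓
    (RingHom.eqLocus (conjPoly Q) (RingHom.id _))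

theorem mem_invariantSubring (hQ : Q ≠ 0) (x : TrigPoly Q) : x ∈ invariantSubring hQ ↔
    (∀ k, x.coeff (rotEquiv hQ k) = x.coeff k) ∧ ∀ k, (starRingEnd ℂ) (x.coeff k) = x.coeff k := by
  rw [← rotPoly_eq_iff, ← conjPoly_eq_iff]
  rfl

theorem real_smul_mem (hQ : Q ≠ 0) (c : ℝ) {x : TrigPoly Q} (hx : x ∈ invariantSubring hQ) :
    (c : ℂ) • x ∈ invariantSubring hQ := by
  rw [mem_invariantSubring] at hx ⊢
  simp only [AddMonoidAlgebra.coeff_smul_apply, smul_eq_mul, map_mul, Complex.conj_ofReal, hx.1, hx.2]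
  simp

theorem leadingPoly_mem (hQ : Q ≠ 0) : leadingPoly Q ∈ invariantSubring hQ := by
  rw [mem_invariantSubring]
  have h01 : ∀ k, (leadingPoly Q).coeff k = 1 ∧ (∃ j, wv Q j = k) ∨
      (leadingPoly Q).coeff k = 0 ∧ ∀ j, wv Q j ≠ k := by
    intro k
    by_cases h : ∃ j, wv Q j = k
    · obtain ⟨j, rfl⟩ := h
      exact Or.inl ⟨coeff_leadingPoly_wv hQ j, j, rfl⟩
    · push Not at h
      exact Or.inr ⟨coeff_leadingPoly_of_ne h, h⟩
  constructor
  · rw [← rotPoly_eq_iff]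
    rw [leadingPoly, map_sum]
    have : ∀ j, rotPoly hQ (AddMonoidAlgebra.single (wv Q j) 1) = AddMonoidAlgebra.single
        (wv Q ⟨(j + 1) % Q, Nat.mod_lt _ (Nat.pos_of_ne_zero hQ)⟩) 1 := by
      intro j
      rw [rotPoly, AddMonoidAlgebra.mapDomainRingEquiv_single, rotEquiv_wv]
    simp only [this]
    refine Function.Bijective.sum_comp (e := fun j : Fin Q =>
      (⟨(j + 1) % Q, Nat.mod_lt _ (Nat.pos_of_ne_zero hQ)⟩ : Fin Q)) ?_
      (fun j => (AddMonoidAlgebra.single (wv Q j) (1 : ℂ) : TrigPoly Q))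
    refine Finite.injective_iff_bijective.1 fun i j hij => ?_
    have h : wv Q _ = wv Q _ := congrArg (wv Q) hij
    rw [← rotEquiv_wv hQ, ← rotEquiv_wv hQ] at h
    exact wv_injective hQ ((rotEquiv hQ).injective h)
  · intro k
    rcases h01 k with h | h <;> simp [h.1]

/-- Trigonometric polynomials with frequencies of order at most `m`. -/
def OrderLE (m : ℕ) (x : TrigPoly Q) : Prop := ∀ k, x.coeff k ≠ 0 → order k ≤ m

theorem OrderLE.mono {m m' : ℕ} {x : TrigPoly Q} (h : OrderLE m x) (hm : m ≤ m') : OrderLE m' x :=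
  fun k hk => (h k hk).trans hm

theorem OrderLE.zero (m : ℕ) : OrderLE m (0 : TrigPoly Q) := fun _ hk => absurd rfl hk

theorem OrderLE.add {m : ℕ} {x y : TrigPoly Q} (hx : OrderLE m x) (hy : OrderLE m y) :
    OrderLE m (x + y) := by
  intro k hk
  by_cases h : x.coeff k = 0
  · refine hy k fun h' => hk ?_
    rw [AddMonoidAlgebra.coeff_add, Finsupp.add_apply, h, h', add_zero]
  · exact hx k h

theorem OrderLE.smul {m : ℕ} {x : TrigPoly Q} (c : ℂ) (hx : OrderLE m x) : OrderLE m (c • x) := by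
  intro k hk
  refine hx k fun h => hk ?_
  rw [AddMonoidAlgebra.coeff_smul_apply, h, smul_zero]

theorem OrderLE.sub {m : ℕ} {x y : TrigPoly Q} (hx : OrderLE m x) (hy : OrderLE m y) :
    OrderLE m (x - y) := by
  have : x - y = x + (-1 : ℂ) • y := by rw [neg_one_smul, sub_eq_add_neg]
  rw [this]
  exact hx.add (hy.smul _)

theorem OrderLE.sum {m : ℕ} {ι : Type*} {t : Finset ι} {f : ι → TrigPoly Q}
    (h : ∀ i ∈ t, OrderLE m (f i)) : OrderLE m (∑ i ∈ t, f i) :=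
  Finset.sum_induction f (OrderLE m) (fun _ _ => OrderLE.add) (OrderLE.zero m) h

theorem OrderLE.mul {m m' : ℕ} {x y : TrigPoly Q} (hx : OrderLE m x) (hy : OrderLE m' y) :
    OrderLE (m + m') (x * y) := by
  classical
  intro k hk
  rw [AddMonoidAlgebra.coeff_mul] at hk
  obtain ⟨a, ha, ha'⟩ := Finset.exists_ne_zero_of_sum_ne_zero hk
  obtain ⟨b, hb, hb'⟩ := Finset.exists_ne_zero_of_sum_ne_zero ha'
  dsimp only at hb'
  split_ifs at hb' with h
  · rw [← h]
    exact (order_add_le a b).trans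
      (add_le_add (hx a (Finsupp.mem_support_iff.1 ha)) (hy b (Finsupp.mem_support_iff.1 hb)))
  · exact absurd rfl hb'

theorem OrderLE.leadingPoly : OrderLE 1 (leadingPoly Q) := by
  intro k hk
  by_contra h
  refine hk (coeff_leadingPoly_of_ne fun j hj => h ?_)
  rw [← hj]
  exact order_wv_le j

/-- `(2i+1) + (2j+1) + (2k+1) = 2(n+1) + 1` when `i + j + k = n`: the bound `2n + 1` on the order
reproduces itself under the recursion. -/
theorem OrderLE.cubicSum {f : ℕ → TrigPoly Q} {n : ℕ} (h : ∀ i ≤ n, OrderLE (2 * i + 1) (f i)) :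
    OrderLE (2 * n + 3) (cubicSum f n) := by
  refine OrderLE.sum fun p hp => OrderLE.sum fun q hq => ?_
  obtain ⟨h0, h1, h2, h3⟩ := le_of_mem_antidiagonals hp hq
  exact (((h _ h1).mul (h _ h2)).mul (h _ h3)).mono (by omega)

theorem cubicSum_mem {R : Type*} [Ring R] (S : Subring R) {f : ℕ → R} {n : ℕ}
    (h : ∀ i ≤ n, f i ∈ S) : cubicSum f n ∈ S := by
  refine sum_mem fun p hp => sum_mem fun q hq => ?_
  obtain ⟨-, h1, h2, h3⟩ := le_of_mem_antidiagonals hp hq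
  exact mul_mem (mul_mem (h _ h1) (h _ h2)) (h _ h3)

/-- The multiplier inverting `(1 + Δ)²` away from its kernel. -/
def pseudoInv (x : TrigPoly Q) : TrigPoly Q :=
  .ofCoeff <| Finsupp.onFinset x.coeff.support
    (fun k => if ‖(k : ℂ)‖ = 1 then 0 else ((1 - (‖(k : ℂ)‖ : ℂ) ^ 2) ^ 2)⁻¹ * x.coeff k)
    fun k hk => by
      rw [Finsupp.mem_support_iff]
      intro h
      simp [h] at hk

theorem coeff_pseudoInv (x : TrigPoly Q) (k : Quasilattice Q) : (pseudoInv x).coeff k =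
    if ‖(k : ℂ)‖ = 1 then 0 else ((1 - (‖(k : ℂ)‖ : ℂ) ^ 2) ^ 2)⁻¹ * x.coeff k := rfl

theorem symbol_eq_zero_iff (k : Quasilattice Q) :
    (1 - (‖(k : ℂ)‖ : ℂ) ^ 2) ^ 2 = 0 ↔ ‖(k : ℂ)‖ = 1 := by
  rw [sq_eq_zero_iff, sub_eq_zero, eq_comm]
  rw [← Complex.ofReal_pow, ← Complex.ofReal_one, Complex.ofReal_inj]
  exact pow_eq_one_iff_of_nonneg (norm_nonneg _) two_ne_zero

theorem pseudoInv_mem (hQ : Q ≠ 0) {x : TrigPoly Q} (hx : x ∈ invariantSubring hQ) :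
    pseudoInv x ∈ invariantSubring hQ := by
  rw [mem_invariantSubring] at hx ⊢
  constructor
  · intro k
    rw [coeff_pseudoInv, coeff_pseudoInv, norm_rotEquiv, hx.1]
  · intro k
    rw [coeff_pseudoInv]
    split_ifs
    · simp
    · simp only [map_mul, map_inv₀, map_pow, map_sub, map_one, Complex.conj_ofReal, hx.2]

theorem OrderLE.pseudoInv {m : ℕ} {x : TrigPoly Q} (hx : OrderLE m x) : OrderLE m (pseudoInv x) := by
  intro k hk
  refine hx k fun h => hk ?_
  rw [coeff_pseudoInv, h]
  simp

/-- The index opposite to `i`. -/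
def opp (hQ : Q ≠ 0) (i : Fin Q) : Fin Q := ⟨(i + Q / 2) % Q, Nat.mod_lt _ (Nat.pos_of_ne_zero hQ)⟩

theorem omega_pow_half (hQ : Q ≠ 0) (hQe : Even Q) : omega Q ^ (Q / 2) = -1 := by
  obtain ⟨d, hd⟩ := hQe
  have hd2 : Q / 2 = d := by omega
  have h1 : (omega Q ^ d - 1) * (omega Q ^ d + 1) = 0 := by
    have := omega_pow_self hQ
    conv at this => lhs; arg 2; rw [hd]
    rw [pow_add] at this
    linear_combination this
  rw [hd2]
  rcases mul_eq_zero.1 h1 with h | h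
  · have := (omega_primitive hQ).dvd_of_pow_eq_one d (sub_eq_zero.1 h)
    exact absurd (Nat.le_of_dvd (by omega) this) (by omega)
  · exact eq_neg_of_add_eq_zero_left h

theorem wavevector_opp (hQ : Q ≠ 0) (hQe : Even Q) (i : Fin Q) :
    wavevector Q (opp hQ i) = -wavevector Q i := by
  rw [opp, ← omega_pow_eq_wavevector hQ, pow_add, omega_pow_half hQ hQe, wavevector_eq]
  ring

theorem wavevector_injective (hQ : Q ≠ 0) : Function.Injective (wavevector Q) := fun _ _ h =>
  wv_injective hQ (Subtype.ext h)

theorem wavevector_add_eq_zero (hQ : Q ≠ 0) (hQe : Even Q) (i j : Fin Q) :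
    wavevector Q i + wavevector Q j = 0 ↔ j = opp hQ i := by
  rw [← (wavevector_injective hQ).eq_iff, wavevector_opp hQ hQe]
  rw [eq_neg_iff_add_eq_zero, add_comm]

end TrigPoly
end SwiftHohenberg
end

noncomputable section
namespace SwiftHohenberg

open SwiftHohenberg.HSpace

/-! ### Existence and uniqueness of the formal solution. -/

section FormalSolution

variable {Q : ℕ} {s : ℝ}

theorem opp_opp (hQ : Q ≠ 0) (hQe : Even Q) (i : Fin Q) : opp hQ (opp hQ i) = i := by
  rw [← (wavevector_injective hQ).eq_iff, wavevector_opp hQ hQe, wavevector_opp hQ hQe, neg_neg]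

theorem opp_ne (hQ : Q ≠ 0) (hQe : Even Q) (i : Fin Q) : opp hQ i ≠ i := by
  intro h
  have h1 := wavevector_opp hQ hQe i
  rw [h] at h1
  have h2 : wavevector Q i = 0 := by
    have : (2 : ℂ) * wavevector Q i = 0 := by linear_combination h1
    simpa using this
  have h3 := norm_wavevector i
  rw [h2, norm_zero] at h3
  exact zero_ne_one h3

/-- Three wavevectors adding up to a unit vector contain an opposite pair, and the third one is then
the sum. -/
theorem wavevector_add_add_eq (hQ : Q ≠ 0) (hQe : Even Q) (i j k o : Fin Q) :
    wavevector Q i + wavevector Q j + wavevector Q k = wavevector Q o ↔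
      (i = o ∧ k = opp hQ j) ∨ (j = o ∧ k = opp hQ i) ∨ (k = o ∧ j = opp hQ i) := by
  constructor
  · intro h
    rcases opposite_of_norm_add_eq_one (norm_wavevector i) (norm_wavevector j) (norm_wavevector k)
      (by rw [h, norm_wavevector]) with h1 | h1 | h1
    · refine Or.inr (Or.inr ⟨wavevector_injective hQ (by linear_combination h - h1), ?_⟩)
      exact (wavevector_add_eq_zero hQ hQe i j).1 h1
    · refine Or.inl ⟨wavevector_injective hQ (by linear_combination h - h1), ?_⟩
      exact (wavevector_add_eq_zero hQ hQe j k).1 h1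
    · refine Or.inr (Or.inl ⟨wavevector_injective hQ (by linear_combination h - h1), ?_⟩)
      exact (wavevector_add_eq_zero hQ hQe i k).1 (by linear_combination h1)
  · rintro (⟨rfl, h⟩ | ⟨rfl, h⟩ | ⟨rfl, h⟩)
    · linear_combination (wavevector_add_eq_zero hQ hQe j k).2 h
    · linear_combination (wavevector_add_eq_zero hQ hQe i k).2 h
    · linear_combination (wavevector_add_eq_zero hQ hQe i j).2 h

/-- This is the origin of `β`: the three families of resonant triples have `Q` elements each, meet
pairwise in a single triple, and have no triple in common, which makes `3Q - 3`. -/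
theorem coeff_leadingPoly_cube (hQ : Q ≠ 0) (hQe : Even Q) (o : Fin Q) :
    (leadingPoly Q ^ 3).coeff (wv Q o) = (beta Q : ℂ) := by
  classical
  have h1 : leadingPoly Q ^ 3 = ∑ i, ∑ j, ∑ k,
      AddMonoidAlgebra.single (wv Q i + wv Q j + wv Q k) (1 : ℂ) := by
    have : leadingPoly Q ^ 3 = leadingPoly Q * leadingPoly Q * leadingPoly Q := by ring
    rw [this, leadingPoly, Finset.sum_mul_sum, Finset.sum_mul]
    refine Finset.sum_congr rfl fun i _ => ?_
    rw [Finset.sum_mul]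
    refine Finset.sum_congr rfl fun j _ => ?_
    rw [Finset.mul_sum]
    refine Finset.sum_congr rfl fun k _ => ?_
    rw [AddMonoidAlgebra.single_mul_single, AddMonoidAlgebra.single_mul_single, mul_one, mul_one]
  -- Inclusion-exclusion; the triple intersection would force `opp o = o`.
  have h2 : ∀ i j k : Fin Q, (if wv Q i + wv Q j + wv Q k = wv Q o then (1 : ℂ) else 0) =
      (if i = o then (if k = opp hQ j then 1 else 0) else 0) +
      (if j = o then (if k = opp hQ i then 1 else 0) else 0) +
      (if k = o then (if j = opp hQ i then 1 else 0) else 0) -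
      (if i = o then (if j = o then (if k = opp hQ o then 1 else 0) else 0) else 0) -
      (if i = o then (if k = o then (if j = opp hQ o then 1 else 0) else 0) else 0) -
      (if j = o then (if k = o then (if i = opp hQ o then 1 else 0) else 0) else 0) := by
    intro i j k
    have h3 : wv Q i + wv Q j + wv Q k = wv Q o ↔ _ :=
      Subtype.ext_iff.trans (wavevector_add_add_eq hQ hQe i j k o)
    have ho := opp_ne hQ hQe o
    have ho2 := opp_opp hQ hQe
    have hoo : ∀ i, o = opp hQ i ↔ i = opp hQ o := fun i =>
      ⟨fun h => by rw [h, ho2], fun h => by rw [h, ho2]⟩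
    simp only [h3]
    by_cases hi : i = o <;> by_cases hj : j = o <;> by_cases hk : k = o <;>
      simp [hi, hj, hk, hoo, ho.symm]
  have h4 : ∀ i j k : Fin Q,
      (AddMonoidAlgebra.single (wv Q i + wv Q j + wv Q k) (1 : ℂ) : TrigPoly Q).coeff (wv Q o) =
      if wv Q i + wv Q j + wv Q k = wv Q o then (1 : ℂ) else 0 := fun i j k => by
    rw [AddMonoidAlgebra.coeff_single, Finsupp.single_apply]
  rw [h1]
  simp only [AddMonoidAlgebra.coeff_sum, Finsupp.finsetSum_apply, h4, h2, Finset.sum_add_distrib,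
    Finset.sum_sub_distrib]
  simp [beta]
  ring

/-- The component of order `n + 1` of the formal solution orthogonal to the kernel. -/
def stepRange (n : ℕ) (f : ℕ → TrigPoly Q) : TrigPoly Q :=
  pseudoInv (f n - (beta Q : ℂ)⁻¹ • cubicSum f n)

/-- The coefficient of order `n + 1` along the kernel, given by solvability at order `n + 2`. -/
def stepKernel (o : Fin Q) (n : ℕ) (f : ℕ → TrigPoly Q) : ℂ :=
  -(2 * (beta Q : ℂ))⁻¹ *
    (cubicSum (Function.update f (n + 1) (stepRange n f)) (n + 1)).coeff (wv Q o)

theorem stepRange_congr {n : ℕ} {f g : ℕ → TrigPoly Q} (h : ∀ i ≤ n, f i = g i) :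
    stepRange n f = stepRange n g := by
  rw [stepRange, stepRange, h n le_rfl, cubicSum_congr h]

theorem stepKernel_congr {o : Fin Q} {n : ℕ} {f g : ℕ → TrigPoly Q} (h : ∀ i ≤ n, f i = g i) :
    stepKernel o n f = stepKernel o n g := by
  have hc : cubicSum (Function.update f (n + 1) (stepRange n f)) (n + 1) =
      cubicSum (Function.update g (n + 1) (stepRange n g)) (n + 1) := by
    refine cubicSum_congr fun i hi => ?_
    rcases eq_or_ne i (n + 1) with rfl | hne
    · rw [Function.update_self, Function.update_self, stepRange_congr h]
    · rw [Function.update_of_ne hne, Function.update_of_ne hne, h i (by omega)]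
  rw [stepKernel, stepKernel, hc]

/-- The recursion defining the coefficients of the formal solution. -/
structure IsPolySolution (o : Fin Q) (U : ℕ → TrigPoly Q) : Prop where
  zero : U 0 = leadingPoly Q
  succ : ∀ n, U (n + 1) = stepRange n U + stepKernel o n U • leadingPoly Q

theorem exists_isPolySolution (o : Fin Q) : ∃ U, IsPolySolution o U := by
  obtain ⟨U, h0, h1⟩ := exists_seq_of_step (leadingPoly Q)
    (fun n f => stepRange n f + stepKernel o n f • leadingPoly Q)
    (fun n f g h => by rw [stepRange_congr h, stepKernel_congr h])
  exact ⟨U, h0, h1⟩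

namespace IsPolySolution

variable {o : Fin Q} {U : ℕ → TrigPoly Q}

theorem mem_invariantSubring (hU : IsPolySolution o U) (hQ : Q ≠ 0) (n : ℕ) :
    U n ∈ invariantSubring hQ := by
  have hb : (beta Q : ℂ)⁻¹ = ((beta Q)⁻¹ : ℝ) := by push_cast; rfl
  induction n using Nat.strong_induction_on with
  | _ n ih =>
    cases n with
    | zero => rw [hU.zero]; exact leadingPoly_mem hQ
    | succ n =>
      have hW : stepRange n U ∈ invariantSubring hQ := by
        refine pseudoInv_mem hQ (sub_mem (ih n (by omega)) ?_)
        rw [hb]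
        exact real_smul_mem hQ _ (cubicSum_mem _ fun i hi => ih i (by omega))
      have hc : cubicSum (Function.update U (n + 1) (stepRange n U)) (n + 1) ∈ invariantSubring hQ := by
        refine cubicSum_mem _ fun i hi => ?_
        rcases eq_or_ne i (n + 1) with rfl | hne
        · simpa using hW
        · rw [Function.update_of_ne hne]; exact ih i (by omega)
      have ha : stepKernel o n U = ((stepKernel o n U).re : ℂ) := by
        refine (Complex.conj_eq_iff_re.1 ?_).symm
        rw [SwiftHohenberg.mem_invariantSubring] at hc
        have hr : -(2 * (beta Q : ℂ))⁻¹ = ((-(2 * beta Q)⁻¹ : ℝ) : ℂ) := by push_cast; rfl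
        rw [stepKernel, map_mul, hc.2, hr, Complex.conj_ofReal]
      rw [hU.succ, ha]
      exact add_mem hW (real_smul_mem hQ _ (leadingPoly_mem hQ))

theorem orderLE (hU : IsPolySolution o U) (n : ℕ) : OrderLE (2 * n + 1) (U n) := by
  induction n using Nat.strong_induction_on with
  | _ n ih =>
    cases n with
    | zero => rw [hU.zero]; exact OrderLE.leadingPoly
    | succ n =>
      rw [hU.succ]
      refine OrderLE.add ?_ ((OrderLE.leadingPoly.mono (by omega)).smul _)
      refine OrderLE.pseudoInv (((ih n (by omega)).mono (by omega)).sub (OrderLE.smul _ ?_))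
      exact OrderLE.cubicSum fun i hi => ih i (by omega)

theorem coeff_stepRange_wv (n : ℕ) (f : ℕ → TrigPoly Q) (j : Fin Q) :
    (stepRange n f).coeff (wv Q j) = 0 := by
  rw [stepRange, coeff_pseudoInv, if_pos (norm_wv j)]

theorem three_mul_cube_coeff (hQ : Q ≠ 0) (hQe : Even Q) (a : ℂ) :
    (3 * leadingPoly Q ^ 2 * (a • leadingPoly Q)).coeff (wv Q o) = 3 * a * beta Q := by
  have : 3 * leadingPoly Q ^ 2 * (a • leadingPoly Q) = (3 * a) • leadingPoly Q ^ 3 := by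
    have h3 : (3 * a) • leadingPoly Q ^ 3 = 3 * (a • leadingPoly Q ^ 3) := by
      have h3 : (3 : TrigPoly Q) = algebraMap ℂ _ 3 := (map_ofNat _ 3).symm
      rw [h3, Algebra.smul_def, Algebra.smul_def, map_mul, mul_assoc]
    rw [h3, mul_smul_comm, mul_assoc, ← pow_succ, mul_smul_comm]
  rw [this, AddMonoidAlgebra.coeff_smul_apply, coeff_leadingPoly_cube hQ hQe, smul_eq_mul]

theorem beta_ne_zero (hQ8 : 8 ≤ Q) : (beta Q : ℂ) ≠ 0 := by
  have : 0 < beta Q := by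
    unfold beta
    have : (8 : ℝ) ≤ Q := by exact_mod_cast hQ8
    linarith
  exact_mod_cast this.ne'

/-- The solvability condition. -/
theorem solvability_wv (hU : IsPolySolution o U) (hQe : Even Q) (hQ8 : 8 ≤ Q) (n : ℕ) :
    (U n - (beta Q : ℂ)⁻¹ • cubicSum U n).coeff (wv Q o) = 0 := by
  have hQ : Q ≠ 0 := by omega
  have hb := beta_ne_zero hQ8
  rw [AddMonoidAlgebra.coeff_sub, Finsupp.sub_apply, AddMonoidAlgebra.coeff_smul_apply, smul_eq_mul]
  cases n with
  | zero =>
    have : cubicSum U 0 = leadingPoly Q ^ 3 := by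
      simp [cubicSum, hU.zero]; ring
    rw [this, coeff_leadingPoly_cube hQ hQe, hU.zero, coeff_leadingPoly_wv hQ, inv_mul_cancel₀ hb,
      sub_self]
  | succ n =>
    -- With `a` the kernel coefficient and `c` that of the cubic sum without it, the condition reads
    -- `a - (c + 3aβ)/β = 0`, that is `a = -c/(2β)`, the value of `stepKernel`.
    have h1 : cubicSum U (n + 1) =
        cubicSum (Function.update U (n + 1) (stepRange n U)) (n + 1) +
          3 * leadingPoly Q ^ 2 * (stepKernel o n U • leadingPoly Q) := by
      rw [← hU.zero, ← cubicSum_update, hU.zero, ← hU.succ, Function.update_eq_self]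
    rw [h1, AddMonoidAlgebra.coeff_add, Finsupp.add_apply, three_mul_cube_coeff hQ hQe, hU.succ,
      AddMonoidAlgebra.coeff_add, Finsupp.add_apply, coeff_stepRange_wv,
      AddMonoidAlgebra.coeff_smul_apply, coeff_leadingPoly_wv hQ, stepKernel]
    simp only [smul_eq_mul]
    field_simp
    ring

/-- The rotation permutes the wavevectors cyclically. Invariance thus makes the kernel
one-dimensional, and the condition at one wavevector suffices. -/
theorem _root_.SwiftHohenberg.coeff_wv_eq (hQ : Q ≠ 0) {a : Quasilattice Q → ℂ} (ha : RotInvariant a)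
    (i j : Fin Q) : a (wv Q i) = a (wv Q j) := by
  rw [rotInvariant_iff hQ] at ha
  have h0 : ∀ n : ℕ, ∀ j : Fin Q, (j : ℕ) = n →
      a (wv Q j) = a (wv Q ⟨0, Nat.pos_of_ne_zero hQ⟩) := by
    intro n
    induction n with
    | zero => intro j hj; congr 2; exact Fin.ext hj
    | succ n ih =>
      intro j hj
      have h1 := ih ⟨n, by omega⟩ rfl
      rw [← h1, ← ha (wv Q ⟨n, by omega⟩), rotEquiv_wv]
      congr 2
      apply Fin.ext
      simp only [hj]
      exact (Nat.mod_eq_of_lt (by omega)).symm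
  rw [h0 _ i rfl, h0 _ j rfl]

/-- Off the unit circle `pseudoInv` inverts the symbol and the kernel part vanishes; on it the left
side is zero and the right side vanishes by solvability. -/
theorem linOp_eq (hU : IsPolySolution o U) (hQe : Even Q) (hQ8 : 8 ≤ Q) (n : ℕ) (k : Quasilattice Q) :
    linOp (U (n + 1)).coeff k = (U n - (beta Q : ℂ)⁻¹ • cubicSum U n).coeff k := by
  have hQ : Q ≠ 0 := by omega
  unfold linOp
  by_cases hk : ‖(k : ℂ)‖ = 1
  · rw [(symbol_eq_zero_iff k).2 hk, zero_mul]
    obtain ⟨j, rfl⟩ := exists_eq_wv hQ hQe hk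
    have hmem : U n - (beta Q : ℂ)⁻¹ • cubicSum U n ∈ invariantSubring hQ := by
      have hb : (beta Q : ℂ)⁻¹ = ((beta Q)⁻¹ : ℝ) := by push_cast; rfl
      rw [hb]
      exact sub_mem (hU.mem_invariantSubring hQ n)
        (real_smul_mem hQ _ (cubicSum_mem _ fun i _ => hU.mem_invariantSubring hQ i))
    rw [SwiftHohenberg.mem_invariantSubring, ← rotInvariant_iff] at hmem
    rw [coeff_wv_eq hQ hmem.1 j o, hU.solvability_wv hQe hQ8]
  · have h0 := (symbol_eq_zero_iff k).not.2 hk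
    rw [hU.succ, AddMonoidAlgebra.coeff_add, Finsupp.add_apply, stepRange, coeff_pseudoInv, if_neg hk,
      AddMonoidAlgebra.coeff_smul_apply, coeff_leadingPoly_of_ne, smul_zero, add_zero,
      mul_inv_cancel_left₀ h0]
    rintro j rfl
    exact hk (norm_wv j)

theorem sum_conv_eq {V : ℕ → HSpace Q s} {f : ℕ → TrigPoly Q} {n : ℕ}
    (h : ∀ i ≤ n, V i = toH s (f i)) (k : Quasilattice Q) :
    ∑ p ∈ Finset.HasAntidiagonal.antidiagonal n, ∑ q ∈ Finset.HasAntidiagonal.antidiagonal p.2,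
      conv (conv (coeff (V p.1)) (coeff (V q.1))) (coeff (V q.2)) k = (cubicSum f n).coeff k := by
  simp only [cubicSum, AddMonoidAlgebra.coeff_sum, Finsupp.finsetSum_apply]
  refine Finset.sum_congr rfl fun p hp => Finset.sum_congr rfl fun q hq => ?_
  obtain ⟨-, h1, h2, h3⟩ := le_of_mem_antidiagonals hp hq
  rw [h _ h1, h _ h2, h _ h3, coeff_toH, coeff_toH, coeff_toH]
  have : conv (f p.1).coeff (f q.1).coeff = (f p.1 * f q.1).coeff := funext fun k => conv_coeff _ _ k
  rw [this, conv_coeff]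

theorem coeff_step (f : ℕ → TrigPoly Q) (n : ℕ) (k : Quasilattice Q) :
    (f n - (beta Q : ℂ)⁻¹ • cubicSum f n).coeff k =
      (f n).coeff k - (beta Q : ℂ)⁻¹ * (cubicSum f n).coeff k := rfl

theorem isFormalSolution (hU : IsPolySolution o U) (hQe : Even Q) (hQ8 : 8 ≤ Q) :
    IsFormalSolution fun n => toH s (U n) := by
  have hQ : Q ≠ 0 := by omega
  have hlead : ∀ k : Quasilattice Q,
      ((∃ j, (k : ℂ) = wavevector Q j) → (leadingPoly Q).coeff k = 1) ∧
      ((¬ ∃ j, (k : ℂ) = wavevector Q j) → (leadingPoly Q).coeff k = 0) := by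
    intro k
    constructor
    · rintro ⟨j, hj⟩
      have : k = wv Q j := Subtype.ext hj
      rw [this, coeff_leadingPoly_wv hQ]
    · intro h
      exact coeff_leadingPoly_of_ne fun j hj => h ⟨j, by rw [← hj]; rfl⟩
  refine ⟨fun k => ?_, fun n => ?_, fun k => ?_, fun n k => ?_⟩
  · rw [coeff_toH, hU.zero]
    exact hlead k
  · rw [coeff_toH, rotInvariant_iff hQ]
    exact ((SwiftHohenberg.mem_invariantSubring hQ _).1 (hU.mem_invariantSubring hQ n)).1
  · rw [coeff_toH, hU.zero, linOp]
    by_cases hk : ∃ j, (k : ℂ) = wavevector Q j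
    · obtain ⟨j, hj⟩ := hk
      rw [(symbol_eq_zero_iff k).2 (by rw [hj, norm_wavevector]), zero_mul]
    · rw [(hlead k).2 hk, mul_zero]
  · rw [sum_conv_eq (f := U) (fun i _ => rfl), coeff_toH, hU.linOp_eq hQe hQ8, coeff_step]
    rfl

/-- If two solutions agree up to order `n`, the equation fixes order `n + 1` off the unit circle, so
they differ there by some `a U⁽⁰⁾`. The equation of the following order, read at one wavevector,
then says `0 = a - 3a`. -/
theorem eq_of_isFormalSolution (hU : IsPolySolution o U) (hQe : Even Q) (hQ8 : 8 ≤ Q)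
    {V : ℕ → HSpace Q s} (hV : IsFormalSolution V) (n : ℕ) : V n = toH s (U n) := by
  have hQ : Q ≠ 0 := by omega
  have hS := hU.isFormalSolution (s := s) hQe hQ8
  induction n using Nat.strong_induction_on with
  | _ n ih =>
    cases n with
    | zero =>
      refine HSpace.ext (funext fun k => ?_)
      by_cases hk : ∃ j, (k : ℂ) = wavevector Q j
      · rw [(hV.leading k).1 hk, (hS.leading k).1 hk]
      · rw [(hV.leading k).2 hk, (hS.leading k).2 hk]
    | succ n =>
      set a := coeff (V (n + 1)) (wv Q o) - (U (n + 1)).coeff (wv Q o) with ha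
      have hVn : V (n + 1) = toH s (U (n + 1) + a • leadingPoly Q) := by
        refine HSpace.ext (funext fun k => ?_)
        rw [coeff_toH, AddMonoidAlgebra.coeff_add, Finsupp.add_apply,
          AddMonoidAlgebra.coeff_smul_apply, smul_eq_mul]
        by_cases hk : ‖(k : ℂ)‖ = 1
        · obtain ⟨j, rfl⟩ := exists_eq_wv hQ hQe hk
          have h1 : (U (n + 1)).coeff (wv Q j) = (U (n + 1)).coeff (wv Q o) :=
            coeff_wv_eq hQ (hS.invariant (n + 1)) j o
          rw [coeff_leadingPoly_wv hQ, coeff_wv_eq hQ (hV.invariant _) j o, h1, ha]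
          ring
        · have h1 := hV.order_succ n k
          rw [sum_conv_eq (f := U) (fun i hi => ih i (by omega)), ih n (by omega), coeff_toH,
            ← coeff_step, ← hU.linOp_eq hQe hQ8] at h1
          have h2 := mul_left_cancel₀ ((symbol_eq_zero_iff k).not.2 hk) h1
          rw [h2, coeff_leadingPoly_of_ne, mul_zero, add_zero]
          rintro j rfl
          exact hk (norm_wv j)
      have h3 := hV.order_succ (n + 1) (wv Q o)
      have hf : ∀ i ≤ n + 1, V i =
          toH s (Function.update U (n + 1) (U (n + 1) + a • leadingPoly Q) i) := by
        intro i hi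
        rcases eq_or_ne i (n + 1) with rfl | hne
        · rw [Function.update_self, hVn]
        · rw [Function.update_of_ne hne]; exact ih i (by omega)
      have hsol := hU.solvability_wv hQe hQ8 (n + 1)
      rw [coeff_step] at hsol
      rw [sum_conv_eq hf, cubicSum_update, Function.update_eq_self, hU.zero, linOp,
        (symbol_eq_zero_iff _).2 (norm_wv o), zero_mul, AddMonoidAlgebra.coeff_add, Finsupp.add_apply,
        three_mul_cube_coeff hQ hQe, hVn, coeff_toH, AddMonoidAlgebra.coeff_add, Finsupp.add_apply,
        AddMonoidAlgebra.coeff_smul_apply, coeff_leadingPoly_wv hQ, smul_eq_mul] at h3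
      have hb := beta_ne_zero hQ8
      have h4 : (0 : ℂ) = a - 3 * a := by
        have : (beta Q : ℂ)⁻¹ * (3 * a * beta Q) = 3 * a := by field_simp
        linear_combination h3 + hsol - this
      have ha0 : a = 0 := by linear_combination (1 / 2 : ℂ) * h4
      rw [hVn, ha0, zero_smul, add_zero]

end IsPolySolution

end FormalSolution
end SwiftHohenberg
end

noncomputable section
namespace SwiftHohenberg

open SwiftHohenberg.HSpace

/-! ### Majorants for factorially growing sequences. -/

section Gevrey

theorem factorial_succ_mul_factorial_succ_le (p q : ℕ) :
    (p + 1).factorial * (q + 1).factorial ≤ (p + q + 1).factorial := by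
  induction q with
  | zero => simp
  | succ q ih =>
    calc (p + 1).factorial * (q + 1 + 1).factorial
        = (q + 2) * ((p + 1).factorial * (q + 1).factorial) := by rw [Nat.factorial_succ (q + 1)]; ring
      _ ≤ (p + q + 2) * (p + q + 1).factorial := Nat.mul_le_mul (by omega) ih
      _ = (p + (q + 1) + 1).factorial := (Nat.factorial_succ (p + q + 1)).symm

/-- For `n ≥ 2` each end term equals `n!^m`, and each of the `n - 1` inner ones is at most `n!^m/n`,
because `(p+1)! (q+1)! ≤ (p+q+1)!` and `m ≥ 1`. Hence a constant independent of `n`. -/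
theorem sum_factorial_pow_le {m : ℕ} (hm : 1 ≤ m) (n : ℕ) :
    ∑ p ∈ Finset.HasAntidiagonal.antidiagonal n,
      ((p.1.factorial : ℝ) ^ m * (p.2.factorial : ℝ) ^ m) ≤ 3 * (n.factorial : ℝ) ^ m := by
  match n with
  | 0 => simp
  | 1 => simp [Finset.Nat.sum_antidiagonal_succ]; norm_num
  | n + 2 =>
    rw [Finset.Nat.sum_antidiagonal_succ, Finset.Nat.sum_antidiagonal_succ']
    have hterm : ∀ p ∈ Finset.HasAntidiagonal.antidiagonal n,
        (((p.1 + 1).factorial : ℝ) ^ m * ((p.2 + 1).factorial : ℝ) ^ m) ≤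
          ((n + 2).factorial : ℝ) ^ m / (n + 2) := by
      intro p hp
      rw [Finset.HasAntidiagonal.mem_antidiagonal] at hp
      rw [le_div_iff₀ (by positivity), ← mul_pow]
      have h1 := factorial_succ_mul_factorial_succ_le p.1 p.2
      rw [hp] at h1
      have h2 : (((p.1 + 1).factorial : ℝ) * ((p.2 + 1).factorial : ℝ)) ≤ ((n + 1).factorial : ℝ) := by
        exact_mod_cast h1
      have h3 : ((n : ℝ) + 2) ≤ ((n : ℝ) + 2) ^ m := le_self_pow₀ (by linarith [n.cast_nonneg (α := ℝ)]) (by omega)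
      calc _ ≤ ((n + 1).factorial : ℝ) ^ m * ((n : ℝ) + 2) ^ m :=
            mul_le_mul (pow_le_pow_left₀ (by positivity) h2 m) h3 (by positivity) (by positivity)
        _ = _ := by
          rw [← mul_pow, Nat.factorial_succ (n + 1)]
          push_cast
          ring
    have hsum := Finset.sum_le_card_nsmul _ _ _ hterm
    rw [Finset.Nat.card_antidiagonal, nsmul_eq_mul] at hsum
    have h4 : ((n + 1 : ℕ) : ℝ) * (((n + 2).factorial : ℝ) ^ m / (n + 2)) ≤ ((n + 2).factorial : ℝ) ^ m := by
      rw [mul_div_assoc', div_le_iff₀ (by positivity), mul_comm]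
      refine mul_le_mul_of_nonneg_left ?_ (by positivity)
      push_cast; linarith
    simp only [Nat.factorial_zero, Nat.cast_one, one_pow, mul_one, one_mul]
    have h5 : ((n + 1 + 1).factorial : ℝ) = ((n + 2).factorial : ℝ) := rfl
    rw [h5]
    linarith

theorem cubicSum_gevrey_le {m : ℕ} (hm : 1 ≤ m) {K : ℝ} (hK : 0 ≤ K) (n : ℕ) :
    cubicSum (fun n => K ^ n * (n.factorial : ℝ) ^ m) n ≤ 9 * (K ^ n * (n.factorial : ℝ) ^ m) := by
  have h2 : ∀ n, ∑ p ∈ Finset.HasAntidiagonal.antidiagonal n,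
      (K ^ p.1 * (p.1.factorial : ℝ) ^ m) * (K ^ p.2 * (p.2.factorial : ℝ) ^ m) ≤
        3 * (K ^ n * (n.factorial : ℝ) ^ m) := by
    intro n
    have : ∀ p ∈ Finset.HasAntidiagonal.antidiagonal n,
        (K ^ p.1 * (p.1.factorial : ℝ) ^ m) * (K ^ p.2 * (p.2.factorial : ℝ) ^ m) =
          K ^ n * ((p.1.factorial : ℝ) ^ m * (p.2.factorial : ℝ) ^ m) := by
      intro p hp
      rw [Finset.HasAntidiagonal.mem_antidiagonal] at hp
      rw [← hp, pow_add]; ring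
    rw [Finset.sum_congr rfl this, ← Finset.mul_sum]
    have := mul_le_mul_of_nonneg_left (sum_factorial_pow_le hm n) (pow_nonneg hK n)
    linarith
  unfold cubicSum
  simp only [mul_assoc, ← Finset.mul_sum]
  calc _ ≤ ∑ p ∈ Finset.HasAntidiagonal.antidiagonal n,
        3 * ((K ^ p.1 * (p.1.factorial : ℝ) ^ m) * (K ^ p.2 * (p.2.factorial : ℝ) ^ m)) := by
        refine Finset.sum_le_sum fun p _ => ?_
        have h3 := mul_le_mul_of_nonneg_left (h2 p.2)
          (show 0 ≤ K ^ p.1 * (p.1.factorial : ℝ) ^ m by positivity)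
        simp only [mul_assoc, Finset.mul_sum] at h3 ⊢
        linarith
    _ ≤ _ := by
        rw [← Finset.mul_sum]
        have := h2 n
        linarith

/-- Write `e n = Kⁿ n!^m`. The cubic sum of order `n + 1` is of the full size `e (n + 1)`, so
enlarging `K` alone does not close the induction. With its top entry removed, however, every nonzero
product has two factors of positive index. Proving `u n ≤ ε * e n` for `n ≥ 1`, besides `u n ≤ B * e
n`, brings a factor `ε²` that beats `ε`. The terms multiplied by `(n + 1)^m` are absorbed by a large
`K`. -/
theorem exists_gevrey_bound {m : ℕ} (hm : 1 ≤ m) {u : ℕ → ℝ} (hu : ∀ n, 0 ≤ u n) {D : ℝ}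
    (hD : 0 ≤ D)
    (h : ∀ n, u (n + 1) ≤ D * (((n : ℝ) + 1) ^ m * (u n + cubicSum u n) +
      cubicSum (Function.update u (n + 1) 0) (n + 1))) :
    ∃ K > (0 : ℝ), ∃ γ > (0 : ℝ), ∀ n, u n ≤ γ * K ^ n * (n.factorial : ℝ) ^ m := by
  set B := max 1 (u 0) with hB
  have hB1 : 1 ≤ B := le_max_left _ _
  have hB0 : 0 < B := by linarith
  -- Chosen so that `9 D ε² B ≤ ε/2`; the value of `K` below makes `D (B + 9B³) ≤ εK/2`, and the two
  -- halves add up to `ε`.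
  set ε := 1 / (18 * (D + 1) * B) with hε
  have hε0 : 0 < ε := by positivity
  have hεB : ε ≤ B := by
    rw [hε, div_le_iff₀ (by positivity)]
    have : 1 ≤ B * B := by nlinarith
    nlinarith
  set K := 2 * (D + 1) * (B + 9 * B ^ 3) / ε with hK
  have hK0 : 0 < K := by positivity
  set e : ℕ → ℝ := fun n => K ^ n * (n.factorial : ℝ) ^ m with he
  have he0 : ∀ n, 0 < e n := fun n => by simp only [he]; positivity
  have hDε : D * (9 * ε ^ 2 * B) ≤ ε / 2 := by
    have h1 : ε * (18 * (D + 1) * B) = 1 := by rw [hε]; field_simp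
    nlinarith [mul_pos hε0 hε0, mul_pos (mul_pos hε0 hε0) hB0]
  have hDK : D * (B + 9 * B ^ 3) ≤ ε / 2 * K := by
    have h1 : ε * K = 2 * (D + 1) * (B + 9 * B ^ 3) := by rw [hK]; field_simp
    have h2 : 0 < B + 9 * B ^ 3 := by positivity
    nlinarith
  have key : ∀ n, u n ≤ B * e n ∧ (1 ≤ n → u n ≤ ε * e n) := by
    intro n
    induction n using Nat.strong_induction_on with
    | _ n ih =>
      cases n with
      | zero => exact ⟨by simp [he, hB], by omega⟩
      | succ n =>
        suffices hs : u (n + 1) ≤ ε * e (n + 1) from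
          ⟨hs.trans (mul_le_mul_of_nonneg_right hεB (he0 _).le), fun _ => hs⟩
        have hun := (ih n (by omega)).1
        have hc1 : cubicSum u n ≤ B ^ 3 * (9 * e n) := by
          refine le_trans ?_ (mul_le_mul_of_nonneg_left (cubicSum_gevrey_le hm hK0.le n) (by positivity))
          unfold cubicSum
          simp only [Finset.mul_sum]
          refine Finset.sum_le_sum fun p hp => Finset.sum_le_sum fun q hq => ?_
          obtain ⟨-, h1, h2, h3⟩ := le_of_mem_antidiagonals hp hq
          have b1 := (ih p.1 (by omega)).1
          have b2 := (ih q.1 (by omega)).1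
          have b3 := (ih q.2 (by omega)).1
          calc _ ≤ (B * e p.1) * (B * e q.1) * (B * e q.2) :=
                mul_le_mul (mul_le_mul b1 b2 (hu _) (by have := he0 p.1; positivity)) b3 (hu _)
                  (by have := he0 p.1; have := he0 q.1; positivity)
            _ = _ := by ring
        have hc2 : cubicSum (Function.update u (n + 1) 0) (n + 1) ≤ (ε ^ 2 * B) * (9 * e (n + 1)) := by
          refine le_trans ?_ (mul_le_mul_of_nonneg_left (cubicSum_gevrey_le hm hK0.le (n + 1)) (by positivity))
          set v := Function.update u (n + 1) 0 with hv
          have hv0 : ∀ i, 0 ≤ v i := by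
            intro i
            rcases eq_or_ne i (n + 1) with rfl | hne
            · simp [hv]
            · rw [hv, Function.update_of_ne hne]; exact hu i
          have hvB : ∀ i ≤ n + 1, v i ≤ B * e i := by
            intro i hi
            rcases eq_or_ne i (n + 1) with rfl | hne
            · rw [hv, Function.update_self]; have := he0 (n + 1); positivity
            · rw [hv, Function.update_of_ne hne]; exact (ih i (by omega)).1
          have hvε : ∀ i ≤ n + 1, 1 ≤ i → v i ≤ ε * e i := by
            intro i hi hi1
            rcases eq_or_ne i (n + 1) with rfl | hne
            · rw [hv, Function.update_self]; have := he0 (n + 1); positivity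
            · rw [hv, Function.update_of_ne hne]; exact (ih i (by omega)).2 hi1
          have hvn : v (n + 1) = 0 := by rw [hv, Function.update_self]
          have prod_le : ∀ {x y z a b c : ℝ}, 0 ≤ x → 0 ≤ y → 0 ≤ z → x ≤ a → y ≤ b → z ≤ c →
              x * y * z ≤ a * b * c := fun hx hy hz ha hb hc =>
            mul_le_mul (mul_le_mul ha hb hy (hx.trans ha)) hc hz
              (mul_nonneg (hx.trans ha) (hy.trans hb))
          unfold cubicSum
          simp only [Finset.mul_sum]
          refine Finset.sum_le_sum fun p hp => Finset.sum_le_sum fun q hq => ?_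
          obtain ⟨h0, h1, h2, h3⟩ := le_of_mem_antidiagonals hp hq
          have e1 := he0 p.1
          have e2 := he0 q.1
          have e3 := he0 q.2
          change _ ≤ ε ^ 2 * B * (e p.1 * e q.1 * e q.2)
          -- The indices add up to `n + 1`. Unless one of them is `n + 1`, where `v` vanishes, at
          -- most one index is zero.
          by_cases hz : p.1 = n + 1 ∨ q.1 = n + 1 ∨ q.2 = n + 1
          · have : v p.1 * v q.1 * v q.2 = 0 := by
              rcases hz with hz | hz | hz <;> rw [hz, hvn] <;> ring
            rw [this]; positivity
          · rcases Nat.eq_zero_or_pos p.1 with hp0 | hp0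
            · calc _ ≤ _ := prod_le (hv0 _) (hv0 _) (hv0 _) (hvB _ h1) (hvε _ h2 (by omega))
                    (hvε _ h3 (by omega))
                _ = _ := by ring
            · rcases Nat.eq_zero_or_pos q.1 with hq0 | hq0
              · calc _ ≤ _ := prod_le (hv0 _) (hv0 _) (hv0 _) (hvε _ h1 hp0) (hvB _ h2)
                      (hvε _ h3 (by omega))
                  _ = _ := by ring
              · calc _ ≤ _ := prod_le (hv0 _) (hv0 _) (hv0 _) (hvε _ h1 hp0) (hvε _ h2 hq0) (hvB _ h3)
                  _ = _ := by ring
        have hstep : ((n : ℝ) + 1) ^ m * e n * K = e (n + 1) := by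
          simp only [he, Nat.factorial_succ, pow_succ K]
          push_cast
          rw [mul_pow]; ring
        have hn1 : 0 ≤ ((n : ℝ) + 1) ^ m := by positivity
        calc u (n + 1) ≤ _ := h n
          _ ≤ D * (((n : ℝ) + 1) ^ m * (B * e n + B ^ 3 * (9 * e n)) + (ε ^ 2 * B) * (9 * e (n + 1))) := by
            gcongr
          _ = (D * (B + 9 * B ^ 3)) * (((n : ℝ) + 1) ^ m * e n) + (D * (9 * ε ^ 2 * B)) * e (n + 1) := by ring
          _ ≤ (ε / 2 * K) * (((n : ℝ) + 1) ^ m * e n) + (ε / 2) * e (n + 1) := by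
            have := he0 n
            have := he0 (n + 1)
            gcongr
          _ = ε * e (n + 1) := by rw [← hstep]; ring
  refine ⟨K, hK0, B, hB0, fun n => ?_⟩
  have := (key n).1
  simp only [he] at this
  linarith

end Gevrey

/-! ### Gevrey bound for the formal solution. -/

section GevreySolution

variable {Q : ℕ} {s : ℝ}

theorem norm_toH_le_of_coeff_le {x y : TrigPoly Q} {c : ℝ} (hc : 0 ≤ c)
    (h : ∀ k, ‖x.coeff k‖ ≤ c * ‖y.coeff k‖) : ‖toH s x‖ ≤ c * ‖toH s y‖ := by
  refine le_of_sq_le_sq ?_ (by positivity)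
  rw [mul_pow, norm_sq_eq, norm_sq_eq, ← tsum_mul_left]
  refine (summable_coeff_sq _).tsum_le_tsum (fun k => ?_) ((summable_coeff_sq _).mul_left _)
  rw [coeff_toH, coeff_toH]
  have := pow_le_pow_left₀ (norm_nonneg _) (h k) 2
  have := mul_le_mul_of_nonneg_left this (weight_pos s k).le
  linarith [mul_pow c ‖y.coeff k‖ 2]

/-- `small_divisor` made uniform on a finite range of orders: inverting the symbol is a diagonal
operation, so its largest factor bounds it. -/
theorem norm_toH_pseudoInv_le (hQe : Even Q) (hQ8 : 8 ≤ Q) {m : ℕ} {x : TrigPoly Q}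
    (hx : OrderLE m x) : ‖toH s (pseudoInv x)‖ ≤ (1 + (m : ℝ) ^ 2) ^ (2 * ell Q) * ‖toH s x‖ := by
  refine norm_toH_le_of_coeff_le (by positivity) fun k => ?_
  rw [coeff_pseudoInv]
  split_ifs with hk
  · rw [norm_zero]; positivity
  · by_cases hxk : x.coeff k = 0
    · simp [hxk]
    rw [norm_mul]
    refine mul_le_mul_of_nonneg_right ?_ (norm_nonneg _)
    have h1 := small_divisor hQe hQ8 hk
    have h2 : ‖((1 - (‖(k : ℂ)‖ : ℂ) ^ 2) ^ 2)⁻¹‖ = ((1 - ‖(k : ℂ)‖ ^ 2) ^ 2)⁻¹ := by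
      rw [norm_inv, ← Complex.ofReal_pow, ← Complex.ofReal_one, ← Complex.ofReal_sub,
        ← Complex.ofReal_pow, Complex.norm_real, Real.norm_of_nonneg (sq_nonneg _)]
    have h3 : (1 + (order k : ℝ) ^ 2) ^ (2 * ell Q) ≤ (1 + (m : ℝ) ^ 2) ^ (2 * ell Q) := by
      have : (order k : ℝ) ≤ m := by exact_mod_cast hx k hxk
      gcongr
    have h4 : 0 < (1 - ‖(k : ℂ)‖ ^ 2) ^ 2 := by
      refine lt_of_le_of_ne (sq_nonneg _) fun h => ?_
      rw [← h, zero_mul] at h1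
      linarith
    rw [h2, inv_le_iff_one_le_mul₀' h4]
    exact h1.trans (mul_le_mul_of_nonneg_left h3 h4.le)

/-- The inversion acts on orders at most `2n + 3`, and `1 + (2n+3)² ≤ 10 (n+1)²`; raised to the
power `2l` this is the source of the exponent `4l`. The kernel coefficient costs no further
division. -/
theorem IsPolySolution.gevreyBound {o : Fin Q} {U : ℕ → TrigPoly Q} (hU : IsPolySolution o U)
    (hQe : Even Q) (hQ8 : 8 ≤ Q) (hs : 0 ≤ s)
    (hw : Summable fun k : Quasilattice Q => (weight s k)⁻¹) :
    ∃ K > (0 : ℝ), ∃ γ > (0 : ℝ), GevreyBound (fun n => toH s (U n)) γ K := by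
  obtain ⟨B, hB⟩ := exists_mulCLM hs hw
  set M := ‖B‖ with hM
  have hM0 : 0 ≤ M := by positivity
  have hmul : ∀ x y : TrigPoly Q, ‖toH s (x * y)‖ ≤ M * ‖toH s x‖ * ‖toH s y‖ := by
    intro x y
    have : toH s (x * y) = B (toH s x) (toH s y) := by
      refine HSpace.ext (funext fun k => ?_)
      rw [hB, coeff_toH, coeff_toH, coeff_toH, conv_coeff]
    rw [this]
    exact B.le_opNorm₂ _ _
  have hcub : ∀ (f : ℕ → TrigPoly Q) n, ‖toH s (cubicSum f n)‖ ≤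
      M ^ 2 * cubicSum (fun i => ‖toH s (f i)‖) n := by
    intro f n
    unfold cubicSum
    simp only [map_sum, Finset.mul_sum]
    refine (norm_sum_le _ _).trans (Finset.sum_le_sum fun p _ => ?_)
    refine (norm_sum_le _ _).trans (Finset.sum_le_sum fun q _ => ?_)
    calc _ ≤ _ := hmul _ _
      _ ≤ M * (M * ‖toH s (f p.1)‖ * ‖toH s (f q.1)‖) * ‖toH s (f q.2)‖ := by
        have := hmul (f p.1) (f q.1)
        gcongr
      _ = _ := by ring
  have hb : 0 < beta Q := by
    unfold beta
    have : (8 : ℝ) ≤ Q := by exact_mod_cast hQ8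
    linarith
  set b := (beta Q)⁻¹ with hbdef
  have hb0 : 0 < b := inv_pos.2 hb
  set u : ℕ → ℝ := fun n => ‖toH s (U n)‖ with hu
  have hu0 : ∀ n, 0 ≤ u n := fun n => norm_nonneg _
  have hcu : ∀ n, 0 ≤ cubicSum u n := fun n => Finset.sum_nonneg fun p _ =>
    Finset.sum_nonneg fun q _ => mul_nonneg (mul_nonneg (hu0 _) (hu0 _)) (hu0 _)
  have hnb : ‖(beta Q : ℂ)⁻¹‖ = b := by
    rw [norm_inv, Complex.norm_real, Real.norm_of_nonneg hb.le]
  set c := (10 : ℝ) ^ (2 * ell Q) * (1 + b * M ^ 2) with hc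
  have hc0 : 0 ≤ c := by positivity
  have hW : ∀ n, ‖toH s (stepRange n U)‖ ≤ c * (((n : ℝ) + 1) ^ (4 * ell Q) * (u n + cubicSum u n)) := by
    intro n
    have hle : OrderLE (2 * n + 3) (U n - (beta Q : ℂ)⁻¹ • cubicSum U n) :=
      ((hU.orderLE n).mono (by omega)).sub ((OrderLE.cubicSum fun i _ => hU.orderLE i).smul _)
    have h1 := norm_toH_pseudoInv_le (s := s) hQe hQ8 hle
    have h2 : ‖toH s (U n - (beta Q : ℂ)⁻¹ • cubicSum U n)‖ ≤ (1 + b * M ^ 2) * (u n + cubicSum u n) := by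
      rw [map_sub, map_smul]
      refine (norm_sub_le _ _).trans ?_
      rw [norm_smul, hnb]
      have h3 := mul_le_mul_of_nonneg_left (hcub U n) hb0.le
      have h4 := hcu n
      have h5 := hu0 n
      have h6 : 0 ≤ b * M ^ 2 * u n := by positivity
      calc _ ≤ u n + b * (M ^ 2 * cubicSum u n) := by gcongr
        _ ≤ _ := by nlinarith
    have h7 : (1 + ((2 * n + 3 : ℕ) : ℝ) ^ 2) ^ (2 * ell Q) ≤
        10 ^ (2 * ell Q) * ((n : ℝ) + 1) ^ (4 * ell Q) := by
      have : ((n : ℝ) + 1) ^ (4 * ell Q) = (((n : ℝ) + 1) ^ 2) ^ (2 * ell Q) := by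
        rw [← pow_mul]; congr 1; ring
      rw [this, ← mul_pow]
      refine pow_le_pow_left₀ (by positivity) ?_ _
      push_cast
      nlinarith [n.cast_nonneg (α := ℝ)]
    calc _ ≤ _ := h1
      _ ≤ (10 ^ (2 * ell Q) * ((n : ℝ) + 1) ^ (4 * ell Q)) * ((1 + b * M ^ 2) * (u n + cubicSum u n)) := by
        gcongr
      _ = _ := by rw [hc]; ring
  set a := 3 * M ^ 2 * u 0 ^ 2 with ha
  have ha0 : 0 ≤ a := by have := hu0 0; positivity
  have hK : ∀ n, ‖stepKernel o n U‖ ≤ b * (M ^ 2 * cubicSum (Function.update u (n + 1) 0) (n + 1) +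
      a * ‖toH s (stepRange n U)‖) := by
    intro n
    set W := stepRange n U with hWdef
    -- The new term `W` enters the cubic sum only through `3 U₀² W`. Splitting it off leaves a sum
    -- over known terms, the form required by `exists_gevrey_bound`.
    have h1 : cubicSum (Function.update U (n + 1) W) (n + 1) =
        cubicSum (Function.update U (n + 1) 0) (n + 1) + (3 : ℂ) • (U 0 * U 0 * W) := by
      have := cubicSum_update U n 0 W
      rw [zero_add] at this
      have h3 : (3 : TrigPoly Q) = algebraMap ℂ _ 3 := (map_ofNat _ 3).symm
      rw [this, Algebra.smul_def, ← h3]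
      ring
    have h2 : ‖toH s (cubicSum (Function.update U (n + 1) W) (n + 1))‖ ≤
        M ^ 2 * cubicSum (Function.update u (n + 1) 0) (n + 1) + a * ‖toH s W‖ := by
      rw [h1, map_add, map_smul]
      refine (norm_add_le _ _).trans (add_le_add ?_ ?_)
      · refine (hcub _ _).trans (le_of_eq ?_)
        congr 2
        funext i
        rcases eq_or_ne i (n + 1) with rfl | hne
        · simp
        · rw [Function.update_of_ne hne, Function.update_of_ne hne]
      · rw [norm_smul]
        have h3 : ‖(3 : ℂ)‖ = 3 := by simp
        rw [h3]
        have h4 := hmul (U 0 * U 0) W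
        have h5 := hmul (U 0) (U 0)
        calc 3 * ‖toH s (U 0 * U 0 * W)‖ ≤ 3 * (M * (M * u 0 * u 0) * ‖toH s W‖) := by
              refine mul_le_mul_of_nonneg_left (h4.trans ?_) (by norm_num)
              gcongr
          _ = _ := by rw [ha]; ring
    rw [stepKernel, norm_mul, norm_neg, norm_inv, norm_mul, Complex.norm_real,
      Real.norm_of_nonneg hb.le]
    have h3 : ‖(2 : ℂ)‖ = 2 := by simp
    rw [h3]
    have h4 := norm_coeff_le hs (toH s (cubicSum (Function.update U (n + 1) W) (n + 1))) (wv Q o)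
    rw [coeff_toH] at h4
    have h5 : (2 * beta Q)⁻¹ ≤ b := inv_anti₀ hb (by linarith)
    exact mul_le_mul h5 (h4.trans h2) (norm_nonneg _) hb0.le
  have hu' : ∀ n i, 0 ≤ Function.update u (n + 1) 0 i := by
    intro n i
    rcases eq_or_ne i (n + 1) with rfl | hne
    · simp
    · rw [Function.update_of_ne hne]; exact hu0 i
  refine exists_gevrey_bound (m := 4 * ell Q) (by have := (ell_pos hQe hQ8).1; omega) hu0
    (D := (1 + u 0 * b * a) * c + u 0 * b * M ^ 2) (by have := hu0 0; positivity) fun n => ?_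
  set S := cubicSum (Function.update u (n + 1) 0) (n + 1) with hS
  have hS0 : 0 ≤ S := Finset.sum_nonneg fun p _ =>
    Finset.sum_nonneg fun q _ => mul_nonneg (mul_nonneg (hu' _ _) (hu' _ _)) (hu' _ _)
  set T := ((n : ℝ) + 1) ^ (4 * ell Q) * (u n + cubicSum u n) with hT
  have hT0 : 0 ≤ T := by have := hu0 n; have := hcu n; positivity
  have hw1 : ‖toH s (stepRange n U)‖ ≤ c * T := hW n
  have hk1 := hK n
  have h00 := hu0 0
  have h1 : u (n + 1) ≤ ‖toH s (stepRange n U)‖ + ‖stepKernel o n U‖ * u 0 := by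
    simp only [hu]
    rw [hU.succ, ← hU.zero, map_add, map_smul]
    refine (norm_add_le _ _).trans ?_
    rw [norm_smul]
  calc u (n + 1) ≤ _ := h1
    _ ≤ c * T + (b * (M ^ 2 * S + a * (c * T))) * u 0 := by
      refine add_le_add hw1 (mul_le_mul_of_nonneg_right (hk1.trans ?_) h00)
      gcongr
    _ ≤ _ := by
      have e1 : 0 ≤ (1 + u 0 * b * a) * c * S := by positivity
      have e2 : 0 ≤ u 0 * b * M ^ 2 * T := by positivity
      nlinarith

end GevreySolution
end SwiftHohenberg
end

noncomputable section
namespace SwiftHohenberg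

/-! ### The incomplete Gamma function and its approximate multiplicativity. -/

section IncompleteGamma

theorem nonneg_of_hasDerivAt_nonneg {f f' : ℝ → ℝ} (h0 : f 0 = 0)
    (hf : ∀ x, HasDerivAt f (f' x) x) {X : ℝ} (hX : 0 ≤ X) (hf' : ∀ x, 0 ≤ x → x ≤ X → 0 ≤ f' x) :
    0 ≤ f X := by
  have hmono : MonotoneOn f (Set.Icc 0 X) := by
    refine monotoneOn_of_deriv_nonneg (convex_Icc 0 X)
      (fun x _ => (hf x).continuousAt.continuousWithinAt)
      (fun x _ => (hf x).differentiableAt.differentiableWithinAt) fun x hx => ?_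
    rw [interior_Icc] at hx
    rw [(hf x).deriv]
    exact hf' x hx.1.le hx.2.le
  rw [← h0]
  exact hmono ⟨le_rfl, hX⟩ ⟨hX, le_rfl⟩ hX

/-- The normalized lower incomplete Gamma function `∫₀ˣ e⁻ᵗ tᵖ / p! dt`. -/
def incGamma (p : ℕ) (x : ℝ) : ℝ :=
  1 - Real.exp (-x) * ∑ k ∈ Finset.range (p + 1), x ^ k / k.factorial

theorem incGamma_succ (p : ℕ) (x : ℝ) :
    incGamma (p + 1) x = incGamma p x - Real.exp (-x) * (x ^ (p + 1) / (p + 1).factorial) := by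
  rw [incGamma, incGamma, Finset.sum_range_succ _ (p + 1)]
  ring

theorem incGamma_zero_left (x : ℝ) : incGamma 0 x = 1 - Real.exp (-x) := by
  simp [incGamma]

theorem incGamma_zero (p : ℕ) : incGamma p 0 = 0 := by
  induction p with
  | zero => simp [incGamma_zero_left]
  | succ p ih => rw [incGamma_succ, ih]; simp

theorem hasDerivAt_exp_neg (x : ℝ) : HasDerivAt (fun x => Real.exp (-x)) (-Real.exp (-x)) x := by
  have := (hasDerivAt_neg x).exp
  refine this.congr_deriv ?_
  ring

theorem hasDerivAt_pow_div_factorial (p : ℕ) (x : ℝ) :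
    HasDerivAt (fun x : ℝ => x ^ (p + 1) / (p + 1).factorial) (x ^ p / p.factorial) x := by
  have := (hasDerivAt_pow (p + 1) x).div_const ((p + 1).factorial : ℝ)
  refine this.congr_deriv ?_
  rw [Nat.factorial_succ]
  push_cast
  have : (p.factorial : ℝ) ≠ 0 := by positivity
  have : (p : ℝ) + 1 ≠ 0 := by positivity
  field_simp

theorem hasDerivAt_incGamma (p : ℕ) (x : ℝ) :
    HasDerivAt (incGamma p) (Real.exp (-x) * (x ^ p / p.factorial)) x := by
  induction p with
  | zero =>
    have h : incGamma 0 = fun x => 1 - Real.exp (-x) := funext incGamma_zero_left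
    rw [h]
    have := (hasDerivAt_exp_neg x).const_sub 1
    refine this.congr_deriv ?_
    simp
  | succ p ih =>
    have h : incGamma (p + 1) = fun x => incGamma p x -
        Real.exp (-x) * (x ^ (p + 1) / (p + 1).factorial) := funext (incGamma_succ p)
    rw [h]
    have := ih.sub ((hasDerivAt_exp_neg x).mul (hasDerivAt_pow_div_factorial p x))
    refine this.congr_deriv ?_
    ring

theorem incGamma_nonneg (p : ℕ) {x : ℝ} (hx : 0 ≤ x) : 0 ≤ incGamma p x :=
  nonneg_of_hasDerivAt_nonneg (incGamma_zero p) (hasDerivAt_incGamma p) hx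
    fun y hy _ => by positivity

theorem incGamma_le_one (p : ℕ) {x : ℝ} (hx : 0 ≤ x) : incGamma p x ≤ 1 := by
  have : 0 ≤ Real.exp (-x) * ∑ k ∈ Finset.range (p + 1), x ^ k / k.factorial :=
    mul_nonneg (Real.exp_nonneg _) (Finset.sum_nonneg fun k _ => by positivity)
  unfold incGamma
  linarith

/-- Compare derivatives on `[0, x]`, where `y^(m+d) ≤ x^d y^m`, and use `incGamma m ≤ 1`. -/
theorem incGamma_add_le (m d : ℕ) {x : ℝ} (hx : 0 ≤ x) :
    incGamma (m + d) x ≤ x ^ d * m.factorial / (m + d).factorial := by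
  have h1 := nonneg_of_hasDerivAt_nonneg
    (f := fun y => x ^ d * m.factorial / (m + d).factorial * incGamma m y - incGamma (m + d) y)
    (by simp [incGamma_zero])
    (fun y => ((hasDerivAt_incGamma m y).const_mul _).sub (hasDerivAt_incGamma (m + d) y)) hx
    fun y hy hyx => by
      have h2 : y ^ d ≤ x ^ d := pow_le_pow_left₀ hy hyx d
      have hm : (m.factorial : ℝ) ≠ 0 := by positivity
      have : x ^ d * m.factorial / (m + d).factorial * (Real.exp (-y) * (y ^ m / m.factorial)) -
          Real.exp (-y) * (y ^ (m + d) / (m + d).factorial) =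
          Real.exp (-y) * y ^ m / (m + d).factorial * (x ^ d - y ^ d) := by
        rw [pow_add]; field_simp
      rw [this]
      exact mul_nonneg (by positivity) (by linarith)
  have h2 : 0 ≤ x ^ d * m.factorial / (m + d).factorial := by positivity
  nlinarith [incGamma_le_one m hx]

theorem incGamma_le (p : ℕ) {x : ℝ} (hx : 0 ≤ x) : incGamma p x ≤ x ^ p / p.factorial := by
  have := incGamma_add_le 0 p hx
  simpa using this

/-- Put `G_q = e^x (γ_p γ_q - γ_{p+q})`. The recurrence for `γ` gives `G_{q+1}' = G_q + (x^p/p!)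
γ_{q+1}`, so the bound follows by induction on `q` and comparison of derivatives, from `G_0 = -γ_p`.
-/
theorem abs_incGamma_mul_sub_le {p : ℕ} (hp : 1 ≤ p) (q : ℕ) {x : ℝ} (hx : 0 ≤ x) :
    |incGamma p x * incGamma q x - incGamma (p + q) x| ≤
      Real.exp (-x) * (x ^ (p + q) / (p.factorial * q.factorial)) := by
  have key : ∀ q : ℕ, ∀ x : ℝ, 0 ≤ x →
      |Real.exp x * (incGamma p x * incGamma q x - incGamma (p + q) x)| ≤
        x ^ (p + q) / (p.factorial * q.factorial) := by
    intro q
    induction q with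
    | zero =>
      intro x hx
      have h1 : Real.exp x * (incGamma p x * incGamma 0 x - incGamma (p + 0) x) = -incGamma p x := by
        rw [incGamma_zero_left, add_zero]
        have : Real.exp x * Real.exp (-x) = 1 := by rw [← Real.exp_add]; simp
        linear_combination (-incGamma p x) * this
      rw [h1, abs_neg, abs_of_nonneg (incGamma_nonneg p hx)]
      simpa using incGamma_le p hx
    | succ q ih =>
      intro X hX
      set G : ℕ → ℝ → ℝ := fun q x =>
        Real.exp x * (incGamma p x * incGamma q x - incGamma (p + q) x) with hG
      have hG0 : G (q + 1) 0 = 0 := by simp [hG, incGamma_zero]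
      have hGd : ∀ x, HasDerivAt (G (q + 1)) (G q x + x ^ p / p.factorial * incGamma (q + 1) x) x := by
        intro x
        have h := (Real.hasDerivAt_exp x).mul
          (((hasDerivAt_incGamma p x).mul (hasDerivAt_incGamma (q + 1) x)).sub
            (hasDerivAt_incGamma (p + (q + 1)) x))
        refine h.congr_deriv ?_
        have h1 := incGamma_succ q x
        have h2 := incGamma_succ (p + q) x
        have h3 : Real.exp x * Real.exp (-x) = 1 := by rw [← Real.exp_add]; simp
        simp only [hG, Pi.mul_apply, Pi.sub_apply, ← add_assoc]
        rw [h2, h1]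
        linear_combination (x ^ p / p.factorial *
          (incGamma q x - Real.exp (-x) * (x ^ (q + 1) / (q + 1).factorial))) * h3
      have hH : ∀ x : ℝ, HasDerivAt (fun x : ℝ => x ^ (p + (q + 1)) / (p.factorial * (q + 1).factorial))
          ((p + q + 1) * x ^ (p + q) / (p.factorial * (q + 1).factorial)) x := by
        intro x
        have := (hasDerivAt_pow (p + (q + 1)) x).div_const
          ((p.factorial : ℝ) * (q + 1).factorial)
        refine this.congr_deriv ?_
        push_cast
        rw [show p + (q + 1) - 1 = p + q by omega]
        ring
      have hbd : ∀ x, 0 ≤ x → |G q x + x ^ p / p.factorial * incGamma (q + 1) x| ≤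
          (p + q + 1) * x ^ (p + q) / (p.factorial * (q + 1).factorial) := by
        intro x hx
        have h1 := ih x hx
        have h2 : incGamma (q + 1) x ≤ x ^ q / (q + 1).factorial := by
          have := incGamma_add_le 1 q hx
          rw [add_comm 1 q] at this
          simpa using this
        have h3 := incGamma_nonneg (q + 1) hx
        have h4 : |x ^ p / p.factorial * incGamma (q + 1) x| ≤
            x ^ p / p.factorial * (x ^ q / (q + 1).factorial) := by
          rw [abs_of_nonneg (by positivity)]
          exact mul_le_mul_of_nonneg_left h2 (by positivity)
        refine (abs_add_le _ _).trans ((add_le_add h1 h4).trans ?_)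
        have h5 : x ^ (p + q) / (p.factorial * q.factorial) +
            x ^ p / p.factorial * (x ^ q / (q + 1).factorial) =
            (q + 1 + 1) * x ^ (p + q) / (p.factorial * (q + 1).factorial) := by
          rw [Nat.factorial_succ, pow_add]
          push_cast
          have : (q.factorial : ℝ) ≠ 0 := by positivity
          have : (p.factorial : ℝ) ≠ 0 := by positivity
          have : (q : ℝ) + 1 ≠ 0 := by positivity
          field_simp
        rw [h5]
        -- The two contributions add up to the factor `q + 2`, while the derivative of the bound
        -- offers `p + q + 1`: this is why `p ≥ 1` is needed.
        have : (1 : ℝ) ≤ p := by exact_mod_cast hp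
        refine div_le_div_of_nonneg_right (mul_le_mul_of_nonneg_right ?_ (by positivity))
          (by positivity)
        linarith
      rw [abs_le]
      constructor
      · have := nonneg_of_hasDerivAt_nonneg (f := fun x =>
          x ^ (p + (q + 1)) / (p.factorial * (q + 1).factorial) + G (q + 1) x) (by simp [hG0])
          (fun x => (hH x).add (hGd x)) hX fun x hx _ => by
            have := (abs_le.1 (hbd x hx)).1
            linarith
        simp only [hG] at this ⊢
        linarith
      · have := nonneg_of_hasDerivAt_nonneg (f := fun x =>
          x ^ (p + (q + 1)) / (p.factorial * (q + 1).factorial) - G (q + 1) x) (by simp [hG0])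
          (fun x => (hH x).sub (hGd x)) hX fun x hx _ => by
            have := (abs_le.1 (hbd x hx)).2
            linarith
        simp only [hG] at this ⊢
        linarith
  have h := key q x hx
  rw [abs_mul, abs_of_pos (Real.exp_pos x)] at h
  rw [Real.exp_neg, inv_mul_eq_div, le_div_iff₀ (Real.exp_pos x), mul_comm]
  exact h

theorem integral_exp_mul_pow (p : ℕ) {a ν : ℝ} (hν : 0 < ν) :
    ∫ ζ in (0 : ℝ)..a, Real.exp (-ζ / ν) * (ζ ^ p / p.factorial) = ν ^ (p + 1) * incGamma p (a / ν) := by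
  have hd : ∀ ζ ∈ Set.uIcc 0 a, HasDerivAt (fun ζ => ν ^ (p + 1) * incGamma p (ζ / ν))
      (Real.exp (-ζ / ν) * (ζ ^ p / p.factorial)) ζ := by
    intro ζ _
    have h := ((hasDerivAt_incGamma p (ζ / ν)).comp ζ ((hasDerivAt_id ζ).div_const ν)).const_mul
      (ν ^ (p + 1))
    refine h.congr_deriv ?_
    rw [neg_div, div_pow, pow_succ]
    field_simp
  rw [intervalIntegral.integral_eq_sub_of_hasDerivAt hd]
  · simp [incGamma_zero]
  · exact Continuous.intervalIntegrable (by fun_prop) _ _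

end IncompleteGamma

/-! ### Flat functions and truncated Laplace transforms of monomials. -/

section BoundedDerivatives

/-- `f` is of class `C^n` and its derivatives up to order `n` are bounded by `B`. -/
def BoundedDerivs (n : ℕ) (f : ℝ → ℝ) (B : ℝ) : Prop :=
  ContDiff ℝ n f ∧ ∀ i ≤ n, ∀ x, |iteratedDeriv i f x| ≤ B

theorem BoundedDerivs.mono {n : ℕ} {f : ℝ → ℝ} {B B' : ℝ} (h : BoundedDerivs n f B) (hB : B ≤ B') :
    BoundedDerivs n f B' := ⟨h.1, fun i hi x => (h.2 i hi x).trans hB⟩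

theorem BoundedDerivs.add {n : ℕ} {f g : ℝ → ℝ} {B B' : ℝ} (hf : BoundedDerivs n f B)
    (hg : BoundedDerivs n g B') : BoundedDerivs n (fun x => f x + g x) (B + B') := by
  refine ⟨hf.1.add hg.1, fun i hi x => ?_⟩
  have hin : ((i : ℕ) : WithTop ℕ∞) ≤ n := by exact_mod_cast hi
  have := iteratedDeriv_fun_add (x := x) (hf.1.of_le hin).contDiffAt (hg.1.of_le hin).contDiffAt
  rw [this]
  exact (abs_add_le _ _).trans (add_le_add (hf.2 i hi x) (hg.2 i hi x))

theorem BoundedDerivs.const_mul {n : ℕ} {f : ℝ → ℝ} {B : ℝ} (c : ℝ) (hf : BoundedDerivs n f B) :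
    BoundedDerivs n (fun x => c * f x) (|c| * B) := by
  refine ⟨contDiff_const.mul hf.1, fun i hi x => ?_⟩
  have hin : ((i : ℕ) : WithTop ℕ∞) ≤ n := by exact_mod_cast hi
  have := iteratedDeriv_const_mul (x := x) c (hf.1.of_le hin).contDiffAt
  rw [this, abs_mul]
  exact mul_le_mul_of_nonneg_left (hf.2 i hi x) (abs_nonneg _)

theorem BoundedDerivs.succ {n : ℕ} {f f' : ℝ → ℝ} {B : ℝ} (h0 : ∀ x, |f x| ≤ B)
    (hd : ∀ x, HasDerivAt f (f' x) x) (hf' : BoundedDerivs n f' B) : BoundedDerivs (n + 1) f B := by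
  have hderiv : deriv f = f' := funext fun x => (hd x).deriv
  refine ⟨?_, fun i hi x => ?_⟩
  · push_cast
    refine contDiff_succ_iff_deriv.2 ⟨fun x => (hd x).differentiableAt, by simp, ?_⟩
    rw [hderiv]; exact hf'.1
  · cases i with
    | zero => simpa using h0 x
    | succ i =>
      rw [iteratedDeriv_succ', hderiv]
      exact hf'.2 i (by omega) x

theorem hasDerivAt_zero_of_abs_le_sq {f : ℝ → ℝ} {C : ℝ} (h : ∀ x, |f x| ≤ C * x ^ 2) :
    HasDerivAt f 0 0 := by
  have h0 : f 0 = 0 := by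
    have := h 0
    simpa using this
  rw [hasDerivAt_iff_isLittleO]
  simp only [h0, sub_zero, smul_zero]
  have h1 : f =O[𝓝 0] fun x : ℝ => x ^ 2 :=
    Asymptotics.IsBigO.of_bound C (Eventually.of_forall fun x => by
      rw [Real.norm_eq_abs, Real.norm_of_nonneg (sq_nonneg x)]; exact h x)
  have h2 : (fun x : ℝ => x ^ 2) =o[𝓝 0] fun x => x := by
    have := Asymptotics.isLittleO_pow_pow (𝕜 := ℝ) (show 1 < 2 by norm_num)
    simpa using this
  exact h1.trans_isLittleO h2

/-- The flat function `e^{-a/ν} ν^{-j}`, extended by zero to `ν ≤ 0`. -/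
def flat (a : ℝ) (j : ℕ) (ν : ℝ) : ℝ := if ν ≤ 0 then 0 else Real.exp (-a / ν) / ν ^ j

/-- The truncated Laplace transform of `ζᵖ/p!`, extended by zero to `ν ≤ 0`. -/
def truncMono (a : ℝ) (p : ℕ) (ν : ℝ) : ℝ := if ν ≤ 0 then 0 else ν ^ p * incGamma p (a / ν)

variable {a : ℝ}

theorem flat_of_pos {ν : ℝ} (hν : 0 < ν) (j : ℕ) : flat a j ν = Real.exp (-a / ν) / ν ^ j :=
  if_neg hν.not_ge

theorem truncMono_of_pos {ν : ℝ} (hν : 0 < ν) (p : ℕ) :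
    truncMono a p ν = ν ^ p * incGamma p (a / ν) := if_neg hν.not_ge

theorem abs_flat_le (ha : 0 < a) (j : ℕ) (ν : ℝ) : |flat a j ν| ≤ j.factorial / a ^ j := by
  rcases le_or_gt ν 0 with hν | hν
  · rw [flat, if_pos hν, abs_zero]; positivity
  · rw [flat_of_pos hν, abs_of_nonneg (by positivity)]
    have h := Real.pow_div_factorial_le_exp (a / ν) (by positivity) j
    rw [neg_div, Real.exp_neg, div_le_div_iff₀ (by positivity) (by positivity), inv_mul_eq_div,
      div_le_iff₀ (Real.exp_pos _)]
    rw [div_le_iff₀ (by positivity), div_pow, div_le_iff₀ (by positivity)] at h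
    linarith

/-- The family of flat functions is stable under differentiation, also at zero, where `flat a j =
O(ν²)`. Smoothness and bounds on all derivatives follow by induction. -/
theorem hasDerivAt_flat (ha : 0 < a) (j : ℕ) (ν : ℝ) :
    HasDerivAt (flat a j) (a * flat a (j + 2) ν + (-j) * flat a (j + 1) ν) ν := by
  rcases lt_trichotomy ν 0 with hν | hν | hν
  · have h : flat a j =ᶠ[𝓝 ν] fun _ => 0 := by
      filter_upwards [gt_mem_nhds hν] with y hy
      exact if_pos hy.le
    refine ((hasDerivAt_const ν (0 : ℝ)).congr_of_eventuallyEq h).congr_deriv ?_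
    rw [flat, flat, if_pos hν.le, if_pos hν.le]; ring
  · subst hν
    have h : HasDerivAt (flat a j) 0 0 := by
      refine hasDerivAt_zero_of_abs_le_sq (C := (j + 2).factorial / a ^ (j + 2)) fun x => ?_
      rcases le_or_gt x 0 with hx | hx
      · rw [flat, if_pos hx, abs_zero]; positivity
      · have h1 := abs_flat_le ha (j + 2) x
        have h2 : flat a j x = flat a (j + 2) x * x ^ 2 := by
          rw [flat_of_pos hx, flat_of_pos hx, pow_add]; field_simp
        rw [h2, abs_mul, abs_of_nonneg (sq_nonneg x)]
        exact mul_le_mul_of_nonneg_right h1 (sq_nonneg x)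
    refine h.congr_deriv ?_
    simp [flat]
  · have h : flat a j =ᶠ[𝓝 ν] fun y => Real.exp (-a / y) / y ^ j := by
      filter_upwards [lt_mem_nhds hν] with y hy
      exact flat_of_pos hy j
    have hne := hν.ne'
    have h1 : HasDerivAt (fun y => Real.exp (-a / y)) (Real.exp (-a / ν) * (a / ν ^ 2)) ν := by
      have := ((hasDerivAt_const ν (-a)).div (hasDerivAt_id ν) hne).exp
      refine this.congr_deriv ?_
      simp
    refine ((h1.div (hasDerivAt_pow j ν) (by positivity)).congr_of_eventuallyEq h).congr_deriv ?_
    rw [flat_of_pos hν, flat_of_pos hν]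
    cases j with
    | zero => simp; field_simp
    | succ j =>
      simp only [Nat.add_sub_cancel]
      push_cast
      field_simp
      ring

theorem exists_boundedDerivs_flat (ha : 0 < a) (n : ℕ) :
    ∀ j, ∃ B, 0 ≤ B ∧ BoundedDerivs n (flat a j) B := by
  induction n with
  | zero =>
    intro j
    refine ⟨j.factorial / a ^ j, by positivity, ?_, fun i hi x => ?_⟩
    · exact contDiff_zero.2 (continuous_iff_continuousAt.2 fun x => (hasDerivAt_flat ha j x).continuousAt)
    · rw [Nat.le_zero.1 hi, iteratedDeriv_zero]; exact abs_flat_le ha j x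
  | succ n ih =>
    intro j
    obtain ⟨B1, hB1, h1⟩ := ih (j + 2)
    obtain ⟨B2, hB2, h2⟩ := ih (j + 1)
    have h3 := (h1.const_mul a).add (h2.const_mul (-j))
    set B := |a| * B1 + |(-j : ℝ)| * B2 with hB
    have hB0 : 0 ≤ B := by positivity
    have hj : 0 ≤ (j.factorial : ℝ) / a ^ j := by positivity
    exact ⟨B + j.factorial / a ^ j, by positivity,
      BoundedDerivs.succ (fun x => (abs_flat_le ha j x).trans (by linarith)) (hasDerivAt_flat ha j)
        (h3.mono (by linarith))⟩

theorem truncMono_nonneg (ha : 0 ≤ a) (p : ℕ) (ν : ℝ) : 0 ≤ truncMono a p ν := by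
  rcases le_or_gt ν 0 with hν | hν
  · rw [truncMono, if_pos hν]
  · rw [truncMono_of_pos hν]
    exact mul_nonneg (by positivity) (incGamma_nonneg p (by positivity))

theorem truncMono_add_le (ha : 0 ≤ a) (m d : ℕ) {ν : ℝ} (hν : 0 < ν) :
    truncMono a (m + d) ν ≤ ν ^ m * (a ^ d * m.factorial / (m + d).factorial) := by
  rw [truncMono_of_pos hν]
  have := incGamma_add_le m d (x := a / ν) (by positivity)
  refine (mul_le_mul_of_nonneg_left this (by positivity)).trans (le_of_eq ?_)
  rw [pow_add, div_pow]
  field_simp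

theorem truncMono_le (ha : 0 ≤ a) (p : ℕ) (ν : ℝ) : truncMono a p ν ≤ a ^ p / p.factorial := by
  rcases le_or_gt ν 0 with hν | hν
  · rw [truncMono, if_pos hν]; positivity
  · have := truncMono_add_le ha 0 p hν
    simpa using this

theorem truncMono_succ {ν : ℝ} (hν : 0 < ν) (p : ℕ) : truncMono a (p + 1) ν =
    ν * truncMono a p ν - Real.exp (-a / ν) * (a ^ (p + 1) / (p + 1).factorial) := by
  rw [truncMono_of_pos hν, truncMono_of_pos hν, incGamma_succ, neg_div, div_pow, pow_succ]
  field_simp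

theorem abs_truncMono_mul_sub_le (ha : 0 ≤ a) {p : ℕ} (hp : 1 ≤ p) (q : ℕ) {ν : ℝ} (hν : 0 < ν) :
    |truncMono a p ν * truncMono a q ν - truncMono a (p + q) ν| ≤
      Real.exp (-a / ν) * (a ^ (p + q) / (p.factorial * q.factorial)) := by
  have h := abs_incGamma_mul_sub_le hp q (x := a / ν) (by positivity)
  have h1 : truncMono a p ν * truncMono a q ν - truncMono a (p + q) ν = ν ^ (p + q) *
      (incGamma p (a / ν) * incGamma q (a / ν) - incGamma (p + q) (a / ν)) := by
    rw [truncMono_of_pos hν, truncMono_of_pos hν, truncMono_of_pos hν, pow_add]; ring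
  rw [h1, abs_mul, abs_of_nonneg (by positivity)]
  refine (mul_le_mul_of_nonneg_left h (by positivity)).trans (le_of_eq ?_)
  rw [neg_div, div_pow]
  field_simp

theorem abs_truncMono_mul_mul_sub_le (ha : 0 ≤ a) {p q : ℕ} (hp : 1 ≤ p) (r : ℕ)
    {ν : ℝ} (hν : 0 < ν) :
    |truncMono a p ν * truncMono a q ν * truncMono a r ν - truncMono a (p + q + r) ν| ≤
      2 * Real.exp (-a / ν) *
        ((a ^ p / p.factorial) * (a ^ q / q.factorial) * (a ^ r / r.factorial)) := by
  have h1 := abs_truncMono_mul_sub_le ha hp q hν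
  have h2 := abs_truncMono_mul_sub_le ha (p := p + q) (by omega) r hν
  have h3 : truncMono a p ν * truncMono a q ν * truncMono a r ν - truncMono a (p + q + r) ν =
      (truncMono a p ν * truncMono a q ν - truncMono a (p + q) ν) * truncMono a r ν +
      (truncMono a (p + q) ν * truncMono a r ν - truncMono a (p + q + r) ν) := by ring
  rw [h3]
  refine (abs_add_le _ _).trans ?_
  rw [abs_mul, abs_of_nonneg (truncMono_nonneg ha r ν)]
  have h4 : |truncMono a p ν * truncMono a q ν - truncMono a (p + q) ν| * truncMono a r ν ≤
      Real.exp (-a / ν) * (a ^ (p + q) / (p.factorial * q.factorial)) * (a ^ r / r.factorial) :=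
    mul_le_mul h1 (truncMono_le ha r ν) (truncMono_nonneg ha r ν) (by positivity)
  have h5 : (p.factorial : ℝ) * q.factorial ≤ (p + q).factorial := by
    exact_mod_cast Nat.le_of_dvd (Nat.factorial_pos _) (Nat.factorial_mul_factorial_dvd_factorial_add p q)
  have h6 : a ^ (p + q + r) / ((p + q).factorial * r.factorial) ≤
      a ^ (p + q + r) / (p.factorial * q.factorial * r.factorial) := by
    gcongr
  have h7 := mul_le_mul_of_nonneg_left h6 (Real.exp_nonneg (-a / ν))
  refine (add_le_add h4 (h2.trans h7)).trans (le_of_eq ?_)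
  rw [pow_add, pow_add]
  field_simp
  ring

/-- Raising the index by one multiplies by `ν` up to a term in `e^(-a/ν)`; iterate `m` times. The
bound `ν₀` controls the factors `ν` that multiply the earlier errors. -/
theorem exists_abs_pow_mul_truncMono_sub_le (ha : 0 ≤ a) {ν₀ : ℝ} (hν₀ : 0 ≤ ν₀) (m : ℕ) :
    ∃ C, 0 ≤ C ∧ ∀ p : ℕ, ∀ ν : ℝ, 0 < ν → ν ≤ ν₀ →
      |truncMono a (p + m) ν - ν ^ m * truncMono a p ν| ≤
        C * Real.exp (-a / ν) * (a ^ p / p.factorial) := by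
  induction m with
  | zero => exact ⟨0, le_rfl, fun p ν _ _ => by simp⟩
  | succ m ih =>
    obtain ⟨C, hC, h⟩ := ih
    refine ⟨ν₀ * C + a ^ (m + 1), by positivity, fun p ν hν hνν => ?_⟩
    have h1 : truncMono a (p + (m + 1)) ν - ν ^ (m + 1) * truncMono a p ν =
        ν * (truncMono a (p + m) ν - ν ^ m * truncMono a p ν) -
          Real.exp (-a / ν) * (a ^ (p + m + 1) / (p + m + 1).factorial) := by
      rw [← add_assoc, truncMono_succ hν]; ring
    rw [h1]
    refine (abs_sub _ _).trans ?_
    rw [abs_mul, abs_of_pos hν, abs_of_nonneg (by positivity : (0 : ℝ) ≤ Real.exp (-a / ν) * _)]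
    have h2 := h p ν hν hνν
    have h3 : a ^ (p + m + 1) / (p + m + 1).factorial ≤ a ^ (m + 1) * (a ^ p / p.factorial) := by
      have : (p.factorial : ℝ) ≤ (p + m + 1).factorial := by
        exact_mod_cast Nat.factorial_le (by omega)
      calc _ ≤ a ^ (p + m + 1) / p.factorial := by gcongr
        _ = _ := by rw [add_assoc, pow_add]; ring
    calc _ ≤ ν₀ * (C * Real.exp (-a / ν) * (a ^ p / p.factorial)) +
          Real.exp (-a / ν) * (a ^ (m + 1) * (a ^ p / p.factorial)) := by gcongr
      _ = _ := by ring

/-- Differentiation lowers the index by one, up to flat terms. An index at least `2` makes the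
function `O(ν²)` on the right, so the extension by zero is differentiable at the origin. -/
theorem hasDerivAt_truncMono (ha : 0 < a) (p : ℕ) (ν : ℝ) :
    HasDerivAt (truncMono a (p + 2)) ((p + 2) * truncMono a (p + 1) ν +
      (-(a ^ (p + 2) / (p + 2).factorial)) * ((p + 2) * flat a 1 ν + a * flat a 2 ν)) ν := by
  rcases lt_trichotomy ν 0 with hν | hν | hν
  · have h : truncMono a (p + 2) =ᶠ[𝓝 ν] fun _ => 0 := by
      filter_upwards [gt_mem_nhds hν] with y hy
      exact if_pos hy.le
    refine ((hasDerivAt_const ν (0 : ℝ)).congr_of_eventuallyEq h).congr_deriv ?_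
    rw [flat, flat, truncMono, if_pos hν.le, if_pos hν.le, if_pos hν.le]; ring
  · subst hν
    have h : HasDerivAt (truncMono a (p + 2)) 0 0 := by
      refine hasDerivAt_zero_of_abs_le_sq
        (C := a ^ p * (2 : ℕ).factorial / (2 + p).factorial) fun x => ?_
      rcases le_or_gt x 0 with hx | hx
      · rw [truncMono, if_pos hx, abs_zero]; positivity
      · have h1 := truncMono_add_le ha.le 2 p hx
        rw [abs_of_nonneg (truncMono_nonneg ha.le _ _), add_comm p 2]
        linarith
    refine h.congr_deriv ?_
    simp [flat, truncMono]
  · have h : truncMono a (p + 2) =ᶠ[𝓝 ν] fun y => y ^ (p + 2) * incGamma (p + 2) (a / y) := by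
      filter_upwards [lt_mem_nhds hν] with y hy
      exact truncMono_of_pos hy _
    have hne := hν.ne'
    have h1 : HasDerivAt (fun y => a / y) (-(a / ν ^ 2)) ν := by
      refine ((hasDerivAt_const ν a).div (hasDerivAt_id ν) hne).congr_deriv ?_
      simp [neg_div]
    have h2 := (hasDerivAt_pow (p + 2) ν).mul ((hasDerivAt_incGamma (p + 2) (a / ν)).comp ν h1)
    refine (h2.congr_of_eventuallyEq h).congr_deriv ?_
    rw [flat_of_pos hν, flat_of_pos hν, truncMono_of_pos hν]
    have h3 := incGamma_succ (p + 1) (a / ν)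
    have h4 : p + 1 + 1 = p + 2 := rfl
    rw [h4] at h3
    simp only [Function.comp_apply]
    rw [h3, neg_div, show p + 2 - 1 = p + 1 by omega, div_pow]
    push_cast
    field_simp
    ring

/-- Each derivative brings a factor `p` and lowers the index; returning from `a^(p-1)/(p-1)!` to
`a^p/p!` costs another `p/a`. The loss is polynomial in `p` with `C` independent of `p`, hence
harmless in the Borel series. The condition `n + 2 ≤ p` keeps the index at least `2` at each
differentiation. -/
theorem exists_boundedDerivs_truncMono (ha : 0 < a) (n : ℕ) :
    ∃ C, 0 ≤ C ∧ ∀ p, n + 2 ≤ p →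
      BoundedDerivs n (truncMono a p) (C * ((p : ℝ) + 1) ^ (2 * n) * (a ^ p / p.factorial)) := by
  have habs : ∀ p ν, |truncMono a p ν| ≤ a ^ p / p.factorial := fun p ν => by
    rw [abs_of_nonneg (truncMono_nonneg ha.le p ν)]; exact truncMono_le ha.le p ν
  induction n with
  | zero =>
    refine ⟨1, zero_le_one, fun p hp => ?_⟩
    obtain ⟨p, rfl⟩ := Nat.exists_eq_add_of_le' hp
    refine ⟨contDiff_zero.2 (continuous_iff_continuousAt.2 fun x =>
      (hasDerivAt_truncMono ha p x).continuousAt), fun i hi x => ?_⟩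
    rw [Nat.le_zero.1 hi, iteratedDeriv_zero]
    simpa using habs (p + 2) x
  | succ n ih =>
    obtain ⟨C, hC, h⟩ := ih
    obtain ⟨B1, hB1, h1⟩ := exists_boundedDerivs_flat ha n 1
    obtain ⟨B2, hB2, h2⟩ := exists_boundedDerivs_flat ha n 2
    refine ⟨1 + C / a + B1 + a * B2, by positivity, fun p hp => ?_⟩
    obtain ⟨p, rfl⟩ := Nat.exists_eq_add_of_le' (show 2 ≤ p by omega)
    have h3 := (h (p + 1) (by omega)).const_mul ((p : ℝ) + 2)
    have h4 := ((h1.const_mul ((p : ℝ) + 2)).add (h2.const_mul a)).const_mul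
      (-(a ^ (p + 2) / ((p + 2).factorial : ℝ)))
    have h5 := h3.add h4
    set A := a ^ (p + 2) / ((p + 2).factorial : ℝ) with hA
    have hA0 : 0 ≤ A := by positivity
    set E := (((p + 2 : ℕ) : ℝ) + 1) ^ (2 * (n + 1)) with hE
    have hE1 : 1 ≤ E := one_le_pow₀ (by push_cast; linarith [p.cast_nonneg (α := ℝ)])
    have hE2 : (p : ℝ) + 2 ≤ E := by
      have h6 : ((p + 2 : ℕ) : ℝ) + 1 ≤ E := le_self_pow₀ (by push_cast; linarith [p.cast_nonneg (α := ℝ)]) (by omega)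
      push_cast at h6
      linarith
    refine BoundedDerivs.succ (f' := _) (fun x => (habs (p + 2) x).trans ?_)
      (hasDerivAt_truncMono ha p) (h5.mono ?_)
    · have : 1 ≤ (1 + C / a + B1 + a * B2) * E := by
        have h7 : 1 ≤ 1 + C / a + B1 + a * B2 := by
          have : 0 ≤ C / a + B1 + a * B2 := by positivity
          linarith
        nlinarith
      exact le_mul_of_one_le_left hA0 this
    · have e1 : |(p : ℝ) + 2| = p + 2 := abs_of_nonneg (by positivity)
      have e2 : |-A| = A := by rw [abs_neg, abs_of_nonneg hA0]
      have e3 : |a| = a := abs_of_pos ha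
      rw [e1, e2, e3]
      have e4 : ((p : ℝ) + 2) * (C * (((p + 1 : ℕ) : ℝ) + 1) ^ (2 * n) *
          (a ^ (p + 1) / (p + 1).factorial)) ≤ C / a * E * A := by
        have e5 : a ^ (p + 1) / ((p + 1).factorial : ℝ) = (p + 2) / a * A := by
          rw [hA, Nat.factorial_succ (p + 1), pow_succ a (p + 1)]
          push_cast
          field_simp
          ring
        have e6 : ((p : ℝ) + 2) * ((p : ℝ) + 2) * (((p + 1 : ℕ) : ℝ) + 1) ^ (2 * n) ≤ E := by
          have : ((p : ℝ) + 2) * ((p : ℝ) + 2) * (((p + 1 : ℕ) : ℝ) + 1) ^ (2 * n) =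
              ((p : ℝ) + 2) ^ (2 * (n + 1)) := by
            push_cast; ring
          rw [this, hE]
          push_cast
          exact pow_le_pow_left₀ (by positivity) (by linarith) _
        rw [e5]
        calc _ = C / a * (((p : ℝ) + 2) * ((p : ℝ) + 2) * (((p + 1 : ℕ) : ℝ) + 1) ^ (2 * n)) * A := by
              ring
          _ ≤ _ := by gcongr
      have e7 : A * (((p : ℝ) + 2) * B1 + a * B2) ≤ (B1 + a * B2) * E * A := by
        have : ((p : ℝ) + 2) * B1 + a * B2 ≤ (B1 + a * B2) * E := by
          have : 0 ≤ a * B2 := by positivity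
          nlinarith
        nlinarith
      have : 0 ≤ E * A := by positivity
      nlinarith

/-- On the half-line the truncated transform of a monomial agrees with a smooth function. -/
theorem exists_contDiff_truncMono (ha : 0 < a) {p : ℕ} (hp : p ≠ 0) :
    ∃ g : ℝ → ℝ, (∀ n : ℕ, ContDiff ℝ n g) ∧ ∀ ν, 0 ≤ ν → truncMono a p ν = g ν := by
  -- For small `p` the extension by zero has too few derivatives at the origin. This one keeps `ν ^
  -- p` for negative `ν` and drops only the flat part.
  refine ⟨fun ν => ν ^ p - flat a 0 ν * ∑ k ∈ Finset.range (p + 1),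
    a ^ k / k.factorial * ν ^ (p - k), fun n => ?_, fun ν hν => ?_⟩
  · obtain ⟨B, -, h⟩ := exists_boundedDerivs_flat ha n 0
    have := h.1
    refine (contDiff_id.pow p).sub (this.mul (ContDiff.sum fun k _ => contDiff_const.mul (contDiff_id.pow _)))
  · dsimp only
    rcases hν.eq_or_lt with rfl | hν
    · simp [truncMono, flat, hp]
    · rw [truncMono_of_pos hν, flat_of_pos hν, incGamma, mul_sub, mul_one, pow_zero, div_one, neg_div]
      rw [mul_left_comm, Finset.mul_sum]
      congr 2
      refine Finset.sum_congr rfl fun k hk => ?_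
      have hk' : k ≤ p := by rw [Finset.mem_range] at hk; omega
      rw [div_pow, ← Nat.sub_add_cancel hk', pow_add, Nat.add_sub_cancel]
      field_simp

/-- The difference is `-e^(-a/ν)` times a polynomial in `ν`, smaller than any power. -/
theorem truncMono_sub_pow_isBigO (ha : 0 < a) (p m : ℕ) :
    (fun ν => truncMono a p ν - ν ^ p) =O[𝓝[>] 0] fun ν : ℝ => ν ^ m := by
  have hle : ∀ ν, 0 < ν → ν ≤ 1 → |truncMono a p ν - ν ^ p| ≤
      (∑ k ∈ Finset.range (p + 1), a ^ k / k.factorial) * (m.factorial / a ^ m) * ν ^ m := by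
    intro ν hν hν1
    have h1 : truncMono a p ν - ν ^ p = -(flat a m ν * ν ^ m * ∑ k ∈ Finset.range (p + 1),
        a ^ k / k.factorial * ν ^ (p - k)) := by
      rw [truncMono_of_pos hν, flat_of_pos hν, incGamma, mul_sub, mul_one, neg_div,
        mul_left_comm, Finset.mul_sum]
      have : ∑ k ∈ Finset.range (p + 1), ν ^ p * ((a / ν) ^ k / k.factorial) =
          ∑ k ∈ Finset.range (p + 1), a ^ k / k.factorial * ν ^ (p - k) := by
        refine Finset.sum_congr rfl fun k hk => ?_
        have hk' : k ≤ p := by rw [Finset.mem_range] at hk; omega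
        rw [div_pow, ← Nat.sub_add_cancel hk', pow_add, Nat.add_sub_cancel]
        field_simp
      rw [this]
      field_simp
      ring
    have h2 : ∑ k ∈ Finset.range (p + 1), a ^ k / k.factorial * ν ^ (p - k) ≤
        ∑ k ∈ Finset.range (p + 1), a ^ k / k.factorial := by
      refine Finset.sum_le_sum fun k _ => ?_
      exact mul_le_of_le_one_right (by positivity) (pow_le_one₀ hν.le hν1)
    have h3 : 0 ≤ ∑ k ∈ Finset.range (p + 1), a ^ k / k.factorial * ν ^ (p - k) :=
      Finset.sum_nonneg fun k _ => by positivity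
    rw [h1, abs_neg, abs_mul, abs_mul, abs_of_nonneg h3, abs_of_nonneg (by positivity : 0 ≤ ν ^ m)]
    have h4 := abs_flat_le ha m ν
    calc _ ≤ (m.factorial / a ^ m * ν ^ m) * ∑ k ∈ Finset.range (p + 1), a ^ k / k.factorial := by
          gcongr
      _ = _ := by ring
  refine Asymptotics.IsBigO.of_bound
    ((∑ k ∈ Finset.range (p + 1), a ^ k / k.factorial) * (m.factorial / a ^ m)) ?_
  filter_upwards [self_mem_nhdsWithin, nhdsWithin_le_nhds (Iic_mem_nhds zero_lt_one)] with ν hν hν1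
  have hν' : 0 < ν := hν
  rw [Real.norm_eq_abs, Real.norm_of_nonneg (by positivity : 0 ≤ ν ^ m)]
  exact hle ν hν' hν1

end BoundedDerivatives
end SwiftHohenberg
end

noncomputable section
namespace SwiftHohenberg

open SwiftHohenberg.HSpace

/-! ### The Borel transform and its truncated Laplace transform. -/

section Borel

variable {Q : ℕ} {s : ℝ} {V : ℕ → HSpace Q s} {γ K : ℝ}

/-- The exponent of `ζ` in the term of index `n` of the Borel transform. -/
def borelExp (Q n : ℕ) : ℕ := 4 * ell Q * n + 2 * ell Q

theorem borelExp_succ (n : ℕ) : borelExp Q (n + 1) = borelExp Q n + 4 * ell Q := by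
  unfold borelExp; ring

/-- The offset `2l` is chosen for this: three of them make `4l + 2l`, so a cubic product shifts the
index by one, as the recursion does. -/
theorem borelExp_add (i j k : ℕ) :
    borelExp Q i + borelExp Q j + borelExp Q k = borelExp Q (i + (j + k) + 1) := by
  unfold borelExp; ring

theorem le_borelExp (hl : 1 ≤ ell Q) (n : ℕ) : 4 * n + 2 ≤ borelExp Q n := by
  unfold borelExp
  nlinarith

theorem factorial_pow_le (n m : ℕ) : n.factorial ^ m ≤ (m * n).factorial := by
  have := Nat.le_of_dvd (Nat.factorial_pos _)
    (Nat.prod_factorial_dvd_factorial_sum (Finset.range m) fun _ => n)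
  simpa using this

theorem pow_mul_lt_one_of_lt {r : ℝ} (hl : 1 ≤ ell Q) (hK : 0 < K) (hr0 : 0 ≤ r)
    (hr : r < K ^ (-(1 / (4 * (ell Q : ℝ))))) : r ^ (4 * ell Q) * K < 1 := by
  have h1 : r ^ (4 * ell Q) < (K ^ (-(1 / (4 * (ell Q : ℝ))))) ^ (4 * ell Q) :=
    pow_lt_pow_left₀ hr hr0 (by omega)
  have hl' : (ell Q : ℝ) ≠ 0 := by positivity
  have h2 : (K ^ (-(1 / (4 * (ell Q : ℝ))))) ^ (4 * ell Q) = K⁻¹ := by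
    rw [← Real.rpow_natCast, ← Real.rpow_mul hK.le]
    push_cast
    rw [show -(1 / (4 * (ell Q : ℝ))) * (4 * (ell Q : ℝ)) = -1 by field_simp, Real.rpow_neg_one]
  rw [h2] at h1
  calc _ < K⁻¹ * K := mul_lt_mul_of_pos_right h1 hK
    _ = 1 := inv_mul_cancel₀ hK.ne'

theorem one_div_lt_radius {K' : ℝ} (hK : 0 < K) (hK' : K ^ (1 / (4 * (ell Q : ℝ))) < K') :
    0 < 1 / K' ∧ 1 / K' < K ^ (-(1 / (4 * (ell Q : ℝ)))) := by
  have h0 : 0 < K ^ (1 / (4 * (ell Q : ℝ))) := Real.rpow_pos_of_pos hK _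
  refine ⟨one_div_pos.2 (h0.trans hK'), ?_⟩
  rw [Real.rpow_neg hK.le, one_div]
  exact inv_strictAnti₀ h0 hK'

/-- Since `n!^(4l) ≤ (4ln)!`, the denominator cancels the Gevrey growth and leaves a geometric
series of ratio `r^(4l) K`. The polynomial factor serves the derivatives in `ν` and the weights
`N_k^m`. -/
theorem summable_borel (hl : 1 ≤ ell Q) (hV : GevreyBound V γ K) (hγ : 0 < γ) (hK : 0 < K) {r : ℝ}
    (hr0 : 0 ≤ r) (hr : r ^ (4 * ell Q) * K < 1) (d : ℕ) :
    Summable fun n => ((borelExp Q n : ℝ) + 1) ^ d *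
      (r ^ borelExp Q n / (borelExp Q n).factorial) * ‖V n‖ := by
  set x := r ^ (4 * ell Q) * K with hx
  have hx0 : 0 ≤ x := by positivity
  have hgeo : Summable fun n : ℕ => (2 ^ d * (n : ℝ) ^ d + 1) * x ^ n := by
    have h1 := (summable_pow_mul_geometric_of_norm_lt_one (R := ℝ) d (r := x)
      (by rwa [Real.norm_of_nonneg hx0])).mul_left (2 ^ d)
    have h2 := summable_geometric_of_lt_one hx0 hr
    refine (h1.add h2).congr fun n => ?_
    ring
  refine Summable.of_nonneg_of_le (fun n => by positivity) (fun n => ?_)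
    (hgeo.mul_left (γ * r ^ (2 * ell Q) * (4 * ell Q + 1) ^ d))
  have hfac : ((n.factorial : ℝ) ^ (4 * ell Q)) ≤ (borelExp Q n).factorial := by
    have h1 := (factorial_pow_le n (4 * ell Q)).trans
      (Nat.factorial_le (show 4 * ell Q * n ≤ borelExp Q n by unfold borelExp; omega))
    exact_mod_cast h1
  have h1 : ‖V n‖ ≤ γ * K ^ n * (borelExp Q n).factorial :=
    (hV n).trans (mul_le_mul_of_nonneg_left hfac (by positivity))
  have h2 : ((borelExp Q n : ℝ) + 1) ^ d ≤ (4 * ell Q + 1) ^ d * (2 ^ d * (n : ℝ) ^ d + 1) := by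
    have h3 : (borelExp Q n : ℝ) + 1 ≤ (4 * ell Q + 1) * ((n : ℝ) + 1) := by
      unfold borelExp
      push_cast
      nlinarith [n.cast_nonneg (α := ℝ), (ell Q).cast_nonneg (α := ℝ)]
    have h4 : ((n : ℝ) + 1) ^ d ≤ 2 ^ d * (n : ℝ) ^ d + 1 := by
      rcases Nat.eq_zero_or_pos n with rfl | hn
      · have : (0 : ℝ) ≤ 2 ^ d * ((0 : ℕ) : ℝ) ^ d := by positivity
        simp only [Nat.cast_zero, zero_add, one_pow] at this ⊢
        linarith
      · have hn1 : (1 : ℝ) ≤ n := by exact_mod_cast hn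
        rw [← mul_pow]
        have := pow_le_pow_left₀ (by positivity) (show (n : ℝ) + 1 ≤ 2 * n by linarith) d
        linarith
    calc _ ≤ ((4 * ell Q + 1) * ((n : ℝ) + 1)) ^ d := pow_le_pow_left₀ (by positivity) h3 d
      _ = (4 * ell Q + 1) ^ d * ((n : ℝ) + 1) ^ d := mul_pow _ _ _
      _ ≤ _ := mul_le_mul_of_nonneg_left h4 (by positivity)
  have h5 : ((borelExp Q n).factorial : ℝ) ≠ 0 := by positivity
  calc _ ≤ ((4 * ell Q + 1) ^ d * (2 ^ d * (n : ℝ) ^ d + 1)) *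
        (r ^ borelExp Q n / (borelExp Q n).factorial) * (γ * K ^ n * (borelExp Q n).factorial) := by
        gcongr
    _ = ((4 * ell Q + 1) ^ d * (2 ^ d * (n : ℝ) ^ d + 1)) * r ^ borelExp Q n * (γ * K ^ n) := by
        field_simp
    _ = _ := by
        rw [hx, mul_pow, ← pow_mul, borelExp, pow_add]; ring

theorem norm_borelTerm (ζ : ℂ) (n : ℕ) : ‖borelTerm V ζ n‖ = (Real.sqrt (beta Q))⁻¹ *
    (‖ζ‖ ^ borelExp Q n / (borelExp Q n).factorial * ‖V n‖) := by
  rw [borelTerm, norm_smul, norm_div, norm_mul, norm_pow, Complex.norm_real, Complex.norm_natCast,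
    Real.norm_of_nonneg (by positivity)]
  unfold borelExp
  ring

theorem summable_norm_borelTerm (hl : 1 ≤ ell Q) (hV : GevreyBound V γ K) (hγ : 0 < γ) (hK : 0 < K)
    {r : ℝ} (hr0 : 0 ≤ r) (hr : r < K ^ (-(1 / (4 * (ell Q : ℝ))))) :
    Summable fun n => (Real.sqrt (beta Q))⁻¹ *
      (r ^ borelExp Q n / (borelExp Q n).factorial * ‖V n‖) := by
  have := summable_borel hl hV hγ hK hr0 (pow_mul_lt_one_of_lt hl hK hr0 hr) 0
  simp only [pow_zero, one_mul] at this
  exact this.mul_left _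

theorem summable_borelTerm (hl : 1 ≤ ell Q) (hV : GevreyBound V γ K) (hγ : 0 < γ) (hK : 0 < K)
    {ζ : ℂ} (hζ : ζ ∈ Metric.ball (0 : ℂ) (K ^ (-(1 / (4 * (ell Q : ℝ)))))) :
    Summable (borelTerm V ζ) := by
  rw [mem_ball_zero_iff] at hζ
  refine Summable.of_norm ?_
  simp only [norm_borelTerm]
  exact summable_norm_borelTerm hl hV hγ hK (norm_nonneg ζ) hζ

theorem analyticOnNhd_borelTransform (hl : 1 ≤ ell Q) (hV : GevreyBound V γ K) (hγ : 0 < γ)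
    (hK : 0 < K) : AnalyticOnNhd ℂ (borelTransform V)
      (Metric.ball (0 : ℂ) (K ^ (-(1 / (4 * (ell Q : ℝ)))))) := by
  refine DifferentiableOn.analyticOnNhd (fun ζ hζ => ?_) Metric.isOpen_ball
  rw [mem_ball_zero_iff] at hζ
  obtain ⟨r, hr1, hr2⟩ := exists_between hζ
  have hr0 : 0 ≤ r := (norm_nonneg ζ).trans hr1.le
  have hd : DifferentiableOn ℂ (fun w => ∑' n, borelTerm V w n) (Metric.ball 0 r) := by
    refine Complex.differentiableOn_tsum_of_summable_norm
      (summable_norm_borelTerm hl hV hγ hK hr0 hr2) (fun n => ?_) Metric.isOpen_ball fun n w hw => ?_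
    · unfold borelTerm
      refine Differentiable.differentiableOn ?_
      fun_prop
    · rw [mem_ball_zero_iff] at hw
      rw [norm_borelTerm]
      gcongr
  exact (hd.differentiableAt (Metric.isOpen_ball.mem_nhds
    (mem_ball_zero_iff.2 hr1))).differentiableWithinAt

theorem ofReal_mem_ball {K' ζ : ℝ} (hK : 0 < K) (hK' : K ^ (1 / (4 * (ell Q : ℝ))) < K')
    (hζ : ζ ∈ Set.Icc 0 (1 / K')) :
    (ζ : ℂ) ∈ Metric.ball (0 : ℂ) (K ^ (-(1 / (4 * (ell Q : ℝ))))) := by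
  rw [mem_ball_zero_iff, Complex.norm_real, Real.norm_of_nonneg hζ.1]
  exact hζ.2.trans_lt (one_div_lt_radius hK hK').2

theorem intervalIntegrable_borelTransform (hl : 1 ≤ ell Q) (hV : GevreyBound V γ K) (hγ : 0 < γ)
    (hK : 0 < K) {K' : ℝ} (hK' : K ^ (1 / (4 * (ell Q : ℝ))) < K') (ν : ℝ) :
    IntervalIntegrable (fun ζ : ℝ => Real.exp (-ζ / ν) • borelTransform V (ζ : ℂ))
      MeasureTheory.volume 0 (1 / K') := by
  refine ContinuousOn.intervalIntegrable ?_
  rw [Set.uIcc_of_le (one_div_lt_radius hK hK').1.le]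
  refine ContinuousOn.smul (M := ℝ) (X := HSpace Q s)
    (by fun_prop : Continuous fun ζ : ℝ => Real.exp (-ζ / ν)).continuousOn ?_
  exact (analyticOnNhd_borelTransform hl hV hγ hK).continuousOn.comp
    Complex.continuous_ofReal.continuousOn fun ζ hζ => ofReal_mem_ball hK hK' hζ

/-- The coefficients of the solution in powers of `ν = μ^{1/4l}`. -/
def scaled (V : ℕ → HSpace Q s) (n : ℕ) : HSpace Q s := (Real.sqrt (beta Q))⁻¹ • V n

theorem borelTerm_ofReal (ζ : ℝ) (n : ℕ) : borelTerm V (ζ : ℂ) n =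
    (ζ ^ borelExp Q n / (borelExp Q n).factorial) • scaled V n := by
  rw [scaled, smul_smul, ← Complex.coe_smul, borelTerm]
  congr 1
  unfold borelExp
  push_cast
  ring

/-- Termwise integration, dominated by the values of the terms at the endpoint `1/K'`, which lies
inside the disc of convergence. -/
theorem hasSum_truncLaplace (hl : 1 ≤ ell Q) (hV : GevreyBound V γ K) (hγ : 0 < γ)
    (hK : 0 < K) {K' : ℝ} (hK' : K ^ (1 / (4 * (ell Q : ℝ))) < K') {ν : ℝ} (hν : 0 ≤ ν) :
    HasSum (fun n => truncMono (1 / K') (borelExp Q n) ν • scaled V n) (truncLaplace V K' ν) := by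
  rcases hν.eq_or_lt with rfl | hν
  -- At `ν = 0` both sides vanish by convention: `0⁻¹ = 0`, and `truncMono` is zero there.
  · have : truncLaplace V K' 0 = 0 := by rw [truncLaplace, inv_zero, zero_smul]
    rw [this]
    simp only [truncMono, le_refl, if_true, zero_smul]
    exact hasSum_zero
  obtain ⟨ha, har⟩ := one_div_lt_radius hK hK'
  set a := 1 / K' with hadef
  have h := intervalIntegral.hasSum_integral_of_dominated_convergence
    (μ := MeasureTheory.volume) (a := 0) (b := a)
    (F := fun n (ζ : ℝ) => Real.exp (-ζ / ν) • borelTerm V (ζ : ℂ) n)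
    (f := fun ζ : ℝ => Real.exp (-ζ / ν) • borelTransform V (ζ : ℂ))
    (fun n _ => (Real.sqrt (beta Q))⁻¹ * (a ^ borelExp Q n / (borelExp Q n).factorial * ‖V n‖))
    (fun n => by
      refine Continuous.aestronglyMeasurable ?_
      simp only [borelTerm_ofReal]
      exact Continuous.smul (M := ℝ) (X := HSpace Q s)
        (by fun_prop : Continuous fun ζ : ℝ => Real.exp (-ζ / ν))
        (Continuous.smul (M := ℝ) (X := HSpace Q s)
          ((continuous_pow (borelExp Q n)).div_const _) continuous_const))
    (fun n => Eventually.of_forall fun ζ hζ => by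
      rw [Set.uIoc_of_le ha.le] at hζ
      rw [norm_smul, Real.norm_of_nonneg (Real.exp_nonneg _), norm_borelTerm, Complex.norm_real,
        Real.norm_of_nonneg hζ.1.le]
      have h1 : Real.exp (-ζ / ν) ≤ 1 := by
        rw [Real.exp_le_one_iff]
        exact div_nonpos_of_nonpos_of_nonneg (by linarith [hζ.1]) hν.le
      have h2 : ζ ^ borelExp Q n ≤ a ^ borelExp Q n := pow_le_pow_left₀ hζ.1.le hζ.2 _
      refine (mul_le_of_le_one_left (by have := hζ.1; positivity) h1).trans ?_
      gcongr)
    (Eventually.of_forall fun ζ _ => summable_norm_borelTerm hl hV hγ hK ha.le har)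
    (by simp)
    (Eventually.of_forall fun ζ hζ => by
      rw [Set.uIoc_of_le ha.le] at hζ
      exact (summable_borelTerm hl hV hγ hK (ofReal_mem_ball hK hK' ⟨hζ.1.le, hζ.2⟩)).hasSum.const_smul _)
  have h2 := h.const_smul ν⁻¹
  refine h2.congr_fun fun n => ?_
  have h3 : (fun ζ : ℝ => Real.exp (-ζ / ν) • borelTerm V (ζ : ℂ) n) = fun ζ : ℝ =>
      (Real.exp (-ζ / ν) * (ζ ^ borelExp Q n / (borelExp Q n).factorial)) • scaled V n := by
    funext ζ
    rw [borelTerm_ofReal, smul_smul]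
  rw [h3, intervalIntegral.integral_smul_const, integral_exp_mul_pow _ hν, smul_smul,
    truncMono_of_pos hν]
  congr 1
  rw [pow_succ]
  field_simp

theorem norm_scaled (n : ℕ) : ‖scaled V n‖ = (Real.sqrt (beta Q))⁻¹ * ‖V n‖ := by
  rw [scaled, norm_smul, Real.norm_of_nonneg (by positivity)]

theorem summable_scaled (hl : 1 ≤ ell Q) (hV : GevreyBound V γ K) (hγ : 0 < γ) (hK : 0 < K)
    {K' : ℝ} (hK' : K ^ (1 / (4 * (ell Q : ℝ))) < K') (d : ℕ) :
    Summable fun n => ((borelExp Q n : ℝ) + 1) ^ d *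
      ((1 / K') ^ borelExp Q n / (borelExp Q n).factorial) * ‖scaled V n‖ := by
  obtain ⟨ha, har⟩ := one_div_lt_radius hK hK'
  have := (summable_borel hl hV hγ hK ha.le (pow_mul_lt_one_of_lt hl hK ha.le har) d).mul_left
    (Real.sqrt (beta Q))⁻¹
  refine this.congr fun n => ?_
  rw [norm_scaled]
  ring

end Borel
end SwiftHohenberg
end

noncomputable section
namespace SwiftHohenberg

open SwiftHohenberg.HSpace

/-! ### Smoothness up to `ν = 0` and the asymptotic expansion. -/

section Asymptotics

variable {Q : ℕ} {s : ℝ} {V : ℕ → HSpace Q s} {γ K : ℝ}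

/-- For derivatives up to order `m`, the terms of index at least `m` have exponent at least `4m + 2
≥ m + 2`, so their derivatives are bounded by a convergent series. The finitely many others agree on
`[0, ∞)` with smooth functions. -/
theorem contDiffOn_truncLaplace (hl : 1 ≤ ell Q) (hV : GevreyBound V γ K) (hγ : 0 < γ)
    (hK : 0 < K) {K' : ℝ} (hK' : K ^ (1 / (4 * (ell Q : ℝ))) < K') :
    ContDiffOn ℝ (⊤ : ℕ∞) (truncLaplace V K') (Set.Ici 0) := by
  have ha := (one_div_lt_radius hK hK').1
  refine contDiffOn_infty.2 fun m => ?_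
  have hne : ∀ n, borelExp Q n ≠ 0 := fun n => by have := le_borelExp hl n; omega
  choose g hg hTg using fun n => exists_contDiff_truncMono ha (hne n)
  obtain ⟨C, hC, hB⟩ := exists_boundedDerivs_truncMono ha m
  have hB' : ∀ n, BoundedDerivs m (truncMono (1 / K') (borelExp Q (n + m))) _ := fun n =>
    hB (borelExp Q (n + m)) (by have := le_borelExp hl (n + m); omega)
  have hsm : ∀ n, ContDiff ℝ m fun ν =>
      truncMono (1 / K') (borelExp Q (n + m)) ν • scaled V (n + m) :=
    fun n => (hB' n).1.smul contDiff_const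
  have htail : ContDiff ℝ m fun ν => ∑' n,
      truncMono (1 / K') (borelExp Q (n + m)) ν • scaled V (n + m) := by
    refine contDiff_tsum (N := m) (v := fun _ n => C * ((borelExp Q (n + m) : ℝ) + 1) ^ (2 * m) *
      ((1 / K') ^ borelExp Q (n + m) / (borelExp Q (n + m)).factorial) * ‖scaled V (n + m)‖)
      hsm (fun _ _ => ?_) fun i n ν hi => ?_
    · have h1 := (((summable_nat_add_iff m).2
        (summable_scaled hl hV hγ hK hK' (2 * m))).mul_left C)
      refine h1.congr fun n => ?_
      ring
    · have hi' : i ≤ m := by exact_mod_cast hi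
      rw [norm_iteratedFDeriv_eq_norm_iteratedDeriv, iteratedDeriv_smul_const
        ((hB' n).1.of_le (by exact_mod_cast hi')).contDiffAt, norm_smul]
      exact mul_le_mul_of_nonneg_right ((hB' n).2 i hi' ν) (norm_nonneg _)
  have hhead : ContDiff ℝ m fun ν => ∑ n ∈ Finset.range m, g n ν • scaled V n :=
    ContDiff.sum fun n _ => (hg n m).smul contDiff_const
  refine (hhead.add htail).contDiffOn.congr fun ν hν => ?_
  have hsum := hasSum_truncLaplace hl hV hγ hK hK' hν
  rw [← hsum.tsum_eq, ← hsum.summable.sum_add_tsum_nat_add m]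
  congr 1
  exact Finset.sum_congr rfl fun n _ => by rw [hTg n ν hν]

/-- The first `N` terms differ from powers of `ν` by flat functions; in the others
`truncMono_add_le` extracts the common factor `ν^p(N)` and leaves a convergent series. -/
theorem truncLaplace_sub_isBigO (hl : 1 ≤ ell Q) (hV : GevreyBound V γ K) (hγ : 0 < γ)
    (hK : 0 < K) {K' : ℝ} (hK' : K ^ (1 / (4 * (ell Q : ℝ))) < K') (N : ℕ) :
    (fun ν => truncLaplace V K' ν - ∑ n ∈ Finset.range N, ν ^ borelExp Q n • scaled V n)
      =O[𝓝[>] 0] fun ν : ℝ => ν ^ borelExp Q N := by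
  have ha := (one_div_lt_radius hK hK').1
  set a := 1 / K' with hadef
  have hhead : (fun ν => ∑ n ∈ Finset.range N,
      (truncMono a (borelExp Q n) ν - ν ^ borelExp Q n) • scaled V n)
      =O[𝓝[>] 0] fun ν : ℝ => ν ^ borelExp Q N := by
    refine Asymptotics.IsBigO.fun_sum fun n _ => ?_
    have h : (fun ν => (truncMono a (borelExp Q n) ν - ν ^ borelExp Q n) • scaled V n)
        =O[𝓝[>] 0] fun ν : ℝ => truncMono a (borelExp Q n) ν - ν ^ borelExp Q n :=
      Asymptotics.IsBigO.of_bound ‖scaled V n‖ (Eventually.of_forall fun ν => by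
        rw [norm_smul, mul_comm])
    exact h.trans (truncMono_sub_pow_isBigO ha (borelExp Q n) (borelExp Q N))
  set M := borelExp Q N with hM
  set v : ℕ → ℝ := fun n => a ^ borelExp Q n / (borelExp Q n).factorial * ‖scaled V n‖ with hv
  have hvs : Summable fun n => v (n + N) := by
    have := (summable_nat_add_iff N).2 (summable_scaled hl hV hγ hK hK' 0)
    simpa only [pow_zero, one_mul] using this
  have htail : (fun ν => ∑' n, truncMono a (borelExp Q (n + N)) ν • scaled V (n + N))
      =O[𝓝[>] 0] fun ν : ℝ => ν ^ M := by
    -- The factor `M!/a^M` turns the bound `a^d M!/(M+d)!` into the summable `a^(M+d)/(M+d)!`.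
    refine Asymptotics.IsBigO.of_bound (M.factorial / a ^ M * ∑' n, v (n + N)) ?_
    filter_upwards [self_mem_nhdsWithin] with ν (hν : 0 < ν)
    have hterm : ∀ n, ‖truncMono a (borelExp Q (n + N)) ν • scaled V (n + N)‖ ≤
        (M.factorial / a ^ M * ν ^ M) * v (n + N) := by
      intro n
      have he : borelExp Q (n + N) = M + 4 * ell Q * n := by
        rw [hM]
        unfold borelExp
        ring
      rw [norm_smul, Real.norm_of_nonneg (truncMono_nonneg ha.le _ _)]
      refine (mul_le_mul_of_nonneg_right (he ▸ truncMono_add_le ha.le M (4 * ell Q * n) hν)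
        (norm_nonneg _)).trans (le_of_eq ?_)
      simp only [hv]
      rw [he, pow_add]
      field_simp
    refine (tsum_of_norm_bounded (hvs.mul_left _).hasSum hterm).trans (le_of_eq ?_)
    rw [tsum_mul_left, Real.norm_of_nonneg (by positivity)]
    ring
  refine (hhead.add htail).congr' ?_ EventuallyEq.rfl
  · filter_upwards [self_mem_nhdsWithin] with ν (hν : 0 < ν)
    have hsum := hasSum_truncLaplace hl hV hγ hK hK' hν.le
    rw [← hsum.tsum_eq, ← hsum.summable.sum_add_tsum_nat_add N]
    simp only [sub_smul, Finset.sum_sub_distrib]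
    abel

theorem rpow_inv_pow {μ : ℝ} (hμ : 0 ≤ μ) (hl : 1 ≤ ell Q) :
    (μ ^ (1 / (4 * (ell Q : ℝ)))) ^ (4 * ell Q) = μ := by
  have hl' : (ell Q : ℝ) ≠ 0 := by positivity
  rw [← Real.rpow_natCast, ← Real.rpow_mul hμ]
  push_cast
  rw [one_div_mul_cancel (by positivity), Real.rpow_one]

theorem rpow_inv_pow_borelExp {μ : ℝ} (hμ : 0 ≤ μ) (hl : 1 ≤ ell Q) (n : ℕ) :
    (μ ^ (1 / (4 * (ell Q : ℝ)))) ^ borelExp Q n = Real.sqrt μ * μ ^ n := by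
  have h := rpow_inv_pow hμ hl
  have h2 : (μ ^ (1 / (4 * (ell Q : ℝ)))) ^ (2 * ell Q) = Real.sqrt μ := by
    rw [eq_comm, Real.sqrt_eq_iff_mul_self_eq hμ (by positivity), ← pow_add,
      show 2 * ell Q + 2 * ell Q = 4 * ell Q by ring, h]
  rw [borelExp, pow_add, pow_mul, h, h2, mul_comm]

theorem tendsto_rpow_inv (hl : 1 ≤ ell Q) :
    Tendsto (fun μ : ℝ => μ ^ (1 / (4 * (ell Q : ℝ)))) (𝓝[>] 0) (𝓝[>] 0) := by
  have hl' : 0 < 1 / (4 * (ell Q : ℝ)) := by positivity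
  refine tendsto_nhdsWithin_iff.2 ⟨?_, ?_⟩
  · have h := (Real.continuousAt_rpow_const 0 (1 / (4 * (ell Q : ℝ))) (Or.inr hl'.le)).tendsto
    rw [Real.zero_rpow hl'.ne'] at h
    exact h.mono_left nhdsWithin_le_nhds
  · filter_upwards [self_mem_nhdsWithin] with μ (hμ : 0 < μ)
    exact Real.rpow_pos_of_pos hμ _

theorem truncLaplace_rpow_sub_isBigO (hl : 1 ≤ ell Q) (hV : GevreyBound V γ K)
    (hγ : 0 < γ) (hK : 0 < K) {K' : ℝ} (hK' : K ^ (1 / (4 * (ell Q : ℝ))) < K') (N : ℕ) :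
    (fun μ : ℝ => truncLaplace V K' (μ ^ (1 / (4 * (ell Q : ℝ)))) -
      Real.sqrt (μ / beta Q) • ∑ n ∈ Finset.range N, μ ^ n • V n)
      =O[𝓝[>] 0] fun μ : ℝ => Real.sqrt μ * μ ^ N := by
  refine ((truncLaplace_sub_isBigO hl hV hγ hK hK' N).comp_tendsto (tendsto_rpow_inv hl)).congr'
    ?_ ?_
  · filter_upwards [self_mem_nhdsWithin] with μ (hμ : 0 < μ)
    simp only [Function.comp_def]
    rw [Finset.smul_sum]
    congr 1
    refine Finset.sum_congr rfl fun n _ => ?_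
    rw [rpow_inv_pow_borelExp hμ.le hl, scaled, smul_smul, smul_smul, Real.sqrt_div hμ.le]
    congr 1
    ring
  · filter_upwards [self_mem_nhdsWithin] with μ (hμ : 0 < μ)
    simp only [Function.comp_def]
    rw [rpow_inv_pow_borelExp hμ.le hl]

end Asymptotics
end SwiftHohenberg
end

noncomputable section
namespace SwiftHohenberg

open SwiftHohenberg.HSpace

/-! ### Smooth real quasiperiodic functions from Fourier series. -/

section PlaneWaves

variable {Q : ℕ}

/-- The plane wave of wavevector `k` and amplitude `c`. -/
def planeWave (c : ℂ) (k x : ℂ) : ℂ := c * Complex.exp (Complex.I * ((inner ℝ k x : ℝ) : ℂ))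

theorem contDiff_mul_exp_I (c : ℂ) {n : WithTop ℕ∞} :
    ContDiff ℝ n fun t : ℝ => c * Complex.exp (Complex.I * (t : ℂ)) :=
  contDiff_const.mul ((contDiff_const.mul Complex.ofRealCLM.contDiff).cexp)

theorem iteratedDeriv_mul_exp_I (c : ℂ) (m : ℕ) :
    iteratedDeriv m (fun t : ℝ => c * Complex.exp (Complex.I * (t : ℂ))) =
      fun t : ℝ => c * Complex.I ^ m * Complex.exp (Complex.I * (t : ℂ)) := by
  induction m with
  | zero => simp
  | succ m ih =>
    rw [iteratedDeriv_succ, ih]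
    funext t
    have h1 : HasDerivAt (fun t : ℝ => Complex.exp (Complex.I * (t : ℂ)))
        (Complex.exp (Complex.I * (t : ℂ)) * (Complex.I * 1)) t :=
      ((Complex.ofRealCLM.hasDerivAt (x := t)).const_mul Complex.I).cexp
    rw [(h1.const_mul _).deriv]
    ring

theorem contDiff_planeWave (c k : ℂ) {n : WithTop ℕ∞} : ContDiff ℝ n (planeWave c k) :=
  (contDiff_mul_exp_I c).comp (innerSL ℝ k).contDiff

theorem norm_iteratedFDeriv_planeWave_le (c k x : ℂ) (m : ℕ) :
    ‖iteratedFDeriv ℝ m (planeWave c k) x‖ ≤ ‖c‖ * ‖k‖ ^ m := by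
  have h : planeWave c k = (fun t : ℝ => c * Complex.exp (Complex.I * (t : ℂ))) ∘ innerSL ℝ k := rfl
  rw [h, (innerSL ℝ k).iteratedFDeriv_comp_right (contDiff_mul_exp_I c (n := m)) x le_rfl]
  refine (ContinuousMultilinearMap.norm_compContinuousLinearMap_le _ _).trans ?_
  rw [norm_iteratedFDeriv_eq_norm_iteratedDeriv, iteratedDeriv_mul_exp_I]
  rw [norm_mul, norm_mul, norm_pow, Complex.norm_I, one_pow, mul_one, mul_comm Complex.I,
    Complex.norm_exp_ofReal_mul_I, mul_one, innerSL_apply_norm, Finset.prod_const,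
    Finset.card_univ, Fintype.card_fin]

/-- The opposite of a point of the quasilattice, for even `Q`. -/
def negEquiv (hQ : Q ≠ 0) (hQe : Even Q) : Quasilattice Q ≃ Quasilattice Q :=
  Function.Involutive.toPerm (fun k => ⟨-k, by
    have := omega_pow_mul_mem hQ (Q / 2) k.2
    rwa [omega_pow_half hQ hQe, neg_one_mul] at this⟩) fun k => by ext1; simp

theorem coe_negEquiv (hQ : Q ≠ 0) (hQe : Even Q) (k : Quasilattice Q) :
    (negEquiv hQ hQe k : ℂ) = -k := rfl

/-- The point `-k` is the image of `k` under `Q/2` successive rotations. Hence real invariant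
coefficients are even and define a real function. -/
theorem RotInvariant.apply_negEquiv {a : Quasilattice Q → ℂ} (ha : RotInvariant a) (hQ : Q ≠ 0)
    (hQe : Even Q) (k : Quasilattice Q) : a (negEquiv hQ hQe k) = a k := by
  have h : ∀ i : ℕ, ∀ k' : Quasilattice Q, (k' : ℂ) = omega Q ^ i * k → a k' = a k := by
    intro i
    induction i with
    | zero => intro k' hk'; rw [pow_zero, one_mul] at hk'; rw [Subtype.ext hk']
    | succ i ih =>
      intro k' hk'
      rw [← ih ⟨_, omega_pow_mul_mem hQ i k.2⟩ rfl]
      refine ha _ _ ?_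
      rw [hk', rot_eq, pow_succ']
      ring
  exact h (Q / 2) _ (by rw [omega_pow_half hQ hQe, coe_negEquiv, neg_one_mul])

theorem inner_mul_mul_of_norm_eq_one {z : ℂ} (hz : ‖z‖ = 1) (k x : ℂ) :
    inner ℝ (z * k) (z * x) = (inner ℝ k x : ℝ) := by
  have h := Complex.conj_mul' z
  rw [hz, Complex.ofReal_one, one_pow] at h
  simp only [Complex.inner, map_mul]
  congr 1
  linear_combination (x * starRingEnd ℂ k) * h

/-- Fourier series with rapidly decaying, real and rotationally invariant coefficients. -/
theorem exists_contDiff_hasSum_planeWave (hQ : Q ≠ 0) (hQe : Even Q) {c : Quasilattice Q → ℂ}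
    (hc : ∀ m : ℕ, Summable fun k => ‖c k‖ * (order k : ℝ) ^ m) (hrot : RotInvariant c)
    (hreal : ∀ k, starRingEnd ℂ (c k) = c k) :
    ∃ u : ℂ → ℝ, ContDiff ℝ (⊤ : ℕ∞) u ∧
      (∀ x, HasSum (fun k : Quasilattice Q => planeWave (c k) k x) (u x : ℂ)) ∧
      ∀ x, u (rot Q x) = u x := by
  have hle : ∀ (m : ℕ) (k : Quasilattice Q), ‖c k‖ * ‖(k : ℂ)‖ ^ m ≤ ‖c k‖ * (order k : ℝ) ^ m :=
    fun m k => by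
      have := norm_le_order k
      gcongr
  have hsmooth : ContDiff ℝ (⊤ : ℕ∞) fun x => ∑' k : Quasilattice Q, planeWave (c k) k x :=
    contDiff_tsum (fun k => contDiff_planeWave _ _) (fun m _ => hc m) fun m k x _ =>
      (norm_iteratedFDeriv_planeWave_le _ _ _ _).trans (hle m k)
  have hsum : ∀ x, Summable fun k : Quasilattice Q => planeWave (c k) k x := fun x => by
    refine Summable.of_norm ((hc 0).congr fun k => ?_)
    rw [planeWave, norm_mul, mul_comm Complex.I, Complex.norm_exp_ofReal_mul_I, pow_zero]
  have him : ∀ x, starRingEnd ℂ (∑' k : Quasilattice Q, planeWave (c k) k x) =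
      ∑' k : Quasilattice Q, planeWave (c k) k x := fun x => by
    rw [Complex.conj_tsum, ← (negEquiv hQ hQe).tsum_eq]
    refine tsum_congr fun k => ?_
    rw [hrot.apply_negEquiv, coe_negEquiv, planeWave, planeWave, map_mul, hreal, ← Complex.exp_conj,
      map_mul, Complex.conj_I, Complex.conj_ofReal, inner_neg_left]
    congr 2
    push_cast
    ring
  refine ⟨fun x => (∑' k : Quasilattice Q, planeWave (c k) k x).re,
    Complex.reCLM.contDiff.comp hsmooth, fun x => ?_, fun x => ?_⟩
  · change HasSum _ (((∑' k : Quasilattice Q, planeWave (c k) k x).re : ℝ) : ℂ)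
    rw [Complex.conj_eq_iff_re.1 (him x)]
    exact (hsum x).hasSum
  · refine congrArg Complex.re ?_
    rw [← (rotEquiv hQ).toEquiv.tsum_eq]
    refine tsum_congr fun k => ?_
    change planeWave (c (rotEquiv hQ k)) (rotEquiv hQ k : ℂ) (rot Q x) = _
    rw [(rotInvariant_iff hQ c).1 hrot, planeWave, coe_rotEquiv, rot_eq,
      inner_mul_mul_of_norm_eq_one (norm_omega Q), planeWave]

end PlaneWaves

/-! ### Rapid decay of the coefficients of the truncated Laplace transform. -/

section RapidDecay

variable {Q : ℕ} {s : ℝ} {V : ℕ → HSpace Q s} {γ K : ℝ}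

theorem coeff_scaled (n : ℕ) (k : Quasilattice Q) :
    coeff (scaled V n) k = ((Real.sqrt (beta Q))⁻¹ : ℝ) * coeff (V n) k := rfl

theorem hasSum_coeff_truncLaplace (hs : 0 ≤ s) (hl : 1 ≤ ell Q) (hV : GevreyBound V γ K)
    (hγ : 0 < γ) (hK : 0 < K) {K' : ℝ} (hK' : K ^ (1 / (4 * (ell Q : ℝ))) < K') {ν : ℝ}
    (hν : 0 ≤ ν) (k : Quasilattice Q) :
    HasSum (fun n => (truncMono (1 / K') (borelExp Q n) ν : ℂ) * coeff (scaled V n) k)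
      (coeff (truncLaplace V K' ν) k) :=
  (coeffCLM hs k).hasSum (hasSum_truncLaplace hl hV hγ hK hK' hν)

/-- On the support of `U⁽ⁿ⁾` the order is at most `2n + 1 ≤ p(n) + 1`. In the double series over `n`
and `k` the factor `N_k^m` thus becomes `(p(n) + 1)^m`, which the Borel denominators absorb; summing
over `n` first gives the claim. -/
theorem summable_norm_coeff_truncLaplace_mul_pow (hs : 0 ≤ s)
    (hw : Summable fun k : Quasilattice Q => (weight s k)⁻¹) (hl : 1 ≤ ell Q)
    (hV : GevreyBound V γ K) (hγ : 0 < γ) (hK : 0 < K) {K' : ℝ}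
    (hK' : K ^ (1 / (4 * (ell Q : ℝ))) < K') {ν : ℝ} (hν : 0 ≤ ν)
    (hord : ∀ n k, coeff (V n) k ≠ 0 → order k ≤ 2 * n + 1) (m : ℕ) :
    Summable fun k => ‖coeff (truncLaplace V K' ν) k‖ * (order k : ℝ) ^ m := by
  have ha := (one_div_lt_radius hK hK').1
  set a := 1 / K' with hadef
  set D := √(∑' k : Quasilattice Q, (weight s k)⁻¹) with hD
  have hTn : ∀ n, 0 ≤ truncMono a (borelExp Q n) ν := fun n => truncMono_nonneg ha.le _ _
  set F : ℕ × Quasilattice Q → ℝ := fun x =>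
    truncMono a (borelExp Q x.1) ν * ‖coeff (scaled V x.1) x.2‖ * (order x.2 : ℝ) ^ m with hF
  have hF0 : 0 ≤ F := fun x => by have := hTn x.1; simp only [hF]; positivity
  have hFle : ∀ n k, F (n, k) ≤ truncMono a (borelExp Q n) ν * ((borelExp Q n : ℝ) + 1) ^ m *
      ‖coeff (scaled V n) k‖ := by
    intro n k
    by_cases h0 : coeff (V n) k = 0
    · simp [hF, coeff_scaled, h0]
    · have h1 : (order k : ℝ) ≤ (borelExp Q n : ℝ) + 1 := by
        have := hord n k h0
        have h2 := le_borelExp hl n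
        exact_mod_cast (by omega : order k ≤ borelExp Q n + 1)
      have := hTn n
      simp only [hF]
      rw [mul_right_comm]
      gcongr
  have hrow : ∀ n, Summable fun k => F (n, k) := fun n =>
    Summable.of_nonneg_of_le (fun k => hF0 _) (hFle n)
      ((summable_norm_coeff hw (scaled V n)).1.mul_left _)
  have hFs : Summable F := by
    refine (summable_prod_of_nonneg hF0).2 ⟨hrow, ?_⟩
    refine Summable.of_nonneg_of_le (fun n => tsum_nonneg fun k => hF0 _) (fun n => ?_)
      ((summable_scaled hl hV hγ hK hK' m).mul_left D)
    have h1 := (hrow n).tsum_le_tsum (hFle n)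
      ((summable_norm_coeff hw (scaled V n)).1.mul_left _)
    rw [tsum_mul_left] at h1
    have h2 := (summable_norm_coeff hw (scaled V n)).2
    have h3 := truncMono_le ha.le (borelExp Q n) ν
    have := hTn n
    calc _ ≤ _ := h1
      _ ≤ (a ^ borelExp Q n / (borelExp Q n).factorial) * ((borelExp Q n : ℝ) + 1) ^ m *
          (D * ‖scaled V n‖) := by gcongr
      _ = _ := by ring
  have hFs' : Summable fun x : Quasilattice Q × ℕ => F x.swap := hFs.prod_symm
  have hcol := (summable_prod_of_nonneg (f := fun x : Quasilattice Q × ℕ => F x.swap)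
    (fun x => hF0 _)).1 hFs'
  refine Summable.of_nonneg_of_le (fun k => by positivity) (fun k => ?_) hcol.2
  have hk := hasSum_coeff_truncLaplace hs hl hV hγ hK hK' hν k
  rw [mul_comm, ← Real.norm_of_nonneg (show 0 ≤ (order k : ℝ) ^ m by positivity),
    ← Complex.norm_real, ← norm_mul]
  refine (hk.mul_left _).norm_le_of_bounded (hcol.1 k).hasSum fun n => le_of_eq ?_
  simp only [hF, Prod.swap]
  rw [norm_mul, norm_mul, Complex.norm_real, Complex.norm_real, Real.norm_of_nonneg (hTn n),
    Real.norm_of_nonneg (by positivity)]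
  ring

theorem exists_contDiff_hasSum_truncLaplace (hQ : Q ≠ 0) (hQe : Even Q) (hs : 0 ≤ s)
    (hw : Summable fun k : Quasilattice Q => (weight s k)⁻¹) (hl : 1 ≤ ell Q)
    (hV : GevreyBound V γ K) (hγ : 0 < γ) (hK : 0 < K) {K' : ℝ}
    (hK' : K ^ (1 / (4 * (ell Q : ℝ))) < K') {ν : ℝ} (hν : 0 ≤ ν)
    (hord : ∀ n k, coeff (V n) k ≠ 0 → order k ≤ 2 * n + 1)
    (hrot : ∀ n, RotInvariant (coeff (V n)))
    (hreal : ∀ n k, starRingEnd ℂ (coeff (V n) k) = coeff (V n) k) :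
    ∃ u : ℂ → ℝ, ContDiff ℝ (⊤ : ℕ∞) u ∧
      (∀ x, HasSum (fun k : Quasilattice Q => coeff (truncLaplace V K' ν) k *
        Complex.exp (Complex.I * ((inner ℝ (k : ℂ) x : ℝ) : ℂ))) (u x : ℂ)) ∧
      ∀ x, u (rot Q x) = u x := by
  have hk := fun k => hasSum_coeff_truncLaplace hs hl hV hγ hK hK' hν k
  refine exists_contDiff_hasSum_planeWave hQ hQe
    (summable_norm_coeff_truncLaplace_mul_pow hs hw hl hV hγ hK hK' hν hord)
    (fun k k' h => ?_) fun k => ?_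
  · refine (hk k').unique ((hk k).congr_fun fun n => ?_)
    rw [coeff_scaled, coeff_scaled, hrot n k k' h]
  · refine HasSum.unique ?_ (hk k)
    refine (Complex.hasSum_conj'.2 (hk k)).congr_fun fun n => ?_
    rw [map_mul, coeff_scaled, map_mul, hreal, Complex.conj_ofReal, Complex.conj_ofReal]

end RapidDecay
end SwiftHohenberg
end

noncomputable section
namespace SwiftHohenberg

open SwiftHohenberg.HSpace

/-! ### Regrouping of multiple series and bilinear products of series. -/

theorem hasSum_sum_antidiagonal {G : Type*} [AddCommGroup G] [TopologicalSpace G]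
    [IsTopologicalAddGroup G] {f : ℕ × ℕ → G} {x : G} (hf : HasSum f x) :
    HasSum (fun n => ∑ p ∈ Finset.HasAntidiagonal.antidiagonal n, f p) x := by
  have h := (Finset.HasAntidiagonal.sigmaAntidiagonalEquivProd (A := ℕ)).hasSum_iff.2 hf
  refine h.sigma fun n => ?_
  rw [← Finset.sum_coe_sort]
  exact hasSum_fintype _

/-- Triples of naturals, the last two grouped by their sum. -/
def sigmaAntidiagonalEquivTriple :
    (Σ x : ℕ × ℕ, Finset.HasAntidiagonal.antidiagonal x.2) ≃ ℕ × (ℕ × ℕ) where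
  toFun y := (y.1.1, y.2.1)
  invFun x := ⟨(x.1, x.2.1 + x.2.2), ⟨x.2, by simp⟩⟩
  left_inv := by
    rintro ⟨⟨i, m⟩, ⟨q, hq⟩⟩
    obtain rfl : q.1 + q.2 = m := by simpa using hq
    rfl
  right_inv _ := rfl

theorem hasSum_sum_sum_antidiagonal {G : Type*} [AddCommGroup G] [TopologicalSpace G]
    [IsTopologicalAddGroup G] {f : ℕ × (ℕ × ℕ) → G} {x : G} (hf : HasSum f x) :
    HasSum (fun n => ∑ p ∈ Finset.HasAntidiagonal.antidiagonal n,
      ∑ q ∈ Finset.HasAntidiagonal.antidiagonal p.2, f (p.1, q)) x := by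
  have h := sigmaAntidiagonalEquivTriple.hasSum_iff.2 hf
  refine hasSum_sum_antidiagonal (f := fun p : ℕ × ℕ =>
    ∑ q ∈ Finset.HasAntidiagonal.antidiagonal p.2, f (p.1, q)) (h.sigma fun p => ?_)
  rw [← Finset.sum_coe_sort]
  exact hasSum_fintype _

section Regrouping

variable {E F G : Type*} [NormedAddCommGroup E] [NormedSpace ℂ E] [NormedAddCommGroup F]
  [NormedSpace ℂ F] [NormedAddCommGroup G] [NormedSpace ℂ G] [CompleteSpace G]

theorem hasSum_bilinear {ι κ : Type*} (B : E →L[ℂ] F →L[ℂ] G) {f : ι → E} {g : κ → F} {x : E} {y : F}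
    (hf : HasSum f x) (hg : HasSum g y) (hfs : Summable fun i => ‖f i‖)
    (hgs : Summable fun j => ‖g j‖) :
    HasSum (fun p : ι × κ => B (f p.1) (g p.2)) (B x y) ∧
      Summable fun p : ι × κ => ‖B (f p.1) (g p.2)‖ := by
  have hs : Summable fun p : ι × κ => ‖B (f p.1) (g p.2)‖ := by
    refine Summable.of_nonneg_of_le (fun _ => norm_nonneg _) (fun p => ?_)
      ((hfs.mul_of_nonneg hgs (fun _ => norm_nonneg _) fun _ => norm_nonneg _).mul_left ‖B‖)
    exact (B.le_opNorm₂ _ _).trans_eq (mul_assoc _ _ _)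
  refine ⟨?_, hs⟩
  have h1 := hs.of_norm.hasSum
  have h2 := h1.prod_fiberwise fun i => (B (f i)).hasSum hg
  have h3 : HasSum (fun i => B (f i) y) (B x y) := (B.flip y).hasSum hf
  rw [h3.unique h2]
  exact h1

end Regrouping

/-! ### The exponentially small residual. -/

section Residual

variable {Q : ℕ} {s : ℝ} {V : ℕ → HSpace Q s} {γ K : ℝ}

theorem inv_sqrt_beta_sq (hQ : 8 ≤ Q) :
    ((((Real.sqrt (beta Q))⁻¹ : ℝ) : ℂ)) ^ 2 = (beta Q : ℂ)⁻¹ := by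
  have hb : 0 ≤ beta Q := by
    have : (8 : ℝ) ≤ Q := by exact_mod_cast hQ
    unfold beta
    linarith
  rw [← Complex.ofReal_pow, inv_pow, Real.sq_sqrt hb, Complex.ofReal_inv]

/-- The recursion satisfied by the rescaled coefficients. -/
theorem linOp_scaled_succ (hQ : 8 ≤ Q) (hV : IsFormalSolution V)
    {B : HSpace Q s →L[ℂ] HSpace Q s →L[ℂ] HSpace Q s}
    (hB : ∀ U W, coeff (B U W) = conv (coeff U) (coeff W)) (n : ℕ) (k : Quasilattice Q) :
    linOp (coeff (scaled V (n + 1))) k = coeff (scaled V n -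
      ∑ p ∈ Finset.HasAntidiagonal.antidiagonal n, ∑ q ∈ Finset.HasAntidiagonal.antidiagonal p.2,
        B (B (scaled V p.1) (scaled V q.1)) (scaled V q.2)) k := by
  have hcoe : ∀ (t : Finset (ℕ × ℕ)) (f : ℕ × ℕ → HSpace Q s),
      coeff (∑ p ∈ t, f p) k = ∑ p ∈ t, coeff (f p) k := fun t f => by
    induction t using Finset.cons_induction with
    | empty => simp
    | cons p t hp ih => rw [Finset.sum_cons, Finset.sum_cons, coeff_add, Pi.add_apply, ih]
  have ht : ∀ i j m, coeff (B (B (scaled V i) (scaled V j)) (scaled V m)) k =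
      (((Real.sqrt (beta Q))⁻¹ : ℝ) : ℂ) * ((beta Q : ℂ)⁻¹ *
        conv (conv (coeff (V i)) (coeff (V j))) (coeff (V m)) k) := by
    intro i j m
    rw [← hB, ← hB, ← inv_sqrt_beta_sq hQ]
    have hsc : ∀ n, scaled V n = (((Real.sqrt (beta Q))⁻¹ : ℝ) : ℂ) • V n := fun n =>
      (Complex.coe_smul _ _).symm
    simp only [hsc, map_smul, _root_.smul_apply, smul_smul, coeff_smul, Pi.smul_apply,
      smul_eq_mul]
    ring
  rw [coeff_sub, Pi.sub_apply, hcoe]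
  simp only [hcoe, ht, ← Finset.mul_sum]
  have h := hV.order_succ n k
  rw [coeff_scaled, ← mul_sub, ← h]
  simp only [linOp, coeff_scaled]
  ring

/-- The recursion of order `n + 1`, multiplied by `T (n + 1)` and summed, represents `(1 + Δ)² Ū`.
Replacing `∑ T (n + 1) • W n` by `ν^(4l) Ū` costs `A`, and replacing the cubic part by `Ū³` costs
`-D`, both `O(e^(-a/ν))` in `H_s`. The residual is exactly `A + D`. The operator `(1 + Δ)²` is
applied only coefficient by coefficient, so no loss of weight occurs. -/
theorem exists_residual_le (hQ : 8 ≤ Q) (hs : 0 ≤ s)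
    (hw : Summable fun k : Quasilattice Q => (weight s k)⁻¹) (hl : 1 ≤ ell Q)
    (hsol : IsFormalSolution V) (hV : GevreyBound V γ K) (hγ : 0 < γ) (hK : 0 < K) {K' : ℝ}
    (hK' : K ^ (1 / (4 * (ell Q : ℝ))) < K') {ν₀ : ℝ} (hν₀ : 0 ≤ ν₀) :
    ∃ C > (0 : ℝ), ∀ ν : ℝ, 0 < ν → ν ≤ ν₀ → ∃ R : HSpace Q s,
      coeff R = shResidual (ν ^ (4 * ell Q)) (coeff (truncLaplace V K' ν)) ∧
      ‖R‖ ≤ C * Real.exp (-(1 / (K' * ν))) := by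
  have ha := (one_div_lt_radius hK hK').1
  have hexp : ∀ ν, -(1 / (K' * ν)) = -(1 / K') / ν := fun ν => by
    rw [neg_div, div_div]
  simp only [hexp]
  set a := 1 / K' with hadef
  obtain ⟨B, hB⟩ := exists_mulCLM hs hw
  obtain ⟨C, hC, hdiff⟩ := exists_abs_pow_mul_truncMono_sub_le ha.le hν₀ (4 * ell Q)
  set W := scaled V with hW
  set y : ℕ → ℝ := fun n => a ^ borelExp Q n / (borelExp Q n).factorial * ‖W n‖ with hy
  have hy0 : ∀ n, 0 ≤ y n := fun n => by positivity
  have hys : Summable y := by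
    have := summable_scaled hl hV hγ hK hK' 0
    simpa only [pow_zero, one_mul] using this
  set Y := ∑' n, y n with hY
  have hY0 : 0 ≤ Y := tsum_nonneg hy0
  have hy2 : HasSum (fun p : ℕ × ℕ => y p.1 * y p.2) (Y * Y) :=
    hys.hasSum.mul hys.hasSum (hys.mul_of_nonneg hys hy0 hy0)
  have hy3 : HasSum (fun p : ℕ × (ℕ × ℕ) => y p.1 * (y p.2.1 * y p.2.2)) (Y * (Y * Y)) :=
    hys.hasSum.mul hy2 (hys.mul_of_nonneg hy2.summable hy0 fun p => mul_nonneg (hy0 _) (hy0 _))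
  -- The summand `1` only makes the constant positive.
  refine ⟨C * Y + 2 * ‖B‖ ^ 2 * (Y * (Y * Y)) + 1, by positivity, fun ν hν hνν₀ => ?_⟩
  set T : ℕ → ℝ := fun n => truncMono a (borelExp Q n) ν with hT
  have hT0 : ∀ n, 0 ≤ T n := fun n => truncMono_nonneg ha.le _ _
  set U := truncLaplace V K' ν with hUdef
  have hU : HasSum (fun n => T n • W n) U := hasSum_truncLaplace hl hV hγ hK hK' hν.le
  have hUn : Summable fun n => ‖T n • W n‖ := by
    refine Summable.of_nonneg_of_le (fun _ => norm_nonneg _) (fun n => ?_) hys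
    rw [norm_smul, Real.norm_of_nonneg (hT0 n)]
    exact mul_le_mul_of_nonneg_right (truncMono_le ha.le _ _) (norm_nonneg _)
  set E := Real.exp (-a / ν) with hE
  -- the linear part
  have hA0 : ∀ n, ‖(T (n + 1) - ν ^ (4 * ell Q) * T n) • W n‖ ≤ C * E * y n := fun n => by
    rw [norm_smul, Real.norm_eq_abs, hy, ← mul_assoc]
    refine mul_le_mul_of_nonneg_right ?_ (norm_nonneg _)
    have := hdiff (borelExp Q n) ν hν hνν₀
    rwa [← borelExp_succ] at this
  have hAs : Summable fun n => (T (n + 1) - ν ^ (4 * ell Q) * T n) • W n :=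
    Summable.of_norm_bounded (hys.mul_left _) hA0
  obtain ⟨A, hA⟩ := hAs
  have hAn : ‖A‖ ≤ C * E * Y := hA.norm_le_of_bounded (hys.hasSum.mul_left _) hA0
  -- the cubic part
  set t : ℕ × (ℕ × ℕ) → HSpace Q s := fun p => B (B (W p.1) (W p.2.1)) (W p.2.2) with ht
  have hcub : HasSum (fun p : ℕ × (ℕ × ℕ) => (T p.1 * T p.2.1 * T p.2.2) • t p) (B (B U U) U) := by
    obtain ⟨h2, h2s⟩ := hasSum_bilinear B hU hU hUn hUn
    obtain ⟨h3, -⟩ := hasSum_bilinear B h2 hU h2s hUn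
    refine ((Equiv.prodAssoc ℕ ℕ ℕ).symm.hasSum_iff.2 h3).congr_fun fun p => ?_
    simp only [Function.comp_def, Equiv.prodAssoc_symm_apply, ht, ← Complex.coe_smul, map_smul,
      _root_.smul_apply, smul_smul]
    congr 1
    push_cast
    ring
  have hD0 : ∀ p : ℕ × (ℕ × ℕ),
      ‖(T p.1 * T p.2.1 * T p.2.2 - T (p.1 + (p.2.1 + p.2.2) + 1)) • t p‖ ≤
        2 * ‖B‖ ^ 2 * E * (y p.1 * (y p.2.1 * y p.2.2)) := by
    rintro ⟨i, j, k⟩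
    have h1 : 1 ≤ borelExp Q i := by have := le_borelExp hl i; omega
    have h2 := abs_truncMono_mul_mul_sub_le (q := borelExp Q j) ha.le h1 (borelExp Q k) hν
    rw [borelExp_add] at h2
    have h3 : ‖t (i, (j, k))‖ ≤ ‖B‖ * (‖B‖ * ‖W i‖ * ‖W j‖) * ‖W k‖ := by
      refine (B.le_opNorm₂ _ _).trans ?_
      gcongr
      exact B.le_opNorm₂ _ _
    rw [norm_smul, Real.norm_eq_abs]
    refine (mul_le_mul h2 h3 (norm_nonneg _) (by positivity)).trans (le_of_eq ?_)
    simp only [hy]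
    ring
  have hDs : Summable fun p : ℕ × (ℕ × ℕ) =>
      (T p.1 * T p.2.1 * T p.2.2 - T (p.1 + (p.2.1 + p.2.2) + 1)) • t p :=
    Summable.of_norm_bounded (hy3.summable.mul_left _) hD0
  obtain ⟨D, hD⟩ := hDs
  have hDn : ‖D‖ ≤ 2 * ‖B‖ ^ 2 * E * (Y * (Y * Y)) := hD.norm_le_of_bounded (hy3.mul_left _) hD0
  -- the recursion, summed
  have hlin : HasSum (fun n => T (n + 1) • W n) (A + ν ^ (4 * ell Q) • U) := by
    refine (hA.add (hU.const_smul (ν ^ (4 * ell Q)))).congr_fun fun n => ?_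
    rw [smul_smul, ← add_smul]
    congr 1
    ring
  have hsub : HasSum (fun p : ℕ × (ℕ × ℕ) => T (p.1 + (p.2.1 + p.2.2) + 1) • t p)
      (B (B U U) U - D) := by
    refine (hcub.sub hD).congr_fun fun p => ?_
    rw [← sub_smul]
    congr 1
    ring
  have hcubic := hasSum_sum_sum_antidiagonal hsub
  have hrec : HasSum (fun n => T (n + 1) • (W n -
      ∑ p ∈ Finset.HasAntidiagonal.antidiagonal n, ∑ q ∈ Finset.HasAntidiagonal.antidiagonal p.2,
        B (B (W p.1) (W q.1)) (W q.2))) (A + ν ^ (4 * ell Q) • U - (B (B U U) U - D)) := by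
    refine (hlin.sub hcubic).congr_fun fun n => ?_
    rw [smul_sub, Finset.smul_sum]
    congr 1
    refine Finset.sum_congr rfl fun p hp => ?_
    rw [Finset.smul_sum]
    refine Finset.sum_congr rfl fun q hq => ?_
    rw [Finset.HasAntidiagonal.mem_antidiagonal] at hp hq
    rw [← hp, ← hq]
  refine ⟨A + D, ?_, ?_⟩
  · funext k
    have h1 := (coeffCLM hs k).hasSum hU
    have h2 := h1.mul_left ((1 - (‖(k : ℂ)‖ : ℂ) ^ 2) ^ 2)
    -- The term of index zero lies in the kernel of `(1 + Δ)²`; dropping it aligns the series with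
    -- the recursion.
    rw [← hasSum_nat_add_iff' 1] at h2
    have h3 := h2.unique (((coeffCLM hs k).hasSum hrec).congr_fun fun n => ?_)
    · have h0 := hsol.order_zero k
      simp only [linOp] at h0
      have h0' : (1 - (‖(k : ℂ)‖ : ℂ) ^ 2) ^ 2 * coeff (W 0) k = 0 := by
        rw [hW, coeff_scaled, mul_left_comm, h0, mul_zero]
      have h0'' : (1 - (‖(k : ℂ)‖ : ℂ) ^ 2) ^ 2 * ((T 0 : ℂ) * coeff (W 0) k) = 0 := by
        rw [mul_left_comm, h0', mul_zero]
      simp only [coeffCLM_apply, Finset.sum_range_one, coeff_add, coeff_sub, coeff_real_smul,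
        Pi.add_apply, Pi.sub_apply, Pi.smul_apply, smul_eq_mul, h0'', sub_zero] at h3
      rw [shResidual, linOp, h3, coeff_add, Pi.add_apply, ← hB, ← hB]
      push_cast
      ring
    · have h4 := linOp_scaled_succ hQ hsol hB n k
      simp only [coeffCLM_apply, coeff_real_smul, Pi.smul_apply, smul_eq_mul]
      rw [← h4, linOp]
      ring
  · calc ‖A + D‖ ≤ ‖A‖ + ‖D‖ := norm_add_le _ _
      _ ≤ C * E * Y + 2 * ‖B‖ ^ 2 * E * (Y * (Y * Y)) + E := by
        have : 0 ≤ E := Real.exp_nonneg _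
        linarith
      _ = _ := by ring

end Residual
end SwiftHohenberg
end

/-! ### The main theorem. -/

theorem theorem3 (Q : ℕ) (hQ : Even Q) (hQ8 : 8 ≤ Q) (s : ℝ) (hs : (Q : ℝ) / 4 < s) :
    ∃ U : ℕ → HSpace Q s,
      IsFormalSolution U ∧
      (∀ V : ℕ → HSpace Q s, IsFormalSolution V → V = U) ∧
      (∃ K > (0 : ℝ), ∃ γ > (0 : ℝ), GevreyBound U γ K) ∧
      ∀ K > (0 : ℝ), ∀ γ > (0 : ℝ), GevreyBound U γ K →
        -- the Borel transform converges and is analytic in the disc of radius `K^{-1/(4l)}`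
        (∀ ζ ∈ Metric.ball (0 : ℂ) (K ^ (-(1 / (4 * (ell Q : ℝ))))), Summable (borelTerm U ζ)) ∧
        AnalyticOnNhd ℂ (borelTransform U) (Metric.ball (0 : ℂ) (K ^ (-(1 / (4 * (ell Q : ℝ)))))) ∧
        ∀ K' : ℝ, K ^ (1 / (4 * (ell Q : ℝ))) < K' →
          (∀ ν > (0 : ℝ), IntervalIntegrable
            (fun ζ : ℝ => Real.exp (-ζ / ν) • borelTransform U (ζ : ℂ)) MeasureTheory.volume 0 (1 / K')) ∧
          -- smoothness in `ν`, up to `ν = 0`, with values in `H_s`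
          ContDiffOn ℝ (⊤ : ℕ∞) (truncLaplace U K') (Set.Ici 0) ∧
          -- the formal series is an asymptotic expansion
          (∀ N : ℕ,
            (fun μ : ℝ => truncLaplace U K' (μ ^ (1 / (4 * (ell Q : ℝ)))) -
              Real.sqrt (μ / beta Q) • ∑ n ∈ Finset.range N, μ ^ n • U n)
              =O[𝓝[>] 0] fun μ : ℝ => Real.sqrt μ * μ ^ N) ∧
          -- a real, smooth, `Q`-fold quasiperiodic function of the position
          (∀ μ > (0 : ℝ), ∃ u : ℂ → ℝ, ContDiff ℝ (⊤ : ℕ∞) u ∧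
            (∀ x : ℂ, HasSum (fun k : Quasilattice Q =>
              coeff (truncLaplace U K' (μ ^ (1 / (4 * (ell Q : ℝ))))) k *
                Complex.exp (Complex.I * ((inner ℝ (k : ℂ) x : ℝ) : ℂ))) (u x : ℂ)) ∧
            ∀ x : ℂ, u (rot Q x) = u x) ∧
          -- the residual is exponentially small in `H_{s-4}`
          ∀ μ₀ > (0 : ℝ), ∃ C > (0 : ℝ), ∀ μ : ℝ, 0 < μ → μ ≤ μ₀ →
            ∃ R : HSpace Q (s - 4),
              coeff R = shResidual μ (coeff (truncLaplace U K' (μ ^ (1 / (4 * (ell Q : ℝ)))))) ∧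
              ‖R‖ ≤ C * Real.exp (-(1 / (K' * μ ^ (1 / (4 * (ell Q : ℝ)))))) := by
  have hQ0 : Q ≠ 0 := by omega
  have hs0 : 0 ≤ s := (div_nonneg (Nat.cast_nonneg Q) (by norm_num)).trans hs.le
  have hw := summable_inv_weight hQ hQ0 hs
  have hl := (ell_pos hQ hQ8).1
  -- Any wavevector can serve to read off the solvability condition; by uniqueness the choice does
  -- not matter.
  obtain ⟨P, hP⟩ := exists_isPolySolution (⟨0, by omega⟩ : Fin Q)
  have hsol : IsFormalSolution fun n => toH s (P n) := hP.isFormalSolution hQ hQ8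
  refine ⟨fun n => toH s (P n), hsol, fun V hV => funext fun n =>
    hP.eq_of_isFormalSolution hQ hQ8 hV n, hP.gevreyBound hQ hQ8 hs0 hw, ?_⟩
  intro K hK γ hγ hG
  refine ⟨fun ζ hζ => summable_borelTerm hl hG hγ hK hζ,
    analyticOnNhd_borelTransform hl hG hγ hK, fun K' hK' => ?_⟩
  refine ⟨fun ν _ => intervalIntegrable_borelTransform hl hG hγ hK hK' ν,
    contDiffOn_truncLaplace hl hG hγ hK hK',
    fun N => truncLaplace_rpow_sub_isBigO hl hG hγ hK hK' N, fun μ hμ => ?_, fun μ₀ hμ₀ => ?_⟩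
  · exact exists_contDiff_hasSum_truncLaplace hQ0 hQ hs0 hw hl hG hγ hK hK'
      (Real.rpow_nonneg hμ.le _) (fun n => hP.orderLE n) hsol.invariant fun n =>
        ((mem_invariantSubring hQ0 _).1 (hP.mem_invariantSubring hQ0 n)).2
  · obtain ⟨C, hC, h⟩ := exists_residual_le hQ8 hs0 hw hl hsol hG hγ hK hK'
      (Real.rpow_nonneg hμ₀.le (1 / (4 * (ell Q : ℝ))))
    refine ⟨C, hC, fun μ hμ hμμ₀ => ?_⟩
    obtain ⟨R, hR, hRn⟩ := h (μ ^ (1 / (4 * (ell Q : ℝ)))) (Real.rpow_pos_of_pos hμ _)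
      (Real.rpow_le_rpow hμ.le hμμ₀ (by positivity))
    -- The estimate already holds in the stronger norm of `H_s`.
    obtain ⟨R', hR', hRn'⟩ := exists_inclusion (show s - 4 ≤ s by linarith) R
    refine ⟨R', ?_, hRn'.trans hRn⟩
    rw [hR', hR, rpow_inv_pow hμ.le hl]
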